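/- Let $0<q<1$ and $0<t<1$ be real numbers. A partition is a weakly decreasing sequence $\lambda=(\lambda_1,\lambda_2,\dots)$ of non-negative integers with finite sum $|\lambda|$; partitions are added termwise, and $(s^r)=(s,\dots,s)$ ($r$ entries). Let $\Lambda_n$ be the ring of symmetric polynomials in $n$ variables with real coefficients and $\Lambda=\varprojlim_n\Lambda_n$ the ring of symmetric functions (graded limit along $x_{n+1}=0$). Let $m_\lambda$ be the monomial symmetric functions and $p_\lambda$ the power sum products, and let $\langle\,,\rangle_{q,t}$ be the scalar product on $\Lambda$ with $\langle p_\lambda,p_\mu\rangle_{q,t}=\delta_{\lambda\mu}\prod_r r^{k_r}k_r!\prod_{i}\frac{1-q^{\lambda_i}}{1-t^{\lambda_i}}$, where $k_r$ is the number of parts of $\lambda$ equal to $r$ and $i$ runs over the nonzero parts. There is a unique family of symmetric functions $P_\lambda=P_\lambda(x;q,t)\in\Lambda$ (the Macdonald symmetric functions) with $P_\lambda\in m_\lambda+\sum_{\mu<\lambda}\mathbb R\,m_\mu$ for the dominance order and $\langle P_\lambda,P_\mu\rangle_{q,t}=0$ for $\lambda\ne\mu$. Put $(a;q)_\infty=\prod_{k\ge0}(1-aq^k)$,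 $\bar y=(1/y_1,1/y_2,\dots)$, $$\Pi(x,y)=\prod_{i,j}\frac{(tx_iy_j;q)_\infty}{(x_iy_j;q)_\infty},\qquad \Delta(x)=\prod_{i\ne j}\frac{(x_i/x_j;q)_\infty}{(tx_i/x_j;q)_\infty},$$ $$\langle f,g\rangle'_{n}=\frac1{n!}\oint_{|x_j|=1}\prod_{j=1}^n\frac{dx_j}{2\pi i x_j}\,f(\bar x)g(x)\Delta(x),\qquad (\mathcal G_sf)(x)=\prod_i x_i^s\cdot f(x),$$ $$(\mathcal N_{n,m}f)(x_1,\dots,x_n)=\oint\prod_{j=1}^m\frac{dy_j}{2\pi i y_j}\,\Pi(x,\bar y)\Delta(y)f(y),$$ where all $y_j$ run over one circle $|y_j|=R$ with $R>\max_i|x_i|$. The element $\mathcal N_{\infty,m}f\in\Lambda$ is the one whose image in $n$ variables is $\mathcal N_{n,m}f$, for every $n$. Let $N\ge0$, let $0\le r_1<r_2<\dots<r_N$ and $s_1,\dots,s_N\ge0$ be integers, and put $\lambda^{(a)}=(s_a^{r_a})+\dots+(s_1^{r_1})$ and $\lambda=\lambda^{(N)}$ (with $\lambda=(0)$ if $N=0$).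 Every partition is of this form. Let $$C^+_\lambda=\prod_{a=1}^N\frac{\langle P_{\lambda^{(a)}},P_{\lambda^{(a)}}\rangle_{q,t}}{r_a!\,\langle P_{\lambda^{(a)}},P_{\lambda^{(a)}}\rangle'_{r_a}}.$$ Then $$P_\lambda(x;q,t)=C^+_\lambda\;\mathcal N_{\infty,r_N}\mathcal G_{s_N}\mathcal N_{r_N,r_{N-1}}\cdots\mathcal G_{s_2}\mathcal N_{r_2,r_1}\mathcal G_{s_1}\cdot 1$$ (for $N=0$ the right-hand side is $1$), and, for all $n$, all $x\in\mathbb C^n$ and all radii $\rho_1>\rho_2>\dots>\rho_N>0$ with $\rho_N>\max_i|x_i|$, $$P_\lambda(x_1,\dots,x_n;q,t)=C^+_\lambda\oint_{|x^a_j|=\rho_a}\prod_{a=1}^N\prod_{j=1}^{r_a}\frac{dx^a_j}{2\pi i x^a_j}\bigl(x^a_j\bigr)^{s_a}\cdot\prod_{a=1}^N\Pi(x^{a+1},\overline{x^a})\,\Delta(x^a),\qquad x^{N+1}=x .$$ -/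

import Mathlib

noncomputable section

namespace MacdonaldInt

open scoped BigOperators

/-! ### Partitions -/

/-- Partitions: weakly decreasing sequences of non-negative integers with finitely many nonzero
terms (`lam 0` is the first part), with termwise addition. -/
def Ptn : AddSubmonoid (ℕ →₀ ℕ) where
  carrier := {f | Antitone f}
  zero_mem' := fun _ _ _ => le_rfl
  add_mem' := fun ha hb _ _ h => add_le_add (ha h) (hb h)

/-- The rectangle `(s^r) = (s, …, s)` with `r` entries. -/
def rect (s r : ℕ) : Ptn :=
  ⟨Finsupp.onFinset (Finset.range r) (fun i => if i < r then s else 0) (by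
      intro i hi
      by_contra h
      simp at h
      simp [Nat.not_lt.mpr h] at hi), by
    intro i j hij
    simp only [Finsupp.onFinset_apply]
    split_ifs <;> omega⟩

/-- The strict dominance order: `mu < lam` in the natural partial ordering. -/
def DomLT (mu lam : Ptn) : Prop :=
  mu ≠ lam ∧ mu.1.degree = lam.1.degree ∧
    ∀ k, ∑ i ∈ Finset.range k, mu.1 i ≤ ∑ i ∈ Finset.range k, lam.1 i

/-! ### The ring of symmetric functions -/

/-- Sequences of polynomials, the `n`-th one in the `n` variables `x_1, …, x_n`. -/
abbrev PolySeq : Type := ∀ n : ℕ, MvPolynomial (Fin n) ℝ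

/-- The homomorphism `f(x_1, …, x_n, x_{n+1}) ↦ f(x_1, …, x_n, 0)`. -/
def dropLast (n : ℕ) : MvPolynomial (Fin (n + 1)) ℝ →ₐ[ℝ] MvPolynomial (Fin n) ℝ :=
  MvPolynomial.aeval
    (Fin.snoc (α := fun _ => MvPolynomial (Fin n) ℝ) (fun i => MvPolynomial.X i) 0)

/-- The ring of symmetric functions with real coefficients: the (graded) projective limit of the
rings of symmetric polynomials in `n` variables, i.e. the compatible sequences of symmetric
polynomials of bounded degree. -/
def SymFun : Subalgebra ℝ PolySeq where
  carrier := {f | (∀ n, (f n).IsSymmetric) ∧ (∀ n, dropLast n (f (n + 1)) = f n) ∧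
    ∃ d, ∀ n, (f n).totalDegree ≤ d}
  mul_mem' := by
    rintro f g ⟨h1, h2, d, h3⟩ ⟨k1, k2, e, k3⟩
    exact ⟨fun n => (h1 n).mul (k1 n), fun n => by simp [h2, k2], d + e, fun n =>
      (MvPolynomial.totalDegree_mul _ _).trans (add_le_add (h3 n) (k3 n))⟩
  add_mem' := by
    rintro f g ⟨h1, h2, d, h3⟩ ⟨k1, k2, e, k3⟩
    exact ⟨fun n => (h1 n).add (k1 n), fun n => by simp [h2, k2], max d e, fun n =>
      (MvPolynomial.totalDegree_add _ _).trans (max_le_max (h3 n) (k3 n))⟩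
  algebraMap_mem' := fun c =>
    ⟨fun n => MvPolynomial.IsSymmetric.C c, fun n => by
      simp [Pi.algebraMap_apply], 0, fun n => by
      simp [Pi.algebraMap_apply, MvPolynomial.algebraMap_eq]⟩

/-- The monomial symmetric function `m_lam`: in `n` variables, the sum of `x^α` over the distinct
permutations `α` of `(lam_1, …, lam_n)`, and zero if `lam` has more than `n` parts. -/
def monomialSym (lam : Ptn) : PolySeq := fun n =>
  open Classical in
  if ∀ i, n ≤ i → lam.1 i = 0 then
    ∑ α ∈ Finset.univ.image (fun (σ : Equiv.Perm (Fin n)) (i : Fin n) => lam.1 (σ i : ℕ)),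
      ∏ i, MvPolynomial.X i ^ α i
  else 0

/-- The substitution of the power sums `p_r = ∑ x_i ^ r`, `r ≥ 1`, for indeterminates. The monomial
with exponents `m` is sent to `p_lam` for `lam = (1^{m 1} 2^{m 2} ⋯)`. -/
def powerSumMap : MvPolynomial ℕ+ ℝ →ₐ[ℝ] PolySeq :=
  MvPolynomial.aeval (fun (r : ℕ+) (n : ℕ) => MvPolynomial.psum (Fin n) ℝ (r : ℕ))

/-- The expansion of a symmetric function in the basis `p_lam`, as a polynomial in the (algebraically
independent and generating) power sums. -/
def powerSumExpansion (f : SymFun) : MvPolynomial ℕ+ ℝ :=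
  Function.invFun powerSumMap (f : PolySeq)

/-- `z_lam(q,t) = ∏ r^{m_r} m_r! ∏_i (1 - q^{lam_i}) / (1 - t^{lam_i})`
for `lam = (1^{m 1} 2^{m 2} ⋯)`. -/
def zWeight (q t : ℝ) (m : ℕ+ →₀ ℕ) : ℝ :=
  m.prod fun r k => ((r : ℕ) : ℝ) ^ k * (k.factorial : ℝ) *
    ((1 - q ^ (r : ℕ)) / (1 - t ^ (r : ℕ))) ^ k

/-- The scalar product `⟨f, g⟩_{q,t}`, bilinear with `⟨p_lam, p_mu⟩ = δ_{lam,mu} z_lam(q,t)`. -/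
def scalar (q t : ℝ) (f g : SymFun) : ℝ :=
  ∑ m ∈ (powerSumExpansion f).support,
    (powerSumExpansion f).coeff m * (powerSumExpansion g).coeff m * zWeight q t m

/-! ### Macdonald symmetric functions -/

/-- The two defining conditions of the Macdonald symmetric functions: `P_lam` is `m_lam` plus a
linear combination of the `m_mu` with `mu < lam`, and `⟨P_lam, P_mu⟩_{q,t} = 0` for `lam ≠ mu`. -/
structure IsMacdonaldFamily (q t : ℝ) (P : Ptn → SymFun) : Prop where
  triangular : ∀ lam, (P lam : PolySeq) - monomialSym lam ∈
    Submodule.span ℝ (monomialSym '' {mu | DomLT mu lam})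
  orthogonal : ∀ lam mu, lam ≠ mu → scalar q t (P lam) (P mu) = 0

/-- The Macdonald symmetric functions `P_lam(x;q,t)`. -/
def macdonaldP (q t : ℝ) : Ptn → SymFun :=
  Classical.epsilon (IsMacdonaldFamily q t)

/-! ### Kernels and contour integrals -/

/-- `(a;q)_∞ = ∏_{k ≥ 0} (1 - a q^k)`. -/
def qPoch (a : ℂ) (q : ℝ) : ℂ := ∏' k : ℕ, (1 - a * (q : ℂ) ^ k)

/-- `Π(x,y;q,t) = ∏_{i,j} (t x_i y_j;q)_∞ / (x_i y_j;q)_∞`. -/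
def kerPi (q t : ℝ) {n m : ℕ} (x : Fin n → ℂ) (y : Fin m → ℂ) : ℂ :=
  ∏ i, ∏ j, qPoch (t * (x i * y j)) q / qPoch (x i * y j) q

/-- `Δ(x;q,t) = ∏_{i ≠ j} (x_i/x_j;q)_∞ / (t x_i/x_j;q)_∞`. -/
def kerDelta (q t : ℝ) {n : ℕ} (x : Fin n → ℂ) : ℂ :=
  ∏ p ∈ (Finset.univ : Finset (Fin n)).offDiag,
    qPoch (x p.1 / x p.2) q / qPoch (t * (x p.1 / x p.2)) q

/-- The contour integral `∮ ∏_i dx_i / (2π i x_i) F(x)` over the positively oriented circles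
`|x_i| = R_i`: with `x_i = R_i e^{√-1 θ_i}` one has `dx_i / (2π √-1 x_i) = dθ_i / (2π)`. -/
def contour {ι : Type*} [Fintype ι] (R : ι → ℝ) (F : (ι → ℂ) → ℂ) : ℂ :=
  ((2 * Real.pi : ℂ) ^ Fintype.card ι)⁻¹ *
    ∫ θ in Set.Icc (0 : ι → ℝ) (fun _ => 2 * Real.pi), F (fun i => circleMap 0 (R i) (θ i))

/-- `contour` in terms of Mathlib's integral over a torus. -/
theorem contour_eq_torusIntegral {n : ℕ} (R : Fin n → ℝ) (hR : ∀ i, R i ≠ 0)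
    (F : (Fin n → ℂ) → ℂ) :
    contour R F = torusIntegral (fun x => (∏ i, (2 * Real.pi * Complex.I * x i)⁻¹) * F x) 0 R := by
  unfold contour torusIntegral
  rw [← MeasureTheory.integral_const_mul]
  refine MeasureTheory.integral_congr_ae (Filter.Eventually.of_forall fun θ => ?_)
  have h : torusMap (0 : Fin n → ℂ) R θ = fun i => circleMap 0 (R i) (θ i) := by
    ext i
    simp [torusMap, circleMap]
  simp only [h, smul_eq_mul, ← mul_assoc, ← Finset.prod_mul_distrib]
  congr 1
  rw [← Finset.card_univ, ← inv_pow, ← Finset.prod_const]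
  refine Finset.prod_congr rfl fun i _ => ?_
  have h1 : (R i : ℂ) ≠ 0 := by exact_mod_cast hR i
  have h2 : (Real.pi : ℂ) ≠ 0 := by exact_mod_cast Real.pi_ne_zero
  simp only [circleMap, zero_add]
  field_simp

/-- The scalar product
`⟨f,g⟩'_{n;q,t} = (1/n!) ∮ ∏_j dx_j / (2π i x_j) f(1/x) g(x) Δ(x;q,t)`. -/
def scalar' (q t : ℝ) {n : ℕ} (f g : MvPolynomial (Fin n) ℝ) : ℂ :=
  (n.factorial : ℂ)⁻¹ * contour (fun _ : Fin n => (1 : ℝ)) (fun x =>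
    MvPolynomial.aeval (fun i => (x i)⁻¹) f * MvPolynomial.aeval x g * kerDelta q t x)

/-! ### The maps `G_s` and `N_{n,m}` -/

/-- `(G_s f)(x) = ∏_i x_i^s · f(x)`. -/
def opG (s : ℕ) {r : ℕ} (f : (Fin r → ℂ) → ℂ) (x : Fin r → ℂ) : ℂ :=
  (∏ i, x i ^ s) * f x

/-- `(N_{n,m} f)(x) = ∮ ∏_j dy_j / (2π i y_j) Π(x,1/y;q,t) Δ(y;q,t) f(y)`, with all `|y_j|` equal to
one radius larger than all `|x_i|` (for polynomial `f` the value does not depend on it).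
An element of the projective limit is given by its images in finitely many variables, so
`N_{∞,m} f` is the sequence of the `N_{n,m} f`, `n ≥ 0`. -/
def opN (q t : ℝ) {m : ℕ} (n : ℕ) (f : (Fin m → ℂ) → ℂ) (x : Fin n → ℂ) : ℂ :=
  contour (fun _ : Fin m => ‖x‖ + 1) (fun y => kerPi q t x y⁻¹ * kerDelta q t y * f y)

/-- `N_{n,r_N} G_{s_N} N_{r_N,r_{N-1}} ⋯ G_{s_2} N_{r_2,r_1} G_{s_1} · 1` as a function of `n`
variables (the constant `1` for `N = 0`). -/
def iterNG (q t : ℝ) : (N : ℕ) → (r s : Fin N → ℕ) → (n : ℕ) → (Fin n → ℂ) → ℂ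
  | 0, _, _, _ => fun _ => 1
  | N + 1, r, s, n => opN q t n (opG (s (Fin.last N))
      (iterNG q t N (fun a => r a.castSucc) (fun a => s a.castSucc) (r (Fin.last N))))

/-! ### The multiple integral and the constant -/

/-- The set of variables `x^{a+1}`, where `x^{N+1} = x`, together with its number. -/
def nextVars {N n : ℕ} {r : Fin N → ℕ} (x : Fin n → ℂ) (X : ∀ a, Fin (r a) → ℂ) (a : Fin N) :
    Σ k : ℕ, (Fin k → ℂ) :=
  if h : (a : ℕ) + 1 < N then ⟨r ⟨a + 1, h⟩, X ⟨a + 1, h⟩⟩ else ⟨n, x⟩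

/-- `∏_a ∏_j (x^a_j)^{s_a} · ∏_a Π(x^{a+1},1/x^a;q,t) Δ(x^a;q,t)`. -/
def integrand (q t : ℝ) {N n : ℕ} {r : Fin N → ℕ} (s : Fin N → ℕ) (x : Fin n → ℂ)
    (X : ∀ a, Fin (r a) → ℂ) : ℂ :=
  (∏ a, ∏ j, X a j ^ s a) *
    ∏ a, (kerPi q t (nextVars x X a).2 (X a)⁻¹ * kerDelta q t (X a))

/-- The partial partitions `lam^{(a)} = (s_a^{r_a}) + ⋯ + (s_1^{r_1})`. -/
def partialPtn {N : ℕ} (r s : Fin N → ℕ) (a : Fin N) : Ptn :=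
  ∑ b ∈ Finset.Iic a, rect (s b) (r b)

/-- `C^+_lam = ∏_a ⟨P,P⟩_{q,t} / (r_a! ⟨P,P⟩'_{r_a;q,t})` with `P = P_{lam^{(a)}}`. -/
def Cplus (q t : ℝ) {N : ℕ} (r s : Fin N → ℕ) : ℂ :=
  ∏ a, ((scalar q t (macdonaldP q t (partialPtn r s a))
      (macdonaldP q t (partialPtn r s a)) : ℝ) : ℂ) /
    (((r a).factorial : ℂ) *
      scalar' q t ((macdonaldP q t (partialPtn r s a)).1 (r a))
        ((macdonaldP q t (partialPtn r s a)).1 (r a)))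

end MacdonaldInt

end

open MacdonaldInt

/-! The ring of symmetric functions is replaced by the polynomial ring in the power sums, to which
it is isomorphic (`powerSumMap_injective`, `exists_powerSumMap_eq`). On it lives the Macdonald
operator E = ∑ g_k s_k (`macOp`). Here g_k is the coefficient of z^k in ∏_j (1 - z x_j / t) / (1 - z
x_j), and s_k takes the coefficient of z^k after p_r ↦ p_r + (q^r - 1) z^r. For ⟨ , ⟩_{q,t} the
adjoint of multiplication by g_k is t^{-k} s_k, so each summand, and hence E, is self-adjoint
(`pairing_macOp`).

In n variables, t^n E is 1 + (t - 1) ∑_i ∏_{j ≠ i} (t x_i - x_j) / (x_i - x_j) · T_i, where T_i is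
the shift x_i ↦ q x_i (`psEval_macOp`). This formula shows that E is triangular on the m_λ for the
dominance order, with diagonal entries that differ for comparable partitions (`eig_ne_of_domLT`). So
there are eigenvectors m_λ + lower terms (`eigP`).

E is also self-adjoint for the torus product with weight Δ (`torusInt_macOp`). The functional
equation of (z;q)_∞ absorbs the denominators of the operator into Δ, and moving the circle |x_i| = 1
to |x_i| = 1/q moves T_i from one argument to the other. Self-adjointness gives orthogonality of
eigenvectors with different eigenvalues. Eigenvalues of incomparable partitions may coincide, but
only for finitely many q, so continuity in q gives orthogonality for both products
(`form_eigP_eq_zero`). With positivity of ⟨ , ⟩_{q,t}, the eigenvectors are the unique Macdonald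
family.

For the integral formula, expand Π(x,y) = ∑ z_μ^{-1} p_μ(x) p_μ(y) (`hasSum_kerTerm`). Since the P_μ
span and are orthogonal for both products, u ↦ ⟨u, P_λ⟩' is a multiple of u ↦ ⟨u, P_λ⟩_{q,t}
(`torusInt_eigP_right`). Termwise integration therefore shows that N_{n,m} sends P_λ in m variables
to a constant times P_λ in n variables (`contour_kerPi`). Moreover, ∏ x_i^s · P_λ = P_{λ + (s^n)} in
n variables when λ has at most n parts (`toVars_eigP_add_rect`). Starting from P_0 = 1, the maps G
and N thus build λ rectangle by rectangle, and C^+ collects the inverse constants. The multiple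
integral is the same iteration after Fubini. -/

noncomputable section

namespace MacdonaldInt

open MvPolynomial

/-! ### The scalar product on polynomials in the power sums -/

/-- Polynomials in the power sums `p_1, p_2, …`. -/
abbrev PowSum : Type := MvPolynomial ℕ+ ℝ

/-- The scalar product `⟨f, g⟩_{q,t}` on polynomials in the power sums. -/
def pairing (q t : ℝ) (u v : PowSum) : ℝ :=
  ∑ m ∈ u.support, u.coeff m * v.coeff m * zWeight q t m

theorem pairing_eq_sum {q t : ℝ} {u : PowSum} (v : PowSum) {s : Finset (ℕ+ →₀ ℕ)}
    (h : u.support ⊆ s) :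
    pairing q t u v = ∑ m ∈ s, u.coeff m * v.coeff m * zWeight q t m :=
  Finset.sum_subset h fun m _ hm => by
    rw [notMem_support_iff.1 hm, zero_mul, zero_mul]

theorem pairing_comm (q t : ℝ) (u v : PowSum) : pairing q t u v = pairing q t v u := by
  classical
  rw [pairing_eq_sum v (Finset.subset_union_left (s₂ := v.support)),
    pairing_eq_sum u (Finset.subset_union_right (s₁ := u.support))]
  exact Finset.sum_congr rfl fun m _ => by ring

theorem pairing_add_left (q t : ℝ) (u u' v : PowSum) :
    pairing q t (u + u') v = pairing q t u v + pairing q t u' v := by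
  classical
  rw [pairing_eq_sum v (support_add (p := u) (q := u')),
    pairing_eq_sum v (Finset.subset_union_left (s₁ := u.support) (s₂ := u'.support)),
    pairing_eq_sum v (Finset.subset_union_right (s₁ := u.support) (s₂ := u'.support)),
    ← Finset.sum_add_distrib]
  exact Finset.sum_congr rfl fun m _ => by rw [coeff_add]; ring

theorem pairing_smul_left (q t c : ℝ) (u v : PowSum) :
    pairing q t (c • u) v = c * pairing q t u v := by
  rw [pairing_eq_sum v (support_smul (a := c) (f := u)), pairing, Finset.mul_sum]
  exact Finset.sum_congr rfl fun m _ => by rw [coeff_smul, smul_eq_mul]; ring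

/-- `pairing` as a bilinear form. -/
def pairingForm (q t : ℝ) : PowSum →ₗ[ℝ] PowSum →ₗ[ℝ] ℝ :=
  LinearMap.mk₂ ℝ (pairing q t) (pairing_add_left q t) (pairing_smul_left q t)
    (fun u v w => by
      rw [pairing_comm, pairing_add_left, pairing_comm q t v, pairing_comm q t w])
    (fun c u v => by rw [pairing_comm, pairing_smul_left, pairing_comm q t v]; rfl)

@[simp] theorem pairingForm_apply (q t : ℝ) (u v : PowSum) :
    pairingForm q t u v = pairing q t u v := rfl

theorem pairing_monomial_left (q t c : ℝ) (m : ℕ+ →₀ ℕ) (v : PowSum) :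
    pairing q t (monomial m c) v = c * v.coeff m * zWeight q t m := by
  classical
  rw [pairing_eq_sum v (support_monomial_subset (s := m) (a := c)), Finset.sum_singleton,
    coeff_monomial, if_pos rfl]

theorem zWeight_pos {q t : ℝ} (hq0 : 0 < q) (hq1 : q < 1) (ht0 : 0 < t) (ht1 : t < 1)
    (m : ℕ+ →₀ ℕ) : 0 < zWeight q t m := by
  refine Finset.prod_pos fun r _ => ?_
  have h1 : q ^ (r : ℕ) < 1 := pow_lt_one₀ hq0.le hq1 r.ne_zero
  have h2 : t ^ (r : ℕ) < 1 := pow_lt_one₀ ht0.le ht1 r.ne_zero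
  have h3 : (0 : ℝ) < (r : ℕ) := by exact_mod_cast r.pos
  have h4 : 0 < (1 - q ^ (r : ℕ)) / (1 - t ^ (r : ℕ)) := div_pos (by linarith) (by linarith)
  positivity

theorem pairing_self_pos {q t : ℝ} (hq0 : 0 < q) (hq1 : q < 1) (ht0 : 0 < t) (ht1 : t < 1)
    {u : PowSum} (hu : u ≠ 0) : 0 < pairing q t u u := by
  refine Finset.sum_pos (fun m hm => ?_) (Finset.nonempty_of_ne_empty (by simpa using hu))
  have := zWeight_pos hq0 hq1 ht0 ht1 m
  have h2 := mul_self_pos.2 (mem_support_iff.1 hm)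
  positivity

/-- The adjoint of multiplication by `p_r` is this multiple of `∂/∂p_r`. -/
def adjFactor (q t : ℝ) (r : ℕ+) : ℝ := (r : ℕ) * ((1 - q ^ (r : ℕ)) / (1 - t ^ (r : ℕ)))

theorem zWeight_add_single (q t : ℝ) (m : ℕ+ →₀ ℕ) (r : ℕ+) :
    zWeight q t (m + Finsupp.single r 1) = zWeight q t m * adjFactor q t r * (m r + 1) := by
  classical
  have key : ∀ m : ℕ+ →₀ ℕ, ∀ s : Finset ℕ+, m.support ⊆ s → zWeight q t m =
      ∏ r ∈ s, (((r : ℕ) : ℝ) ^ m r * ((m r).factorial : ℝ) *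
        ((1 - q ^ (r : ℕ)) / (1 - t ^ (r : ℕ))) ^ m r) := fun m s hs =>
    Finsupp.prod_of_support_subset _ hs _ fun i _ => by simp
  have hm : m.support ⊆ insert r m.support := Finset.subset_insert _ _
  have hm' : (m + Finsupp.single r 1).support ⊆ insert r m.support := by
    intro i hi
    by_cases h : i = r
    · simp [h]
    · simp [Ne.symm h] at hi
      simp [hi]
  rw [key _ _ hm, key _ _ hm', ← Finset.mul_prod_erase _ _ (Finset.mem_insert_self r _),
    ← Finset.mul_prod_erase (insert r m.support) _ (Finset.mem_insert_self r _)]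
  have : ∀ i ∈ (insert r m.support).erase r, (m + Finsupp.single r 1 : ℕ+ →₀ ℕ) i = m i :=
    fun i hi => by simp [Finset.ne_of_mem_erase hi]
  rw [Finset.prod_congr rfl fun i hi => by rw [this i hi]]
  simp only [Finsupp.add_apply, Finsupp.single_eq_same, Nat.factorial_succ, adjFactor]
  push_cast
  ring

/-- On monomials both sides read off one coefficient of v: the factor m_r + 1 produced by `pderiv`
is the one by which the weight z grows when a part r is added. -/
theorem pairing_X_mul (q t : ℝ) (r : ℕ+) (u v : PowSum) :
    pairing q t (X r * u) v = adjFactor q t r * pairing q t u (pderiv r v) := by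
  induction u using MvPolynomial.induction_on' with
  | monomial m c =>
    have : X r * monomial m c = monomial (m + Finsupp.single r 1) c := by
      rw [X, monomial_mul, one_mul, add_comm]
    rw [this, pairing_monomial_left, pairing_monomial_left, coeff_pderiv, zWeight_add_single]
    ring
  | add a b ha hb => rw [mul_add, pairing_add_left, ha, hb, pairing_add_left, mul_add]

/-! ### The operator -/

/-- The substitution `p_r ↦ p_r + (q^r - 1) z^r`. -/
def shift (q : ℝ) : PowSum →ₐ[ℝ] Polynomial PowSum :=
  aeval fun r : ℕ+ => Polynomial.C (X r) +
    Polynomial.C (C (q ^ (r : ℕ) - 1)) * Polynomial.X ^ (r : ℕ)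

@[simp] theorem shift_X (q : ℝ) (r : ℕ+) : shift q (X r) = Polynomial.C (X r) +
    Polynomial.C (C (q ^ (r : ℕ) - 1)) * Polynomial.X ^ (r : ℕ) := by
  simp [shift]

@[simp] theorem shift_C (q c : ℝ) : shift q (C c) = Polynomial.C (C c) := by
  simp [shift, Polynomial.algebraMap_apply, algebraMap_eq]

theorem X_mul_derivative_shift_X (q : ℝ) (a : ℕ+) :
    Polynomial.X * Polynomial.derivative (shift q (X a)) =
      Polynomial.C (C (((a : ℕ) : ℝ) * (q ^ (a : ℕ) - 1))) * Polynomial.X ^ (a : ℕ) := by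
  have h2 : (a : ℕ) = (a : ℕ) - 1 + 1 := (Nat.sub_add_cancel a.pos).symm
  rw [shift_X]
  simp only [Polynomial.derivative_add, Polynomial.derivative_C, zero_add,
    Polynomial.derivative_C_mul, Polynomial.derivative_X_pow]
  rw [mul_left_comm, mul_left_comm Polynomial.X, ← pow_succ', ← h2]
  simp only [map_mul, map_natCast]
  ring

/-- Chain rule for z d/dz. Only finitely many variables occur in u, and letting the index set be any
sufficiently large one allows sums for different u to be added. -/
theorem derivative_shift (q : ℝ) (u : PowSum) : ∃ s₀ : Finset ℕ+, ∀ s, s₀ ⊆ s →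
    Polynomial.X * Polynomial.derivative (shift q u) =
      ∑ r ∈ s, Polynomial.C (C ((r : ℕ) * (q ^ (r : ℕ) - 1))) * Polynomial.X ^ (r : ℕ) *
        shift q (pderiv r u) := by
  classical
  induction u using MvPolynomial.induction_on with
  | C a => exact ⟨∅, fun s _ => by simp⟩
  | add u v hu hv =>
    obtain ⟨s, hs⟩ := hu
    obtain ⟨s', hs'⟩ := hv
    refine ⟨s ∪ s', fun w hw => ?_⟩
    rw [map_add, map_add, mul_add, hs w (Finset.union_subset_left hw),
      hs' w (Finset.union_subset_right hw), ← Finset.sum_add_distrib]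
    exact Finset.sum_congr rfl fun r _ => by rw [map_add, map_add, mul_add]
  | mul_X u a hu =>
    obtain ⟨s, hs⟩ := hu
    refine ⟨insert a s, fun w hw => ?_⟩
    have h1 : ∀ r, shift q (pderiv r (u * X a)) = shift q (pderiv r u) * shift q (X a) +
        if r = a then shift q u else 0 := by
      intro r
      rw [pderiv_mul, pderiv_X, map_add, map_mul]
      congr 1
      by_cases h : r = a
      · subst h; simp
      · simp [h, Ne.symm h]
    have ha : a ∈ w := hw (Finset.mem_insert_self _ _)
    simp only [h1, mul_add, Finset.sum_add_distrib, mul_ite, mul_zero, Finset.sum_ite_eq', ha,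
      if_true]
    rw [map_mul, Polynomial.derivative_mul, mul_add, ← mul_assoc, hs w
      ((Finset.subset_insert _ _).trans hw), Finset.sum_mul]
    refine congrArg₂ (· + ·) (Finset.sum_congr rfl fun r _ => by simp only [mul_assoc]) ?_
    rw [← X_mul_derivative_shift_X, mul_left_comm, mul_assoc, mul_left_comm, mul_comm (shift q u)]

/-- The coefficient of `z ^ k` in the substitution `p_r ↦ p_r + (q^r - 1) z^r`. -/
def shiftCoeff (q : ℝ) (k : ℕ) : PowSum →ₗ[ℝ] PowSum :=
  ((Polynomial.lcoeff PowSum k).restrictScalars ℝ) ∘ₗ (shift q).toLinearMap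

theorem shiftCoeff_apply (q : ℝ) (k : ℕ) (u : PowSum) :
    shiftCoeff q k u = (shift q u).coeff k := rfl

/-- The coefficient of z^k in the chain rule. This recursion in k is the adjoint counterpart of the
one for `gen`, with p_r replaced by a derivative. -/
theorem nat_mul_shiftCoeff (q : ℝ) (k : ℕ) (u : PowSum) :
    (k : ℝ) • shiftCoeff q k u = ∑ j ∈ Finset.range k,
      ((j.succPNat : ℕ) * (q ^ (j.succPNat : ℕ) - 1) : ℝ) •
        shiftCoeff q (k - (j + 1)) (pderiv j.succPNat u) := by
  classical
  obtain ⟨s, hs⟩ := derivative_shift q u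
  have h := congrArg (fun p => p.coeff k)
    (hs (s ∪ (Finset.range k).map ⟨Nat.succPNat, Nat.succPNat_injective⟩)
      Finset.subset_union_left)
  have h0 : (Polynomial.X * Polynomial.derivative (shift q u)).coeff k =
      (k : ℝ) • shiftCoeff q k u := by
    rcases k with - | k
    · simp
    · rw [Polynomial.coeff_X_mul, Polynomial.coeff_derivative, shiftCoeff_apply,
        smul_eq_C_mul, mul_comm]
      simp
  simp only [h0, Polynomial.finsetSum_coeff, mul_assoc, Polynomial.coeff_C_mul,
    Polynomial.coeff_X_pow_mul'] at h
  rw [h, ← Finset.sum_subset Finset.subset_union_right]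
  · rw [Finset.sum_map]
    refine Finset.sum_congr rfl fun j hj => ?_
    have : j + 1 ≤ k := Finset.mem_range.1 hj
    simp only [Function.Embedding.coeFn_mk, Nat.succPNat_coe, Nat.succ_eq_add_one, this, if_true,
      shiftCoeff_apply, smul_eq_C_mul]
  · intro r _ hr
    have : ¬ (r : ℕ) ≤ k := fun h => hr (Finset.mem_map.2 ⟨r.natPred, by
      have := r.natPred_add_one; simp; omega, by simp⟩)
    simp [this]

/-- The coefficients of `∏_j (1 - z x_j / t) / (1 - z x_j)` as polynomials in the power sums. -/
def gen (t : ℝ) : ℕ → PowSum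
  | 0 => 1
  | k + 1 => ((k + 1 : ℕ) : ℝ)⁻¹ • ∑ j : Fin (k + 1),
      (1 - t⁻¹ ^ ((j : ℕ) + 1)) • (X (j : ℕ).succPNat * gen t (k - j))

theorem nat_mul_gen (t : ℝ) (k : ℕ) : (k : ℝ) • gen t k =
    ∑ j ∈ Finset.range k, (1 - t⁻¹ ^ (j + 1)) • (X j.succPNat * gen t (k - (j + 1))) := by
  rcases k with - | k
  · simp
  · rw [gen, smul_smul, mul_inv_cancel₀ (by positivity), one_smul, ← Fin.sum_univ_eq_sum_range
      (fun j => (1 - t⁻¹ ^ (j + 1)) • (X j.succPNat * gen t (k + 1 - (j + 1))))]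
    simp

/-- The recursions of `nat_mul_gen` and `nat_mul_shiftCoeff` correspond term by term under the
adjunction between p_r and ∂/∂p_r, so strong induction on k applies. -/
theorem pairing_gen_mul {q t : ℝ} (ht0 : 0 < t) (ht1 : t < 1) (k : ℕ) (u v : PowSum) :
    pairing q t (gen t k * u) v = t⁻¹ ^ k * pairing q t u (shiftCoeff q k v) := by
  induction k using Nat.strong_induction_on generalizing v with
  | _ k ih =>
  rcases Nat.eq_zero_or_pos k with rfl | hk
  · have : shiftCoeff q 0 v = v := by
      rw [shiftCoeff_apply]
      induction v using MvPolynomial.induction_on with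
      | C a => simp
      | add a b ha hb => rw [map_add, Polynomial.coeff_add, ha, hb]
      | mul_X a r ha => 
        have := r.ne_zero
        rw [map_mul, Polynomial.mul_coeff_zero, ha, shift_X, Polynomial.coeff_add,
          Polynomial.coeff_C_zero, Polynomial.coeff_C_mul, Polynomial.coeff_X_pow,
          if_neg this.symm, mul_zero, add_zero]
    simp [gen, this]
  · have hk' : (k : ℝ) ≠ 0 := by positivity
    refine mul_left_cancel₀ hk' ?_
    have e1 : (k : ℝ) * pairing q t (gen t k * u) v =
        pairingForm q t ((k : ℝ) • gen t k * u) v := by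
      rw [smul_mul_assoc, map_smul, LinearMap.smul_apply]; rfl
    have e2 : (k : ℝ) * (t⁻¹ ^ k * pairing q t u (shiftCoeff q k v)) =
        t⁻¹ ^ k * pairingForm q t u ((k : ℝ) • shiftCoeff q k v) := by
      rw [map_smul, pairingForm_apply, smul_eq_mul]; ring
    rw [e1, e2, nat_mul_gen, nat_mul_shiftCoeff, Finset.sum_mul, map_sum, map_sum,
      LinearMap.sum_apply, Finset.mul_sum]
    refine Finset.sum_congr rfl fun j hj => ?_
    have hj' : j + 1 ≤ k := Finset.mem_range.1 hj
    rw [smul_mul_assoc, map_smul, LinearMap.smul_apply, map_smul, pairingForm_apply,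
      pairingForm_apply, mul_assoc, pairing_X_mul, ih _ (by omega)]
    simp only [smul_eq_mul, adjFactor, Nat.succPNat_coe, Nat.succ_eq_add_one]
    have h1 : 1 - t ^ (j + 1) ≠ 0 := by
      have := pow_lt_one₀ ht0.le ht1 (Nat.succ_ne_zero j)
      simp only [Nat.succ_eq_add_one] at this
      linarith
    have h2 : t⁻¹ ^ k = t⁻¹ ^ (j + 1) * t⁻¹ ^ (k - (j + 1)) := by rw [← pow_add]; congr 1; omega
    -- This quotient is the source of the power of 1/t: its numerator comes from `gen`, its
    -- denominator from the scalar product.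
    have h3 : (1 - t⁻¹ ^ (j + 1)) / (1 - t ^ (j + 1)) = - t⁻¹ ^ (j + 1) := by
      rw [div_eq_iff h1, inv_pow]
      field_simp
      ring
    rw [h2]
    linear_combination ((j + 1 : ℕ) : ℝ) * (1 - q ^ (j + 1)) * t⁻¹ ^ (k - (j + 1)) *
      pairing q t u (shiftCoeff q (k - (j + 1)) (pderiv j.succPNat v)) * h3

/-- The Macdonald operator on polynomials in the power sums, i.e. in infinitely many variables. -/
def macOp (q t : ℝ) : PowSum →ₗ[ℝ] PowSum :=
  ((Polynomial.lsum fun k => LinearMap.mulLeft PowSum (gen t k)).restrictScalars ℝ) ∘ₗ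
    (shift q).toLinearMap

theorem macOp_eq_sum (q t : ℝ) (u : PowSum) {K : ℕ} (hK : (shift q u).natDegree < K) :
    macOp q t u = ∑ k ∈ Finset.range K, gen t k * shiftCoeff q k u := by
  have : macOp q t u = (shift q u).sum fun k a => gen t k * a := rfl
  rw [this, Polynomial.sum_over_range' _ (by simp) _ hK]
  rfl

/-- Each summand g_k s_k is self-adjoint by itself: g_k* = t^{-k} s_k and s_k* = t^k g_k, so (g_k
s_k)* = s_k* g_k* = g_k s_k. -/
theorem pairing_macOp {q t : ℝ} (ht0 : 0 < t) (ht1 : t < 1) (u v : PowSum) :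
    pairing q t (macOp q t u) v = pairing q t u (macOp q t v) := by
  set K := max (shift q u).natDegree (shift q v).natDegree + 1
  rw [macOp_eq_sum q t u (K := K) (by omega), macOp_eq_sum q t v (K := K) (by omega),
    ← pairingForm_apply, ← pairingForm_apply, map_sum, map_sum, LinearMap.sum_apply]
  refine Finset.sum_congr rfl fun k _ => ?_
  rw [pairingForm_apply, pairingForm_apply, pairing_gen_mul ht0 ht1, pairing_comm q t u,
    pairing_gen_mul ht0 ht1, pairing_comm]

end MacdonaldInt

end

/-! ### The q-difference form of the operator, by partial fractions -/

noncomputable section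

namespace MacdonaldInt

open PowerSeries

/-! ### The operator in finitely many variables -/

section Field

variable {K : Type*} [Field K] {n : ℕ}

/-- A formal power series with a given logarithmic derivative is determined by its constant
coefficient. -/
theorem powerSeries_eq_of_log_derivative [CharZero K] {L Y Z : PowerSeries K}
    (hL : constantCoeff L = 0) (hY : X * derivative K Y = L * Y)
    (hZ : X * derivative K Z = L * Z) (h0 : constantCoeff Y = constantCoeff Z) : Y = Z := by
  have key : ∀ {Y : PowerSeries K}, X * derivative K Y = L * Y → ∀ k : ℕ,
      (k : K) * coeff k Y = ∑ p ∈ Finset.HasAntidiagonal.antidiagonal k, coeff p.1 L * coeff p.2 Y := by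
    intro Y hY k
    have := congrArg (coeff k) hY
    rw [coeff_mul k L Y] at this
    rw [← this]
    rcases k with - | k
    · simp
    · rw [coeff_succ_X_mul, coeff_derivative, mul_comm]; push_cast; rfl
  ext k
  induction k using Nat.strong_induction_on with
  | _ k ih =>
  rcases Nat.eq_zero_or_pos k with rfl | hk
  · simpa using h0
  · have hk' : (k : K) ≠ 0 := by exact_mod_cast hk.ne'
    refine mul_left_cancel₀ hk' ?_
    rw [key hY, key hZ]
    refine Finset.sum_congr rfl fun p hp => ?_
    have hp' := Finset.HasAntidiagonal.mem_antidiagonal.1 hp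
    rcases Nat.eq_zero_or_pos p.1 with h | h
    · rw [h, coeff_zero_eq_constantCoeff_apply, hL]; simp
    · rw [ih p.2 (by omega)]

/-- The logarithmic derivative of 1 - aX is -∑_{k ≥ 1} a^k X^{k-1}. Summing gives minus the
generating series of the power sums, here without division. -/
theorem log_derivative_prod {ι : Type*} (s : Finset ι) (a : ι → K) :
    X * derivative K (∏ i ∈ s, (1 - C (a i) * X)) =
      -PowerSeries.mk (fun k => if k = 0 then 0 else ∑ i ∈ s, a i ^ k) *
        ∏ i ∈ s, (1 - C (a i) * X) := by
  classical
  induction s using Finset.induction_on with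
  | empty =>
    have : (PowerSeries.mk fun k : ℕ => if k = 0 then (0 : K) else 0) = 0 := by ext; simp
    simpa using this
  | insert j s hj ih =>
    have h1 : (PowerSeries.mk fun k => if k = 0 then 0 else ∑ i ∈ insert j s, a i ^ k) =
        (PowerSeries.mk fun k => if k = 0 then 0 else a j ^ k) +
          PowerSeries.mk (fun k => if k = 0 then 0 else ∑ i ∈ s, a i ^ k) := by
      ext k
      by_cases h : k = 0 <;> simp [h, Finset.sum_insert hj]
    have h2 : (PowerSeries.mk fun k => if k = 0 then 0 else a j ^ k) * (1 - C (a j) * X) =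
        C (a j) * X := by
      rw [mul_sub, mul_one, mul_left_comm]
      ext k
      rcases k with - | k
      · simp
      · rw [map_sub, coeff_mk, coeff_C_mul, coeff_succ_mul_X, coeff_mk, coeff_C_mul, coeff_X]
        by_cases h : k = 0
        · simp [h]
        · simp [h, pow_succ']
    have h3 : derivative K (1 - C (a j) * X) = -C (a j) := by
      ext k
      rw [coeff_derivative, map_sub, coeff_C_mul, coeff_X, coeff_one, map_neg, coeff_C]
      by_cases h : k = 0 <;> simp [h]
    rw [Finset.prod_insert hj, Derivation.leibniz, h1]
    simp only [smul_eq_mul, mul_add]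
    rw [mul_left_comm, ih, h3]
    linear_combination (∏ i ∈ s, (1 - C (a i) * X)) * h2

/-- Partial fraction expansion in z of ∏ (1 - z x_i / t) / (1 - z x_i), cleared of denominators. The
residues are the coefficients of the q-difference operator. -/
theorem prod_one_sub_partial_fractions {t : K} (ht : t ≠ 0) {x : Fin n → K}
    (hx : Function.Injective x) (hx0 : ∀ i, x i ≠ 0) :
    ∏ i, (1 - Polynomial.C (t⁻¹ * x i) * Polynomial.X) =
      Polynomial.C (t⁻¹ ^ n) * (∏ i, (1 - Polynomial.C (x i) * Polynomial.X) +
        ∑ i, Polynomial.C ((t - 1) * ∏ j ∈ Finset.univ.erase i, (t * x i - x j) / (x i - x j)) *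
          ∏ j ∈ Finset.univ.erase i, (1 - Polynomial.C (x j) * Polynomial.X)) := by
  have hdeg : ∀ c : K, (1 - Polynomial.C c * Polynomial.X).natDegree ≤ 1 := fun c => by
    compute_degree
  have hprod : ∀ (s : Finset (Fin n)) (a : Fin n → K),
      (∏ i ∈ s, (1 - Polynomial.C (a i) * Polynomial.X)).natDegree ≤ s.card := fun s a => by
    refine (Polynomial.natDegree_prod_le _ _).trans ?_
    simpa using Finset.sum_le_card_nsmul s _ 1 fun i _ => hdeg (a i)
  have hcoeff : ∀ a : Fin n → K,
      (∏ i, (1 - Polynomial.C (a i) * Polynomial.X)).coeff n = ∏ i, -a i := fun a => by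
    have := Polynomial.coeff_prod_of_natDegree_le (s := Finset.univ)
      (fun i => 1 - Polynomial.C (a i) * Polynomial.X) 1 fun i _ => hdeg (a i)
    simpa [Polynomial.coeff_one] using this
  set R := ∑ i, Polynomial.C ((t - 1) * ∏ j ∈ Finset.univ.erase i, (t * x i - x j) / (x i - x j)) *
          ∏ j ∈ Finset.univ.erase i, (1 - Polynomial.C (x j) * Polynomial.X) with hR
  rcases Nat.eq_zero_or_pos n with rfl | hn
  · simp [hR]
  have hRdeg : R.natDegree < n := by
    refine lt_of_le_of_lt (Polynomial.natDegree_sum_le_of_forall_le _ _ (n := n - 1)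
      fun i _ => ?_) (by omega)
    refine (Polynomial.natDegree_C_mul_le _ _).trans ((hprod _ _).trans ?_)
    simp
  have hinj : Function.Injective fun i => (x i)⁻¹ := fun i j h => hx (inv_injective h)
  -- Both sides have degree at most n, so it suffices to compare the coefficients of z^n and the
  -- values at the n points 1/x_i.
  refine Polynomial.eq_of_degree_sub_lt_of_eval_index_eq (s := Finset.univ) (v := fun i => (x i)⁻¹)
    hinj.injOn ?_ fun i _ => ?_
  · rw [Finset.card_univ, Fintype.card_fin, Polynomial.degree_lt_iff_coeff_zero]
    intro k hk
    rcases hk.eq_or_lt with rfl | hk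
    · rw [Polynomial.coeff_sub, Polynomial.coeff_C_mul, Polynomial.coeff_add, hcoeff, hcoeff,
        Polynomial.coeff_eq_zero_of_natDegree_lt hRdeg, add_zero]
      simp only [← mul_neg, Finset.prod_mul_distrib]
      simp
    · refine Polynomial.coeff_eq_zero_of_natDegree_lt (lt_of_le_of_lt ?_ hk)
      refine (Polynomial.natDegree_sub_le _ _).trans (max_le ((hprod _ _).trans (by simp)) ?_)
      refine (Polynomial.natDegree_C_mul_le _ _).trans ((Polynomial.natDegree_add_le _ _).trans
        (max_le ((hprod _ _).trans (by simp)) hRdeg.le))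
  · simp only [hR, Polynomial.eval_prod, Polynomial.eval_sub, Polynomial.eval_one,
      Polynomial.eval_mul, Polynomial.eval_C, Polynomial.eval_X, Polynomial.eval_add,
      Polynomial.eval_finsetSum]
    have h0 : ∏ j, (1 - x j * (x i)⁻¹) = 0 :=
      Finset.prod_eq_zero (Finset.mem_univ i) (by rw [mul_inv_cancel₀ (hx0 i), sub_self])
    rw [h0, zero_add, Finset.sum_eq_single i]
    · rw [← Finset.mul_prod_erase _ _ (Finset.mem_univ i)]
      have h1 : ∀ j ∈ Finset.univ.erase i, 1 - t⁻¹ * x j * (x i)⁻¹ =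
          t⁻¹ * ((t * x i - x j) / (x i - x j) * (1 - x j * (x i)⁻¹)) := by
        intro j hj
        have hij : x i - x j ≠ 0 := sub_ne_zero.2 fun h => Finset.ne_of_mem_erase hj (hx h.symm)
        have := hx0 i
        field_simp
      rw [Finset.prod_congr rfl h1, Finset.prod_mul_distrib, Finset.prod_mul_distrib,
        Finset.prod_const,
        Finset.card_erase_of_mem (Finset.mem_univ i), Finset.card_univ, Fintype.card_fin]
      have h2 : 1 - t⁻¹ * x i * (x i)⁻¹ = t⁻¹ * (t - 1) := by
        have := hx0 i
        field_simp
      have h3 : t⁻¹ ^ n = t⁻¹ * t⁻¹ ^ (n - 1) := by rw [← pow_succ']; congr 1; omega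
      rw [h2, h3]
      ring
    · intro j _ hj
      exact mul_eq_zero_of_right _ (Finset.prod_eq_zero (i := i)
        (Finset.mem_erase.2 ⟨hj.symm, Finset.mem_univ i⟩)
        (by rw [mul_inv_cancel₀ (hx0 i), sub_self]))
    · simp

variable [Algebra ℝ K]

/-- The value of a polynomial in the power sums at a point with coordinates in `K`. -/
def psEval (x : Fin n → K) : PowSum →ₐ[ℝ] K := MvPolynomial.aeval fun r : ℕ+ => ∑ i, x i ^ (r : ℕ)

@[simp] theorem psEval_X (x : Fin n → K) (r : ℕ+) :
    psEval x (MvPolynomial.X r) = ∑ i, x i ^ (r : ℕ) := by simp [psEval]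

@[simp] theorem psEval_C (x : Fin n → K) (c : ℝ) : psEval x (MvPolynomial.C c) = algebraMap ℝ K c := by
  simp [psEval]

/-- At z = x_i the substitution p_r ↦ p_r + (q^r - 1) x_i^r replaces the summand x_i^r by (q x_i)^r.
This is where the q-shift of one variable comes from. -/
theorem eval_map_shift (q : ℝ) (x : Fin n → K) (i : Fin n) (u : PowSum) :
    ((shift q u).map (psEval x : PowSum →+* K)).eval (x i) =
      psEval (Function.update x i (algebraMap ℝ K q * x i)) u := by
  induction u using MvPolynomial.induction_on with
  | C a => simp
  | add a b ha hb => simp only [map_add, Polynomial.map_add, Polynomial.eval_add, ha, hb]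
  | mul_X a r ha =>
    rw [map_mul, Polynomial.map_mul, Polynomial.eval_mul, ha, map_mul]
    congr 1
    simp only [shift_X, Polynomial.map_add, Polynomial.map_C, RingHom.coe_coe, psEval_X,
      Polynomial.map_mul, psEval_C, Polynomial.map_pow, Polynomial.map_X, Polynomial.eval_add,
      Polynomial.eval_C, Polynomial.eval_mul, Polynomial.eval_pow, Polynomial.eval_X]
    have h : ∀ j ∈ Finset.univ.erase i,
        Function.update x i (algebraMap ℝ K q * x i) j ^ (r : ℕ) = x j ^ (r : ℕ) := fun j hj => by
      rw [Function.update_of_ne (Finset.ne_of_mem_erase hj)]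
    rw [← Finset.add_sum_erase _ _ (Finset.mem_univ i),
      ← Finset.add_sum_erase Finset.univ (fun j => _ ^ (r : ℕ)) (Finset.mem_univ i),
      Finset.sum_congr rfl h, Function.update_self, map_sub, map_pow, map_one]
    ring

theorem eval_zero_map_shift (q : ℝ) (x : Fin n → K) (u : PowSum) :
    ((shift q u).map (psEval x : PowSum →+* K)).eval 0 = psEval x u := by
  induction u using MvPolynomial.induction_on with
  | C a => simp
  | add a b ha hb => simp only [map_add, Polynomial.map_add, Polynomial.eval_add, ha, hb]
  | mul_X a r ha =>
    rw [map_mul, Polynomial.map_mul, Polynomial.eval_mul, ha, map_mul]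
    simp [Polynomial.eval_finsetSum]

/-- `∑_k g_k z^k = ∏_j (1 - z x_j / t) / (1 - z x_j)`. -/
theorem mk_gen_mul_prod {t : ℝ} (x : Fin n → K) :
    PowerSeries.mk (fun k => psEval x (gen t k)) * ∏ i, (1 - C (x i) * X) =
      ∏ i, (1 - C ((algebraMap ℝ K t)⁻¹ * x i) * X) := by
  have : CharZero K := charZero_of_injective_algebraMap (algebraMap ℝ K).injective
  set T := (algebraMap ℝ K t)⁻¹ with hT
  let p : K → PowerSeries K := fun c =>
    PowerSeries.mk (fun k => if k = 0 then 0 else ∑ i, (c * x i) ^ k)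
  have hG : X * derivative K (PowerSeries.mk (fun k => psEval x (gen t k))) =
      (p 1 - p T) * PowerSeries.mk (fun k => psEval x (gen t k)) := by
    ext k
    have h := congrArg (psEval x) (nat_mul_gen t k)
    rw [map_smul, map_sum, Algebra.smul_def, map_natCast] at h
    rw [coeff_mul _ (p 1 - p T), Finset.Nat.sum_antidiagonal_eq_sum_range_succ
      (fun i j => coeff i (p 1 - p T) * coeff j (PowerSeries.mk fun k => psEval x (gen t k)))]
    rw [Finset.sum_range_succ']
    have h0 : coeff 0 (p 1 - p T) = 0 := by simp [p]
    rw [h0, zero_mul, add_zero]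
    have h1 : coeff k (X * derivative K (PowerSeries.mk fun k => psEval x (gen t k))) =
        k * psEval x (gen t k) := by
      rcases k with - | k
      · simp
      · rw [coeff_succ_X_mul, coeff_derivative, mul_comm]; simp
    rw [h1, h]
    refine Finset.sum_congr rfl fun j _ => ?_
    rw [map_smul, map_mul, Algebra.smul_def, coeff_mk, ← mul_assoc, psEval_X]
    simp only [p, map_sub, coeff_mk, Nat.succ_ne_zero, if_false, mul_pow, map_one, map_pow,
      map_inv₀, ← hT, ← Finset.mul_sum, Nat.succPNat_coe, Nat.succ_eq_add_one]
    ring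
  refine powerSeries_eq_of_log_derivative (L := -p T) (by simp [p]) ?_
    (log_derivative_prod Finset.univ fun i => T * x i) ?_
  · have h := log_derivative_prod Finset.univ x
    rw [Derivation.leibniz]
    simp only [smul_eq_mul, mul_add]
    rw [mul_left_comm, h, mul_left_comm X, hG]
    simp only [p, one_mul]
    ring
  · simp [map_prod, gen]

/-- The partial fractions of the generating function of the g_k, expanded in geometric series. -/
theorem psEval_gen {t : ℝ} (ht : t ≠ 0) {x : Fin n → K} (hx : Function.Injective x)
    (hx0 : ∀ i, x i ≠ 0) (k : ℕ) :
    algebraMap ℝ K t ^ n * psEval x (gen t k) = (if k = 0 then 1 else 0) +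
      (algebraMap ℝ K t - 1) * ∑ i, (∏ j ∈ Finset.univ.erase i,
        (algebraMap ℝ K t * x i - x j) / (x i - x j)) * x i ^ k := by
  set T := algebraMap ℝ K t with hT
  have hT0 : T ≠ 0 := by simpa [hT] using ht
  have h := congrArg (Polynomial.coeToPowerSeries.ringHom (R := K))
    (prod_one_sub_partial_fractions hT0 hx hx0)
  simp only [map_mul, map_prod, map_add, map_sum, map_sub, map_one,
    Polynomial.coeToPowerSeries.ringHom_apply, Polynomial.coe_C, Polynomial.coe_X] at h
  have hgeom : ∀ a : K, PowerSeries.mk (fun k => a ^ k) * (1 - C a * X) = 1 := fun a => by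
    ext k
    rw [mul_sub, mul_one, mul_left_comm, map_sub, coeff_mk, coeff_C_mul, coeff_one]
    rcases k with - | k
    · simp
    · rw [coeff_succ_mul_X, coeff_mk, pow_succ']; simp
  have hQ : ∏ i, (1 - C (x i) * (X : PowerSeries K)) ≠ 0 :=
    Finset.prod_ne_zero_iff.2 fun i _ h0 => by simpa [h0] using hgeom (x i)
  have key : PowerSeries.mk (fun k => psEval x (gen t k)) = C (T⁻¹ ^ n) * (1 +
      ∑ i, C ((T - 1) * ∏ j ∈ Finset.univ.erase i, (T * x i - x j) / (x i - x j)) *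
        PowerSeries.mk (fun k => x i ^ k)) := by
    refine mul_right_cancel₀ hQ ?_
    rw [mk_gen_mul_prod]
    refine Eq.trans ?_ (h.trans ?_)
    · simp only [map_mul, ← hT]
    · simp only [map_mul, map_pow, map_prod]
      rw [mul_assoc, add_mul, one_mul, Finset.sum_mul]
      congr 2
      refine Finset.sum_congr rfl fun i _ => ?_
      rw [← Finset.mul_prod_erase _ (fun i => 1 - C (x i) * X) (Finset.mem_univ i), map_sub,
        map_one]
      linear_combination -((C T - 1) * (∏ j ∈ Finset.univ.erase i,
        C ((T * x i - x j) / (x i - x j))) * ∏ j ∈ Finset.univ.erase i, (1 - C (x j) * X)) *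
          hgeom (x i)
  have := congrArg (coeff k) key
  rw [coeff_mk, coeff_C_mul, map_add, coeff_one, map_sum] at this
  rw [this, ← mul_assoc, ← mul_pow, mul_inv_cancel₀ hT0, one_pow, one_mul, Finset.mul_sum]
  congr 1
  refine Finset.sum_congr rfl fun i _ => ?_
  rw [coeff_C_mul, coeff_mk, mul_assoc]

/-- The operator in `n` variables is the Macdonald `q`-difference operator. -/
theorem psEval_macOp (q : ℝ) {t : ℝ} (ht : t ≠ 0) {x : Fin n → K} (hx : Function.Injective x)
    (hx0 : ∀ i, x i ≠ 0) (u : PowSum) :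
    algebraMap ℝ K t ^ n * psEval x (macOp q t u) = psEval x u +
      (algebraMap ℝ K t - 1) * ∑ i, (∏ j ∈ Finset.univ.erase i,
        (algebraMap ℝ K t * x i - x j) / (x i - x j)) *
          psEval (Function.update x i (algebraMap ℝ K q * x i)) u := by
  set φ := (shift q u).map (psEval x : PowSum →+* K) with hφ
  have hφk : ∀ k, psEval x (shiftCoeff q k u) = φ.coeff k := fun k => by
    rw [hφ, Polynomial.coeff_map]; rfl
  set D := (shift q u).natDegree + 1
  have hD : φ.natDegree < D := Nat.lt_succ_of_le Polynomial.natDegree_map_le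
  rw [macOp_eq_sum q t u (K := D) (Nat.lt_succ_self _), map_sum, Finset.mul_sum]
  -- With φ the shifted polynomial in z, the sum over k of its coefficients times x_i^k is φ(x_i),
  -- the value of u with x_i replaced by q x_i. The term with k = 0 alone gives φ(0), which is the
  -- value of u itself.
  simp only [map_mul, hφk, ← mul_assoc, psEval_gen ht hx hx0, ← eval_map_shift, ← hφ]
  rw [← eval_zero_map_shift q, ← hφ]
  simp only [Polynomial.eval_eq_sum_range' hD, add_mul, Finset.sum_add_distrib]
  congr 1
  · refine Finset.sum_congr rfl fun k _ => ?_
    rcases k with - | k <;> simp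
  · simp only [mul_assoc, Finset.mul_sum, Finset.sum_mul]
    rw [Finset.sum_comm]
    refine Finset.sum_congr rfl fun i _ => Finset.sum_congr rfl fun k _ => by ring

end Field

end MacdonaldInt

end

/-! ### Degree bounds for the operator, from its formula without denominators -/

noncomputable section

namespace MacdonaldInt

open MvPolynomial

/-! ### The operator on symmetric polynomials -/

/-- The image in `n` variables of a polynomial in the power sums. -/
def toVars (n : ℕ) : PowSum →ₐ[ℝ] MvPolynomial (Fin n) ℝ :=
  aeval fun r : ℕ+ => psum (Fin n) ℝ (r : ℕ)

theorem aeval_toVars {K : Type*} [Field K] [Algebra ℝ K] {n : ℕ} (x : Fin n → K) (u : PowSum) :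
    aeval x (toVars n u) = psEval x u := by
  have : (aeval x).comp (toVars n) = psEval x := by
    refine algHom_ext fun r => ?_
    simp [toVars, psum]
  exact DFunLike.congr_fun this u

theorem powerSumMap_apply (u : PowSum) (n : ℕ) : powerSumMap u n = toVars n u := by
  have : (Pi.evalAlgHom ℝ (fun n : ℕ => MvPolynomial (Fin n) ℝ) n).comp powerSumMap =
      toVars n := by
    refine algHom_ext fun r => ?_
    simp [toVars, powerSumMap]
  exact DFunLike.congr_fun this u

theorem prod_offDiag_fst {n : ℕ} {M : Type*} [CommMonoid M] (i : Fin n) (f : Fin n → M) :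
    ∏ p ∈ (Finset.univ : Finset (Fin n)).offDiag, (if p.1 = i then f p.2 else 1) =
      ∏ j ∈ Finset.univ.erase i, f j := by
  rw [← Finset.prod_filter]
  refine Finset.prod_nbij' Prod.snd (fun j => (i, j)) ?_ ?_ ?_ ?_ ?_
  · rintro ⟨a, b⟩ h
    simp only [Finset.mem_filter, Finset.mem_offDiag, Finset.mem_univ, true_and] at h
    simp only [Finset.mem_erase, Finset.mem_univ, and_true]
    rw [← h.2]; exact h.1.symm
  · intro j h
    simpa [eq_comm] using h
  · rintro ⟨a, b⟩ h
    simp only [Finset.mem_filter] at h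
    simp [h.2]
  · intro j _; rfl
  · intro j _; rfl

/-- The product `∏_{i ≠ j} (x_i - x_j)`. -/
def discr (n : ℕ) : MvPolynomial (Fin n) ℝ :=
  ∏ p ∈ (Finset.univ : Finset (Fin n)).offDiag, (X p.1 - X p.2)

/-- The product `∏_{i ≠ j} (x_i - x_j)` times `∏_{j ≠ i} (t x_i - x_j) / (x_i - x_j)`. -/
def discrShift (n : ℕ) (t : ℝ) (i : Fin n) : MvPolynomial (Fin n) ℝ :=
  ∏ p ∈ (Finset.univ : Finset (Fin n)).offDiag, (C (if p.1 = i then t else 1) * X p.1 - X p.2)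

theorem discr_ne_zero (n : ℕ) : discr n ≠ 0 := by
  refine Finset.prod_ne_zero_iff.2 fun p hp h => ?_
  have := (Finset.mem_offDiag.1 hp).2.2
  exact this (X_injective (sub_eq_zero.1 h))

/-- The substitution `x_i ↦ c x_i`. -/
def scaleVar {n : ℕ} (i : Fin n) (c : ℝ) : MvPolynomial (Fin n) ℝ →ₐ[ℝ] MvPolynomial (Fin n) ℝ :=
  aeval fun j => C (if j = i then c else 1) * X j

theorem scaleVar_monomial {n : ℕ} (i : Fin n) (c : ℝ) (a : Fin n →₀ ℕ) (b : ℝ) :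
    scaleVar i c (monomial a b) = monomial a (c ^ a i * b) := by
  rw [scaleVar, aeval_monomial, algebraMap_eq, Finsupp.prod_fintype _ _ (by simp)]
  simp only [mul_pow, Finset.prod_mul_distrib, ← map_pow, ← map_prod]
  rw [← mul_assoc, ← C_mul, monomial_eq (s := a), Finsupp.prod_fintype _ _ (by simp),
    mul_comm b]
  congr 3
  rw [Finset.prod_eq_single i] <;> simp +contextual

theorem coeff_scaleVar {n : ℕ} (i : Fin n) (c : ℝ) (f : MvPolynomial (Fin n) ℝ) (a : Fin n →₀ ℕ) :
    (scaleVar i c f).coeff a = c ^ a i * f.coeff a := by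
  classical
  induction f using MvPolynomial.induction_on' with
  | monomial b r =>
    rw [scaleVar_monomial, coeff_monomial, coeff_monomial]
    split_ifs with h
    · rw [h]
    · simp
  | add p q hp hq => rw [map_add, coeff_add, hp, hq, coeff_add, mul_add]

theorem aeval_real_eq_eval {n : ℕ} (x : Fin n → ℝ) (f : MvPolynomial (Fin n) ℝ) :
    aeval x f = eval x f := by
  rw [← coe_aeval_eq_eval]
  rfl

theorem eval_scaleVar {n : ℕ} (i : Fin n) (c : ℝ) (f : MvPolynomial (Fin n) ℝ) (x : Fin n → ℝ) :
    eval x (scaleVar i c f) = eval (Function.update x i (c * x i)) f := by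
  have : (aeval x : MvPolynomial (Fin n) ℝ →ₐ[ℝ] ℝ).comp (scaleVar i c) =
      aeval (Function.update x i (c * x i)) := by
    refine algHom_ext fun j => ?_
    by_cases h : j = i
    · subst h; simp [scaleVar]
    · simp [scaleVar, h]
  have h2 := DFunLike.congr_fun this f
  simpa only [AlgHom.comp_apply, aeval_real_eq_eval] using h2

theorem discr_mul_macOp (q : ℝ) {t : ℝ} (ht : t ≠ 0) (n : ℕ) (u : PowSum) :
    C (t ^ n) * (discr n * toVars n (macOp q t u)) = discr n * toVars n u +
      C (t - 1) * ∑ i, discrShift n t i * scaleVar i q (toVars n u) := by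
  -- The extra factor vanishes at all points with equal or zero coordinates, where the q-difference
  -- formula is not available. Everywhere else it can be cancelled.
  have h0 : discr n * ∏ i, X i ≠ 0 :=
    mul_ne_zero (discr_ne_zero n) (Finset.prod_ne_zero_iff.2 fun i _ => X_ne_zero i)
  refine mul_left_cancel₀ h0 (MvPolynomial.funext fun x => ?_)
  rw [map_mul (eval x) (discr n * ∏ i, X i), map_mul (eval x) (discr n * ∏ i, X i)]
  by_cases hx : eval x (discr n * ∏ i, X i) = 0
  · rw [hx, zero_mul, zero_mul]
  congr 1
  rw [map_mul, ← ne_eq, mul_ne_zero_iff] at hx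
  have hx0 : ∀ i, x i ≠ 0 := fun i => by
    have := hx.2
    rw [map_prod, Finset.prod_ne_zero_iff] at this
    simpa using this i (Finset.mem_univ i)
  have hd : ∀ i j, i ≠ j → x i - x j ≠ 0 := fun i j hij => by
    have := hx.1
    rw [discr, map_prod, Finset.prod_ne_zero_iff] at this
    simpa using this (i, j) (by simpa using hij)
  have hinj : Function.Injective x := fun i j h => by
    by_contra hij
    exact hd i j hij (sub_eq_zero.2 h)
  have key := psEval_macOp q ht hinj hx0 u
  simp only [Algebra.algebraMap_self, RingHom.id_apply, ← aeval_toVars, aeval_real_eq_eval,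
    ← eval_scaleVar] at key
  have hB : ∀ i, eval x (discrShift n t i) =
      eval x (discr n) * ∏ j ∈ Finset.univ.erase i, (t * x i - x j) / (x i - x j) := fun i => by
    rw [← prod_offDiag_fst i, discrShift, discr, map_prod, map_prod, ← Finset.prod_mul_distrib]
    refine Finset.prod_congr rfl fun p hp => ?_
    have hp := hd p.1 p.2 (Finset.mem_offDiag.1 hp).2.2
    split_ifs with h
    · rw [h] at hp
      simp only [map_sub, map_mul, eval_C, eval_X, h]
      field_simp
    · simp
  simp only [map_mul, map_add, map_sum, eval_C, hB]
  simp only [mul_assoc]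
  rw [← Finset.mul_sum]
  linear_combination eval x (discr n) * key

/-! ### Weights -/

section Weights

variable {n : ℕ} (w : Fin n → ℕ)

/-- The weight of an exponent. -/
def wt (a : Fin n →₀ ℕ) : ℕ := ∑ i, a i * w i

/-- The substitution `x_i ↦ x_i z^{w_i}`. -/
def gradeBy : MvPolynomial (Fin n) ℝ →ₐ[ℝ] Polynomial (MvPolynomial (Fin n) ℝ) :=
  aeval fun i => Polynomial.C (X i) * Polynomial.X ^ w i

theorem gradeBy_monomial (a : Fin n →₀ ℕ) (c : ℝ) :
    gradeBy w (monomial a c) = Polynomial.C (monomial a c) * Polynomial.X ^ wt w a := by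
  rw [gradeBy, aeval_monomial, Finsupp.prod_fintype _ _ (by simp)]
  simp only [mul_pow, Finset.prod_mul_distrib, ← map_pow, ← map_prod, ← pow_mul]
  rw [Finset.prod_pow_eq_pow_sum, monomial_eq (s := a), Finsupp.prod_fintype _ _ (by simp),
    map_mul, Polynomial.algebraMap_apply, algebraMap_eq, mul_assoc, wt]
  simp only [mul_comm (w _)]

theorem coeff_coeff_gradeBy (f : MvPolynomial (Fin n) ℝ) (k : ℕ) (a : Fin n →₀ ℕ) :
    ((gradeBy w f).coeff k).coeff a = if wt w a = k then f.coeff a else 0 := by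
  classical
  induction f using MvPolynomial.induction_on' with
  | monomial b r =>
    rw [gradeBy_monomial, Polynomial.coeff_C_mul, Polynomial.coeff_X_pow, coeff_monomial]
    by_cases hb : b = a
    · subst hb
      by_cases hk : wt w b = k
      · simp [hk]
      · simp [hk, Ne.symm hk]
    · by_cases hk : k = wt w b <;> simp [hk, hb]
  | add p q hp hq =>
    rw [map_add, Polynomial.coeff_add, coeff_add, hp, hq, coeff_add]
    split_ifs <;> simp

theorem gradeBy_injective : Function.Injective (gradeBy w) := by
  intro f g h
  ext a
  have := coeff_coeff_gradeBy w f (wt w a) a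
  rw [h, coeff_coeff_gradeBy] at this
  simpa using this.symm

theorem natDegree_gradeBy_le {f : MvPolynomial (Fin n) ℝ} {d : ℕ} :
    (gradeBy w f).natDegree ≤ d ↔ ∀ a, f.coeff a ≠ 0 → wt w a ≤ d := by
  rw [Polynomial.natDegree_le_iff_coeff_eq_zero]
  constructor
  · intro h a ha
    by_contra hd
    have := coeff_coeff_gradeBy w f (wt w a) a
    rw [h _ (not_le.1 hd)] at this
    simp only [coeff_zero, if_true] at this
    exact ha this.symm
  · intro h k hk
    ext a
    rw [coeff_coeff_gradeBy, coeff_zero]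
    split_ifs with h'
    · by_contra ha
      have := h a ha
      omega
    · rfl

theorem natDegree_gradeBy_mono {f g : MvPolynomial (Fin n) ℝ}
    (h : ∀ a, f.coeff a ≠ 0 → g.coeff a ≠ 0) :
    (gradeBy w f).natDegree ≤ (gradeBy w g).natDegree :=
  (natDegree_gradeBy_le w).2 fun a ha => (natDegree_gradeBy_le w).1 le_rfl a (h a ha)

/-- Each factor involves no monomial that is absent from the corresponding factor x_i - x_j of the
discriminant. On the side of the discriminant the degrees of the factors add up exactly. -/
theorem natDegree_gradeBy_discrShift_le (t : ℝ) (i : Fin n) :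
    (gradeBy w (discrShift n t i)).natDegree ≤ (gradeBy w (discr n)).natDegree := by
  classical
  have h0 : ∀ p ∈ (Finset.univ : Finset (Fin n)).offDiag,
      gradeBy w (X p.1 - X p.2) ≠ 0 := fun p hp h => by
    rw [← map_zero (gradeBy w)] at h
    exact (Finset.mem_offDiag.1 hp).2.2 (X_injective (sub_eq_zero.1 (gradeBy_injective w h)))
  rw [discr, map_prod, Polynomial.natDegree_prod _ _ h0, discrShift, map_prod]
  refine (Polynomial.natDegree_prod_le _ _).trans (Finset.sum_le_sum fun p hp => ?_)
  refine natDegree_gradeBy_mono w fun a ha => ?_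
  have hp := (Finset.mem_offDiag.1 hp).2.2
  rw [coeff_sub, coeff_C_mul, coeff_X, coeff_X] at ha
  rw [coeff_sub, coeff_X, coeff_X]
  by_cases h1 : Finsupp.single p.1 1 = a
  · have : Finsupp.single p.2 1 ≠ a := fun h => hp
      (Finsupp.single_left_injective one_ne_zero (h1.trans h.symm))
    simp [h1, this]
  · simpa [h1] using ha

/-- For every grading of the variables the operator does not raise the top degree: rescaling a
variable keeps the support, and the rational coefficients have numerators of degree at most that of
their denominators. Degrees are exact on the left of `discr_mul_macOp`, since the ring is a domain.
The freedom in w is what yields the dominance order. -/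
theorem wt_le_of_coeff_macOp_ne_zero (q : ℝ) {t : ℝ} (ht : t ≠ 0) {u : PowSum} {d : ℕ}
    (h : ∀ a, (toVars n u).coeff a ≠ 0 → wt w a ≤ d) {a : Fin n →₀ ℕ}
    (ha : (toVars n (macOp q t u)).coeff a ≠ 0) : wt w a ≤ d := by
  revert a
  rw [← natDegree_gradeBy_le] at h ⊢
  have hW : gradeBy w (discr n) ≠ 0 := fun h0 =>
    discr_ne_zero n (gradeBy_injective w (h0.trans (map_zero _).symm))
  by_cases hg : gradeBy w (toVars n (macOp q t u)) = 0
  · simp [hg]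
  have key := congrArg (gradeBy w) (discr_mul_macOp q ht n u)
  have htn : gradeBy w (C (t ^ n)) ≠ 0 := fun h0 => by
    have := gradeBy_injective w (h0.trans (map_zero _).symm)
    rw [C_eq_zero] at this
    exact pow_ne_zero n ht this
  have hC : ∀ c : ℝ, (gradeBy w (C c : MvPolynomial (Fin n) ℝ)).natDegree = 0 := fun c => by
    have : gradeBy w (C c) = Polynomial.C (C c) := by
      rw [gradeBy, ← algebraMap_eq, AlgHom.commutes]; rfl
    rw [this, Polynomial.natDegree_C]
  rw [map_mul, map_mul] at key
  have h1 := congrArg Polynomial.natDegree key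
  rw [Polynomial.natDegree_mul htn (mul_ne_zero hW hg), Polynomial.natDegree_mul hW hg, hC] at h1
  have h2 : (gradeBy w (discr n * toVars n u + C (t - 1) * ∑ i, discrShift n t i *
      scaleVar i q (toVars n u))).natDegree ≤ (gradeBy w (discr n)).natDegree + d := by
    rw [map_add, map_mul, map_mul, map_sum]
    refine (Polynomial.natDegree_add_le _ _).trans (max_le
      (Polynomial.natDegree_mul_le.trans (by omega)) (Polynomial.natDegree_mul_le.trans ?_))
    rw [hC, zero_add]
    refine Polynomial.natDegree_sum_le_of_forall_le _ _ fun i _ => ?_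
    rw [map_mul]
    refine Polynomial.natDegree_mul_le.trans (add_le_add (natDegree_gradeBy_discrShift_le w t i)
      ((natDegree_gradeBy_mono w fun a ha => ?_).trans h))
    rw [coeff_scaleVar] at ha
    exact right_ne_zero_of_mul ha
  omega

end Weights

/-! ### Homogeneity -/

/-- Homogeneity of degree e means that x_i ↦ x_i z acts as multiplication by z^e, and in this form
the factor f can be cancelled. -/
theorem isHomogeneous_of_mul {n : ℕ} {f g : MvPolynomial (Fin n) ℝ} {k d : ℕ} (hf0 : f ≠ 0)
    (hf : f.IsHomogeneous k) (h : (f * g).IsHomogeneous (k + d)) : g.IsHomogeneous d := by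
  have hdeg : ∀ {p : MvPolynomial (Fin n) ℝ} {e : ℕ}, p.IsHomogeneous e →
      gradeBy (fun _ => 1) p = Polynomial.C p * Polynomial.X ^ e := by
    intro p e hp
    ext j a
    rw [coeff_coeff_gradeBy, Polynomial.coeff_C_mul, Polynomial.coeff_X_pow]
    have hw : wt (fun _ => 1) a = a.degree := by simp [wt, Finsupp.degree_eq_sum]
    rw [hw]
    by_cases hae : a.degree = e
    · rw [hae]
      by_cases hj : j = e
      · simp [hj]
      · simp [hj, Ne.symm hj]
    · rw [hp.coeff_eq_zero hae]
      split_ifs <;> simp [hp.coeff_eq_zero hae]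
  have key := hdeg h
  rw [map_mul, hdeg hf, pow_add, map_mul, mul_right_comm, mul_mul_mul_comm] at key
  have hX : (Polynomial.X ^ k : Polynomial (MvPolynomial (Fin n) ℝ)) ≠ 0 :=
    pow_ne_zero _ Polynomial.X_ne_zero
  have key2 : gradeBy (fun _ => 1) g = Polynomial.C g * Polynomial.X ^ d := by
    refine mul_left_cancel₀ (mul_ne_zero (Polynomial.C_ne_zero.2 hf0) hX) ?_
    linear_combination key
  intro a ha
  have := coeff_coeff_gradeBy (fun _ => 1) g (wt (fun _ => 1) a) a
  rw [key2, Polynomial.coeff_C_mul, Polynomial.coeff_X_pow, if_pos rfl] at this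
  have hw : wt (fun _ => 1) a = Finsupp.weight 1 a := by
    simp [wt, Finsupp.weight_apply, Finsupp.sum_fintype]
  rw [hw] at this
  by_contra hne
  rw [if_neg hne] at this
  simp only [mul_zero, coeff_zero] at this
  exact ha this.symm

theorem isHomogeneous_macOp (q : ℝ) {t : ℝ} (ht : t ≠ 0) {n d : ℕ} {u : PowSum}
    (hu : (toVars n u).IsHomogeneous d) : (toVars n (macOp q t u)).IsHomogeneous d := by
  have hW : (discr n).IsHomogeneous (∑ p ∈ (Finset.univ : Finset (Fin n)).offDiag, 1) :=
    IsHomogeneous.prod _ _ _ fun p _ => (isHomogeneous_X _ _).sub (isHomogeneous_X _ _)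
  have hB : ∀ i, (discrShift n t i).IsHomogeneous
      (∑ p ∈ (Finset.univ : Finset (Fin n)).offDiag, 1) := fun i =>
    IsHomogeneous.prod _ _ _ fun p _ => ((isHomogeneous_X _ _).C_mul _).sub (isHomogeneous_X _ _)
  have hs : ∀ i, (scaleVar i q (toVars n u)).IsHomogeneous d := fun i a ha => by
    rw [coeff_scaleVar] at ha
    exact hu (right_ne_zero_of_mul ha)
  refine isHomogeneous_of_mul (discr_ne_zero n) hW ?_
  have h := discr_mul_macOp q ht n u
  have h2 : discr n * toVars n (macOp q t u) = C (t⁻¹ ^ n) * (discr n * toVars n u +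
      C (t - 1) * ∑ i, discrShift n t i * scaleVar i q (toVars n u)) := by
    rw [← h, ← mul_assoc, ← C_mul, ← mul_pow, inv_mul_cancel₀ ht, one_pow, C_1, one_mul]
  rw [h2]
  exact ((hW.mul hu).add ((IsHomogeneous.sum _ _ _ fun i _ => (hB i).mul (hs i)).C_mul _)).C_mul _

end MacdonaldInt

end

/-! ### Partitions as exponents, and the basis of monomial symmetric functions -/

noncomputable section

namespace MacdonaldInt

open MvPolynomial

/-! ### Partitions -/

theorem ptn_antitone (lam : Ptn) : Antitone lam.1 := lam.2

theorem apply_eq_zero_of_degree_le (lam : Ptn) {i : ℕ} (hi : lam.1.degree ≤ i) :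
    lam.1 i = 0 := by
  by_contra h
  have h1 : ∀ j ∈ Finset.range (i + 1), 1 ≤ lam.1 j := fun j hj =>
    (Nat.one_le_iff_ne_zero.2 h).trans (ptn_antitone lam (Nat.lt_succ_iff.1 (Finset.mem_range.1 hj)))
  have hsub : Finset.range (i + 1) ⊆ lam.1.support := fun j hj =>
    Finsupp.mem_support_iff.2 (Nat.one_le_iff_ne_zero.1 (h1 j hj))
  have h2 : i + 1 ≤ lam.1.degree := by
    calc i + 1 = ∑ j ∈ Finset.range (i + 1), 1 := by simp
      _ ≤ ∑ j ∈ Finset.range (i + 1), lam.1 j := Finset.sum_le_sum h1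
      _ ≤ ∑ j ∈ lam.1.support, lam.1 j := Finset.sum_le_sum_of_subset hsub
      _ = lam.1.degree := rfl
  omega

theorem finite_setOf_degree_le (d : ℕ) : {lam : Ptn | lam.1.degree ≤ d}.Finite := by
  let g : ℕ →₀ ℕ := Finsupp.onFinset (Finset.range d) (fun i => if i < d then d else 0) (by
    intro i hi
    by_contra h
    simp at h
    simp [Nat.not_lt.mpr h] at hi)
  refine Set.Finite.of_finite_image (f := Subtype.val) ((Set.finite_Iic g).subset ?_)
    Subtype.val_injective.injOn
  rintro _ ⟨lam, hlam, rfl⟩ i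
  simp only [g, Finsupp.onFinset_apply]
  split_ifs with h
  · exact (Finsupp.le_degree i lam.1).trans hlam
  · rw [apply_eq_zero_of_degree_le lam (le_trans hlam (not_lt.1 h))]

theorem domLT_trans {lam mu nu : Ptn} (h1 : DomLT lam mu) (h2 : DomLT mu nu) : DomLT lam nu := by
  refine ⟨?_, h1.2.1.trans h2.2.1, fun k => (h1.2.2 k).trans (h2.2.2 k)⟩
  rintro rfl
  refine h1.1 (Subtype.ext (Finsupp.ext fun i => ?_))
  have e : ∀ k, ∑ i ∈ Finset.range k, lam.1 i = ∑ i ∈ Finset.range k, mu.1 i := fun k =>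
    le_antisymm (h1.2.2 k) (h2.2.2 k)
  have := e (i + 1)
  rw [Finset.sum_range_succ, Finset.sum_range_succ, e i] at this
  omega

theorem finite_setOf_domLT (lam : Ptn) : {mu | DomLT mu lam}.Finite :=
  (finite_setOf_degree_le lam.1.degree).subset fun _ h => h.2.1.le

/-- The multiset of the nonzero values. -/
def parts {ι : Type*} (f : ι →₀ ℕ) : Multiset ℕ := f.support.val.map f

theorem card_parts {ι : Type*} (f : ι →₀ ℕ) : Multiset.card (parts f) = f.support.card := by
  simp [parts]

theorem mem_iff_lt_card_of_isLowerSet {s : Finset ℕ} (hs : IsLowerSet (s : Set ℕ)) (i : ℕ) :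
    i ∈ s ↔ i < s.card := by
  constructor
  · intro hi
    have : Finset.range (i + 1) ⊆ s := fun j hj =>
      hs (Nat.lt_succ_iff.1 (Finset.mem_range.1 hj)) hi
    simpa using Finset.card_le_card this
  · intro hi
    by_contra h
    have : s ⊆ Finset.range i := fun j hj => by
      by_contra hji
      exact h (hs (not_lt.1 (fun h' => hji (Finset.mem_range.2 h'))) hj)
    have := Finset.card_le_card this
    simp at this
    omega

/-- As the sequence decreases, the indices of the parts exceeding k form an initial segment. So a
partition can be recovered from its multiset of parts. -/
theorem lt_apply_iff (lam : Ptn) (i k : ℕ) :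
    k < lam.1 i ↔ i < Multiset.card ((parts lam.1).filter (k < ·)) := by
  have h1 : Multiset.card ((parts lam.1).filter (k < ·)) =
      (lam.1.support.filter fun j => k < lam.1 j).card := by
    rw [parts, Multiset.filter_map, Multiset.card_map]
    rfl
  rw [h1, ← mem_iff_lt_card_of_isLowerSet]
  · simp only [Finset.mem_filter, Finsupp.mem_support_iff]
    constructor
    · intro h; exact ⟨by omega, h⟩
    · exact fun h => h.2
  · intro a b hba ha
    simp only [Finset.coe_filter, Finsupp.mem_support_iff, Set.mem_ofPred_eq] at ha ⊢
    have := ptn_antitone lam hba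
    omega

theorem parts_injective {lam mu : Ptn} (h : parts lam.1 = parts mu.1) : lam = mu := by
  refine Subtype.ext (Finsupp.ext fun i => ?_)
  have : ∀ k, k < lam.1 i ↔ k < mu.1 i := fun k => by
    rw [lt_apply_iff lam, lt_apply_iff mu, h]
  exact le_antisymm (not_lt.1 fun h => absurd ((this _).1 h) (lt_irrefl _))
    (not_lt.1 fun h => absurd ((this _).2 h) (lt_irrefl _))

/-- The exponent of a function on `Fin n`. -/
abbrev expo {n : ℕ} (a : Fin n → ℕ) : Fin n →₀ ℕ := Finsupp.equivFunOnFinite.symm a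

/-- The first `n` entries of a partition as an exponent. -/
def res (lam : Ptn) (n : ℕ) : Fin n →₀ ℕ := expo fun i => lam.1 i

@[simp] theorem res_apply (lam : Ptn) (n : ℕ) (i : Fin n) : res lam n i = lam.1 i := rfl

/-- A partition with at most `n` parts. -/
def HasLen (lam : Ptn) (n : ℕ) : Prop := ∀ i, n ≤ i → lam.1 i = 0

theorem HasLen.mono {lam : Ptn} {n m : ℕ} (h : HasLen lam n) (hnm : n ≤ m) : HasLen lam m :=
  fun i hi => h i (hnm.trans hi)

theorem hasLen_degree (lam : Ptn) : HasLen lam lam.1.degree :=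
  fun _ hi => apply_eq_zero_of_degree_le lam hi

theorem HasLen.support_subset {lam : Ptn} {n : ℕ} (h : HasLen lam n) :
    lam.1.support ⊆ Finset.range n := fun i hi => by
  by_contra h'
  exact Finsupp.mem_support_iff.1 hi (h i (by simpa using h'))

theorem HasLen.sum_range {lam : Ptn} {n : ℕ} (h : HasLen lam n) :
    ∑ i ∈ Finset.range n, lam.1 i = lam.1.degree :=
  (Finset.sum_subset h.support_subset fun i _ hi => by simpa using hi).symm

theorem HasLen.degree_res {lam : Ptn} {n : ℕ} (h : HasLen lam n) :
    (res lam n).degree = lam.1.degree := by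
  rw [← h.sum_range, Finsupp.degree_eq_sum, ← Fin.sum_univ_eq_sum_range]
  rfl

theorem HasLen.parts_res {lam : Ptn} {n : ℕ} (h : HasLen lam n) :
    parts (res lam n) = parts lam.1 := by
  have : lam.1.support = (res lam n).support.map Fin.valEmbedding := by
    ext i
    simp only [Finsupp.mem_support_iff, Finset.mem_map, Fin.valEmbedding_apply, res_apply]
    constructor
    · intro hi
      have : i < n := by
        by_contra h'
        exact hi (h i (not_lt.1 h'))
      exact ⟨⟨i, this⟩, hi, rfl⟩
    · rintro ⟨j, hj, rfl⟩
      exact hj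
  rw [parts, parts, this, Finset.map_val, Multiset.map_map]
  rfl

theorem exists_ptn_perm {n : ℕ} (a : Fin n → ℕ) :
    ∃ lam : Ptn, HasLen lam n ∧ ∃ σ : Equiv.Perm (Fin n), ∀ i, a i = lam.1 (σ i) := by
  let τ : Equiv.Perm (Fin n) := Fin.revPerm.trans (Tuple.sort a)
  have hτ : Antitone (a ∘ τ) := fun i j hij =>
    Tuple.monotone_sort a (Fin.rev_le_rev.2 hij)
  refine ⟨⟨Finsupp.onFinset (Finset.range n) (fun i => if h : i < n then a (τ ⟨i, h⟩) else 0) ?_,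
    ?_⟩, ?_, τ.symm, ?_⟩
  · intro i hi
    by_contra h
    simp at h
    simp [Nat.not_lt.mpr h] at hi
  · intro i j hij
    simp only [Finsupp.onFinset_apply]
    split_ifs with h1 h2
    · exact hτ (show (⟨i, h2⟩ : Fin n) ≤ ⟨j, h1⟩ from hij)
    · omega
    · exact Nat.zero_le _
    · exact le_rfl
  · intro i hi
    simp [Nat.not_lt.mpr hi]
  · intro i
    simp

theorem parts_comp_perm {n : ℕ} {a b : Fin n →₀ ℕ} {σ : Equiv.Perm (Fin n)}
    (h : ∀ i, a i = b (σ i)) : parts a = parts b := by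
  have : b.support = a.support.map σ.toEmbedding := by
    ext i
    simp only [Finsupp.mem_support_iff, Finset.mem_map_equiv, h, Equiv.apply_symm_apply]
  rw [parts, parts, this, Finset.map_val, Multiset.map_map]
  exact Multiset.map_congr rfl fun i _ => h i

/-! ### Coefficients of symmetric functions -/

theorem isSymmetric_iff_coeff {n : ℕ} {f : MvPolynomial (Fin n) ℝ} : f.IsSymmetric ↔
    ∀ (σ : Equiv.Perm (Fin n)) (a b : Fin n →₀ ℕ), (∀ i, a i = b (σ i)) →
      f.coeff a = f.coeff b := by
  have key : ∀ (σ : Equiv.Perm (Fin n)) (a b : Fin n →₀ ℕ), (∀ i, a i = b (σ i)) →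
      (rename σ f).coeff b = f.coeff a := by
    intro σ a b hab
    rw [← coeff_rename_mapDomain σ σ.injective f a]
    refine congrArg (fun c => coeff c (rename σ f)) (Finsupp.ext fun i => ?_)
    obtain ⟨j, rfl⟩ := σ.surjective i
    rw [Finsupp.mapDomain_apply σ.injective, hab]
  constructor
  · intro h σ a b hab
    rw [← key σ a b hab, h σ]
  · intro h σ
    ext b
    have := key σ (expo fun i => b (σ i)) b fun i => rfl
    rw [this]
    exact h σ _ _ fun i => rfl

theorem coeff_dropLast {n : ℕ} (f : MvPolynomial (Fin (n + 1)) ℝ) (a : Fin n →₀ ℕ) :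
    (dropLast n f).coeff a = f.coeff (expo (Fin.snoc (α := fun _ => ℕ) a 0)) := by
  classical
  induction f using MvPolynomial.induction_on' with
  | monomial b r =>
    have h1 : dropLast n (monomial b r) =
        monomial (expo fun i => b (Fin.castSucc i)) (r * 0 ^ b (Fin.last n)) := by
      rw [dropLast, aeval_monomial, Finsupp.prod_fintype _ _ (by simp), Fin.prod_univ_castSucc]
      simp only [Fin.snoc_castSucc, Fin.snoc_last]
      rw [monomial_eq, Finsupp.prod_fintype _ _ (by simp), C_mul, algebraMap_eq, C_pow, C_0]
      simp only [Finsupp.equivFunOnFinite_symm_apply_apply]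
      ring
    rw [h1, coeff_monomial, coeff_monomial]
    by_cases h : b (Fin.last n) = 0
    · have : (expo (fun i => b (Fin.castSucc i)) = a) ↔
          b = expo (Fin.snoc (α := fun _ => ℕ) a 0) := by
        constructor
        · rintro rfl
          ext i
          refine Fin.lastCases ?_ (fun j => ?_) i <;> simp [h]
        · intro hb
          ext i
          rw [hb]
          simp
      simp only [this, h, pow_zero, mul_one]
    · have : b ≠ expo (Fin.snoc (α := fun _ => ℕ) a 0) := by
        intro hb
        exact h (by rw [hb]; simp)
      simp [this, h]
  | add p q hp hq => rw [map_add, coeff_add, hp, hq, coeff_add]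

/-- The coefficient of `x^lam`. -/
def symCoeff (lam : Ptn) : PolySeq →ₗ[ℝ] ℝ :=
  (lcoeff ℝ (res lam lam.1.degree)) ∘ₗ LinearMap.proj lam.1.degree

theorem symCoeff_apply (lam : Ptn) (f : PolySeq) :
    symCoeff lam f = (f lam.1.degree).coeff (res lam lam.1.degree) := rfl

theorem coeff_res_eq_of_le {f : PolySeq} (hf : f ∈ SymFun) {lam : Ptn} {n m : ℕ}
    (hn : HasLen lam n) (hnm : n ≤ m) : (f m).coeff (res lam m) = (f n).coeff (res lam n) := by
  induction m, hnm using Nat.le_induction with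
  | base => rfl
  | succ m hm ih =>
    rw [← ih, ← hf.2.1 m, coeff_dropLast]
    congr 1
    ext i
    refine Fin.lastCases ?_ (fun j => ?_) i
    · simp [hn m hm]
    · simp

/-- Compatibility under x_{n+1} = 0 makes the coefficient of x^λ independent of the number of
variables once λ fits. Taking |λ| variables in `symCoeff` is only a convenient choice that always
suffices. -/
theorem coeff_res {f : PolySeq} (hf : f ∈ SymFun) {lam : Ptn} {n : ℕ} (hn : HasLen lam n) :
    (f n).coeff (res lam n) = symCoeff lam f := by
  rcases le_total n lam.1.degree with h | h
  · exact (coeff_res_eq_of_le hf hn h).symm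
  · exact coeff_res_eq_of_le hf (hasLen_degree lam) h

theorem symFun_ext {f g : PolySeq} (hf : f ∈ SymFun) (hg : g ∈ SymFun)
    (h : ∀ lam, symCoeff lam f = symCoeff lam g) : f = g := by
  funext n
  ext a
  obtain ⟨lam, hl, σ, hσ⟩ := exists_ptn_perm a
  rw [isSymmetric_iff_coeff.1 (hf.1 n) σ a (res lam n) hσ,
    isSymmetric_iff_coeff.1 (hg.1 n) σ a (res lam n) hσ, coeff_res hf hl, coeff_res hg hl, h]

theorem exists_perm_iff_parts {lam : Ptn} {n : ℕ} (hl : HasLen lam n) (a : Fin n →₀ ℕ) :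
    (∃ σ : Equiv.Perm (Fin n), ∀ i, a i = lam.1 (σ i)) ↔ parts a = parts lam.1 := by
  constructor
  · rintro ⟨σ, hσ⟩
    rw [← hl.parts_res]
    exact parts_comp_perm (b := res lam n) hσ
  · intro h
    obtain ⟨mu, hm, σ, hσ⟩ := exists_ptn_perm a
    have : lam = mu := parts_injective (by
      rw [← h, ← hm.parts_res]
      exact parts_comp_perm (b := res mu n) hσ)
    exact ⟨σ, this ▸ hσ⟩

/-- An exponent is a rearrangement of λ exactly when it has the same nonzero entries. In this form
the case of too few variables needs no separate treatment. -/
theorem coeff_monomialSym (lam : Ptn) {n : ℕ} (a : Fin n →₀ ℕ) [Decidable (parts a = parts lam.1)] :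
    (monomialSym lam n).coeff a = if parts a = parts lam.1 then 1 else 0 := by
  classical
  by_cases hl : HasLen lam n
  · have hmon : ∀ b : Fin n → ℕ,
        ∏ i, (X i : MvPolynomial (Fin n) ℝ) ^ b i = monomial (expo b) 1 := by
      intro b
      rw [monomial_eq, Finsupp.prod_fintype _ _ (by simp), C_1, one_mul]
      rfl
    rw [monomialSym, if_pos (show ∀ i, n ≤ i → lam.1 i = 0 from hl), coeff_sum]
    simp only [hmon, coeff_monomial]
    have : ∀ b : Fin n → ℕ, (expo b = a) = (b = a) := fun b => by
      rw [eq_iff_iff]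
      constructor
      · rintro rfl; rfl
      · rintro rfl; ext i; rfl
    simp only [this, ← exists_perm_iff_parts hl]
    rw [Finset.sum_ite_eq']
    refine if_congr ?_ rfl rfl
    simp only [Finset.mem_image, Finset.mem_univ, true_and]
    exact exists_congr fun σ =>
      ⟨fun h i => (congrFun h i).symm, fun h => funext fun i => (h i).symm⟩
  · rw [monomialSym, if_neg (show ¬ ∀ i, n ≤ i → lam.1 i = 0 from hl), coeff_zero, if_neg]
    intro h
    obtain ⟨mu, hm, σ, hσ⟩ := exists_ptn_perm a
    rw [(exists_perm_iff_parts hm a).1 ⟨σ, hσ⟩] at h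
    exact hl (parts_injective h ▸ hm)

theorem degree_eq_sum_parts {ι : Type*} (f : ι →₀ ℕ) : f.degree = (parts f).sum := rfl

theorem isHomogeneous_monomialSym (lam : Ptn) (n : ℕ) :
    (monomialSym lam n).IsHomogeneous lam.1.degree := by
  classical
  intro a ha
  rw [coeff_monomialSym] at ha
  have h : parts a = parts lam.1 := by
    by_contra h
    exact ha (if_neg h)
  rw [degree_eq_sum_parts, ← h, ← degree_eq_sum_parts, Finsupp.degree_eq_weight_one]
  rfl

theorem monomialSym_mem (lam : Ptn) : monomialSym lam ∈ SymFun := by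
  classical
  refine ⟨fun n => ?_, fun n => ?_, lam.1.degree, fun n =>
    (isHomogeneous_monomialSym lam n).totalDegree_le⟩
  · rw [isSymmetric_iff_coeff]
    intro σ a b hab
    rw [coeff_monomialSym, coeff_monomialSym, parts_comp_perm hab]
  · ext a
    have : parts (expo (Fin.snoc (α := fun _ => ℕ) a 0)) = parts a := by
      have hs : (expo (Fin.snoc (α := fun _ => ℕ) a 0)).support =
          a.support.map Fin.castSuccEmb := by
        ext i
        refine Fin.lastCases ?_ (fun j => ?_) i
        · simp
        · simp
      rw [parts, hs, Finset.map_val, Multiset.map_map, parts]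
      refine Multiset.map_congr rfl fun i _ => ?_
      simp
    rw [coeff_dropLast, coeff_monomialSym, coeff_monomialSym, this]

theorem symCoeff_monomialSym (lam mu : Ptn) [Decidable (lam = mu)] :
    symCoeff lam (monomialSym mu) = if lam = mu then 1 else 0 := by
  classical
  rw [symCoeff_apply, coeff_monomialSym, (hasLen_degree lam).parts_res]
  exact if_congr ⟨fun h => parts_injective h, fun h => h ▸ rfl⟩ rfl rfl

theorem symFun_eq_sum {f : PolySeq} (hf : f ∈ SymFun) {s : Finset Ptn}
    (hs : ∀ lam, symCoeff lam f ≠ 0 → lam ∈ s) :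
    f = ∑ lam ∈ s, symCoeff lam f • monomialSym lam := by
  classical
  refine symFun_ext hf (Subalgebra.sum_mem _ fun lam _ =>
    Subalgebra.smul_mem _ (monomialSym_mem lam) _) fun mu => ?_
  rw [map_sum]
  simp only [map_smul, symCoeff_monomialSym, smul_eq_mul, mul_ite, mul_one, mul_zero]
  rw [Finset.sum_ite_eq]
  split_ifs with h
  · rfl
  · exact not_not.1 fun h' => h (hs mu h')

theorem exists_finset_symCoeff {f : PolySeq} (hf : f ∈ SymFun) :
    ∃ s : Finset Ptn, ∀ lam, symCoeff lam f ≠ 0 → lam ∈ s := by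
  obtain ⟨d, hd⟩ := hf.2.2
  refine ⟨(finite_setOf_degree_le d).toFinset, fun lam h => ?_⟩
  rw [Set.Finite.mem_toFinset, Set.mem_ofPred_eq, ← (hasLen_degree lam).degree_res]
  exact (le_totalDegree (mem_support_iff.2 h)).trans (hd _)

end MacdonaldInt

end

noncomputable section

namespace MacdonaldInt

open MvPolynomial

/-! ### Power sums generate the ring of symmetric functions -/

theorem psum_seq_mem (r : ℕ+) : (fun n : ℕ => psum (Fin n) ℝ (r : ℕ)) ∈ SymFun := by
  refine ⟨fun n => psum_isSymmetric _ _ _, fun n => ?_, r, fun n => ?_⟩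
  · simp only [psum, dropLast, Fin.sum_univ_castSucc]
    simp only [map_add, map_sum, map_pow, aeval_X, Fin.snoc_castSucc, Fin.snoc_last,
      zero_pow r.ne_zero, add_zero]
  · exact (IsHomogeneous.sum _ _ _ fun i _ => isHomogeneous_X_pow i (r : ℕ)).totalDegree_le

theorem powerSumMap_mem (u : PowSum) : powerSumMap u ∈ SymFun := by
  induction u using MvPolynomial.induction_on with
  | C a =>
    rw [← algebraMap_eq, AlgHom.commutes]
    exact SymFun.algebraMap_mem a
  | add a b ha hb => rw [map_add]; exact SymFun.add_mem ha hb
  | mul_X a r ha =>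
    rw [map_mul]
    refine SymFun.mul_mem ha ?_
    rw [powerSumMap, aeval_X]
    exact psum_seq_mem r

theorem coeff_toVars_X_mul {n : ℕ} (r : ℕ+) (u : PowSum) (a : Fin n →₀ ℕ) :
    (toVars n (X r * u)).coeff a = ∑ i, if (r : ℕ) ≤ a i then
      (toVars n u).coeff (a - Finsupp.single i (r : ℕ)) else 0 := by
  rw [map_mul, toVars, aeval_X, psum, Finset.sum_mul, coeff_sum]
  refine Finset.sum_congr rfl fun i _ => ?_
  rw [X_pow_eq_monomial, coeff_monomial_mul', one_mul]
  simp only [Finsupp.single_le_iff]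

/-- The product of power sums attached to a multiset. -/
def powProd (s : Multiset ℕ+) : PowSum := (s.map X).prod

theorem powProd_cons (r : ℕ+) (s : Multiset ℕ+) : powProd (r ::ₘ s) = X r * powProd s := by
  simp [powProd]

theorem monomial_eq_powProd (m : ℕ+ →₀ ℕ) :
    (monomial m 1 : PowSum) = powProd (Finsupp.toMultiset m) := by
  rw [powProd, monomial_eq, C_1, one_mul, Finsupp.toMultiset_map, Finsupp.prod_toMultiset,
    Finsupp.prod_mapDomain_index (by simp) (by simp [pow_add])]

theorem coeff_toVars_powProd_nonneg {n : ℕ} (s : Multiset ℕ+) (a : Fin n →₀ ℕ) :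
    0 ≤ (toVars n (powProd s)).coeff a := by
  classical
  induction s using Multiset.induction_on generalizing a with
  | empty =>
    simp only [powProd, Multiset.map_zero, Multiset.prod_zero, map_one, coeff_one]
    split_ifs <;> norm_num
  | cons r s ih =>
    rw [powProd_cons, coeff_toVars_X_mul]
    refine Finset.sum_nonneg fun i _ => ?_
    split_ifs
    · exact ih _
    · exact le_rfl

theorem support_sub_single {n : ℕ} {a : Fin n →₀ ℕ} {i : Fin n} {r : ℕ} (hr : 0 < r)
    (h : r ≤ a i) : a.support = insert i (a - Finsupp.single i r).support := by
  ext j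
  by_cases hj : j = i
  · subst hj
    simp
    omega
  · simp [hj, Finsupp.tsub_apply]

theorem parts_sub_single {n : ℕ} {a : Fin n →₀ ℕ} {i : Fin n} {r : ℕ} (hr : 0 < r)
    (h : a i = r) : parts a = r ::ₘ parts (a - Finsupp.single i r) := by
  have hi : i ∉ (a - Finsupp.single i r).support := by simp [h]
  rw [parts, support_sub_single hr h.ge, Finset.insert_val_of_notMem hi, Multiset.map_cons, h,
    parts]
  congr 1
  refine Multiset.map_congr rfl fun j hj => ?_
  have : j ≠ i := fun h => hi (h ▸ hj)
  simp [Finsupp.tsub_apply, Ne.symm this]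

/-- Multiplying out p_{r_1} ⋯ p_{r_k} assigns each r_j to a variable; the number of variables used
drops unless no two r_j are merged. So products of power sums are triangular in the m_λ with respect
to the number of parts. -/
theorem card_support_le_of_coeff_powProd_ne_zero {n : ℕ} (s : Multiset ℕ+) (a : Fin n →₀ ℕ)
    (ha : (toVars n (powProd s)).coeff a ≠ 0) : a.support.card ≤ Multiset.card s ∧
      (a.support.card = Multiset.card s → parts a = s.map (fun r : ℕ+ => (r : ℕ))) := by
  classical
  induction s using Multiset.induction_on generalizing a with
  | empty =>
    simp only [powProd, Multiset.map_zero, Multiset.prod_zero, map_one, coeff_one] at ha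
    have : a = 0 := by
      by_contra h
      exact ha (if_neg (Ne.symm h))
    simp [this, parts]
  | cons r s ih =>
    rw [powProd_cons, coeff_toVars_X_mul] at ha
    obtain ⟨i, -, hi⟩ := Finset.exists_ne_zero_of_sum_ne_zero ha
    have hle : (r : ℕ) ≤ a i := by
      by_contra h
      exact hi (if_neg h)
    rw [if_pos hle] at hi
    obtain ⟨h1, h2⟩ := ih _ hi
    have hs := support_sub_single r.pos hle
    rw [Multiset.card_cons]
    have hc : a.support.card ≤ (a - Finsupp.single i (r : ℕ)).support.card + 1 := by
      rw [hs]; exact Finset.card_insert_le _ _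
    refine ⟨by omega, fun h => ?_⟩
    have hni : i ∉ (a - Finsupp.single i (r : ℕ)).support := fun hmem => by
      rw [hs, Finset.insert_eq_of_mem hmem] at h
      omega
    have hai : a i = r := by
      simp [Finsupp.tsub_apply] at hni
      omega
    rw [parts_sub_single r.pos hai, h2 (by omega), Multiset.map_cons]

theorem coeff_toVars_powProd_pos {n : ℕ} (s : Multiset ℕ+) (a : Fin n →₀ ℕ)
    (h : parts a = s.map (fun r : ℕ+ => (r : ℕ))) : 0 < (toVars n (powProd s)).coeff a := by
  classical
  induction s using Multiset.induction_on generalizing a with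
  | empty =>
    have : a = 0 := by
      rw [← Finsupp.support_eq_empty, ← Finset.card_eq_zero, ← card_parts, h]
      rfl
    simp [this, powProd]
  | cons r s ih =>
    have hr : (r : ℕ) ∈ parts a := by
      rw [h, Multiset.map_cons]
      exact Multiset.mem_cons_self _ _
    obtain ⟨i, -, hi⟩ := Multiset.mem_map.1 hr
    rw [parts_sub_single r.pos hi, Multiset.map_cons, Multiset.cons_inj_right] at h
    rw [powProd_cons, coeff_toVars_X_mul]
    refine Finset.sum_pos' (fun j _ => ?_) ⟨i, Finset.mem_univ i, ?_⟩
    · split_ifs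
      · exact coeff_toVars_powProd_nonneg _ _
      · exact le_rfl
    · rw [if_pos hi.ge]
      exact ih _ h

theorem exists_parts_eq (s : Multiset ℕ+) :
    ∃ (n : ℕ) (a : Fin n →₀ ℕ), parts a = s.map (fun r : ℕ+ => (r : ℕ)) := by
  induction s using Quotient.inductionOn with
  | _ l =>
  refine ⟨l.length, expo fun i => (l.get i : ℕ), ?_⟩
  have hs : (expo fun i => (l.get i : ℕ)).support = Finset.univ := by
    ext i
    simp
  rw [parts, hs]
  simp only [Finsupp.equivFunOnFinite_symm_apply_apply, Fin.univ_val_map]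
  change (↑(List.ofFn fun i => (l.get i : ℕ)) : Multiset ℕ) = Multiset.map _ (↑l : Multiset ℕ+)
  rw [Multiset.map_coe]
  congr 1
  exact List.ext_get (by simp) fun k h1 h2 => by simp

theorem powerSumMap_injective : Function.Injective powerSumMap := by
  rw [injective_iff_map_eq_zero]
  intro u hu
  by_contra h0
  -- A term with the largest number of factors p_r is chosen. The monomial whose exponents are its
  -- unmerged parts can occur in no other term.
  obtain ⟨m, hm, hmax⟩ := Finset.exists_max_image u.support
    (fun m => Multiset.card (Finsupp.toMultiset m))
    (Finset.nonempty_of_ne_empty (by simpa using h0))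
  obtain ⟨n, a, ha⟩ := exists_parts_eq (Finsupp.toMultiset m)
  have h1 : (toVars n u).coeff a = 0 := by
    rw [← powerSumMap_apply, hu]; simp
  have h2 : toVars n u = ∑ k ∈ u.support, u.coeff k • toVars n (powProd (Finsupp.toMultiset k)) := by
    conv_lhs => rw [u.as_sum]
    rw [map_sum]
    refine Finset.sum_congr rfl fun k _ => ?_
    rw [← map_smul, ← monomial_eq_powProd, smul_monomial, smul_eq_mul, mul_one]
  rw [h2, coeff_sum, Finset.sum_eq_single_of_mem m hm] at h1
  · rw [coeff_smul, smul_eq_mul] at h1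
    exact mul_ne_zero (mem_support_iff.1 hm) (coeff_toVars_powProd_pos _ _ ha).ne' h1
  · intro k hk hkm
    rw [coeff_smul, smul_eq_mul]
    refine mul_eq_zero_of_right _ ?_
    by_contra hc
    obtain ⟨h3, h4⟩ := card_support_le_of_coeff_powProd_ne_zero _ _ hc
    have h5 : a.support.card = Multiset.card (Finsupp.toMultiset m) := by
      rw [← card_parts, ha, Multiset.card_map]
    have h6 := hmax k hk
    have h7 := h4 (by omega)
    rw [ha] at h7
    have := Multiset.map_injective PNat.coe_injective h7
    exact hkm (by rw [← Finsupp.toMultiset_toFinsupp k, ← this, Finsupp.toMultiset_toFinsupp])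

/-- The multiset of parts of a partition, as positive integers. -/
def pparts (lam : Ptn) : Multiset ℕ+ := (parts lam.1).map Nat.toPNat'

theorem map_pparts (lam : Ptn) : (pparts lam).map (fun r : ℕ+ => (r : ℕ)) = parts lam.1 := by
  rw [pparts, Multiset.map_map]
  conv_rhs => rw [← Multiset.map_id (parts lam.1)]
  refine Multiset.map_congr rfl fun k hk => ?_
  obtain ⟨i, hi, rfl⟩ := Multiset.mem_map.1 hk
  have : 0 < lam.1 i := Nat.pos_of_ne_zero (Finsupp.mem_support_iff.1 hi)
  simp [Nat.toPNat'_coe, this]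

/-- Induction on the number of parts: p_λ is a positive multiple of m_λ plus m_μ with fewer parts.
-/
theorem monomialSym_mem_range (lam : Ptn) : ∃ u, powerSumMap u = monomialSym lam := by
  classical
  induction hk : lam.1.support.card using Nat.strong_induction_on generalizing lam with
  | _ k ih =>
  set f := powerSumMap (powProd (pparts lam)) with hf
  have hfm : f ∈ SymFun := powerSumMap_mem _
  obtain ⟨s, hs⟩ := exists_finset_symCoeff hfm
  have hcard : Multiset.card (pparts lam) = lam.1.support.card := by
    rw [pparts, Multiset.card_map, card_parts]
  have hpos : 0 < symCoeff lam f := by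
    rw [symCoeff_apply, hf, powerSumMap_apply]
    refine coeff_toVars_powProd_pos _ _ ?_
    rw [(hasLen_degree lam).parts_res, map_pparts]
  have hlt : ∀ mu, symCoeff mu f ≠ 0 → mu ≠ lam → mu.1.support.card < lam.1.support.card := by
    intro mu h hne
    rw [symCoeff_apply, hf, powerSumMap_apply] at h
    obtain ⟨h1, h2⟩ := card_support_le_of_coeff_powProd_ne_zero _ _ h
    rw [hcard, ← card_parts, (hasLen_degree mu).parts_res, card_parts] at h1 h2
    refine lt_of_le_of_ne h1 fun h3 => hne (parts_injective ?_)
    rw [h2 h3, map_pparts]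
  have hrange : ∀ mu ∈ s.erase lam, ∃ v, powerSumMap v = symCoeff mu f • monomialSym mu := by
    intro mu hmu
    by_cases h : symCoeff mu f = 0
    · exact ⟨0, by rw [h, zero_smul, map_zero]⟩
    · obtain ⟨v, hv⟩ := ih _ (hk ▸ hlt mu h (Finset.ne_of_mem_erase hmu)) mu rfl
      exact ⟨symCoeff mu f • v, by rw [map_smul, hv]⟩
  choose! v hv using hrange
  refine ⟨(symCoeff lam f)⁻¹ • (powProd (pparts lam) - ∑ mu ∈ s.erase lam, v mu), ?_⟩
  have h := symFun_eq_sum hfm hs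
  rw [← Finset.add_sum_erase _ _ (hs lam hpos.ne')] at h
  rw [map_smul, map_sub, map_sum, Finset.sum_congr rfl hv, ← hf, sub_eq_of_eq_add h, smul_smul, inv_mul_cancel₀ hpos.ne', one_smul]

/-- The monomial symmetric functions as polynomials in the power sums. -/
def mono (lam : Ptn) : PowSum := (monomialSym_mem_range lam).choose

theorem powerSumMap_mono (lam : Ptn) : powerSumMap (mono lam) = monomialSym lam :=
  (monomialSym_mem_range lam).choose_spec

/-- The coefficient of `m_lam`. -/
def monoCoeff (lam : Ptn) : PowSum →ₗ[ℝ] ℝ := symCoeff lam ∘ₗ powerSumMap.toLinearMap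

theorem monoCoeff_apply (lam : Ptn) (u : PowSum) :
    monoCoeff lam u = symCoeff lam (powerSumMap u) := rfl

theorem monoCoeff_mono (lam mu : Ptn) [Decidable (lam = mu)] :
    monoCoeff lam (mono mu) = if lam = mu then 1 else 0 := by
  rw [monoCoeff_apply, powerSumMap_mono, symCoeff_monomialSym]

theorem coeff_toVars_res {lam : Ptn} {n : ℕ} (h : HasLen lam n) (u : PowSum) :
    (toVars n u).coeff (res lam n) = monoCoeff lam u := by
  rw [← powerSumMap_apply, coeff_res (powerSumMap_mem u) h, monoCoeff_apply]

theorem exists_eq_sum_mono (u : PowSum) : ∃ s : Finset Ptn,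
    (∀ lam, monoCoeff lam u ≠ 0 → lam ∈ s) ∧ u = ∑ lam ∈ s, monoCoeff lam u • mono lam := by
  obtain ⟨s, hs⟩ := exists_finset_symCoeff (powerSumMap_mem u)
  refine ⟨s, hs, powerSumMap_injective ?_⟩
  rw [map_sum]
  simp only [map_smul, powerSumMap_mono]
  exact symFun_eq_sum (powerSumMap_mem u) hs

theorem mem_span_mono {u : PowSum} {S : Set Ptn} (h : ∀ lam, monoCoeff lam u ≠ 0 → lam ∈ S) :
    u ∈ Submodule.span ℝ (mono '' S) := by
  obtain ⟨s, -, hs⟩ := exists_eq_sum_mono u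
  rw [hs]
  refine Submodule.sum_mem _ fun lam _ => ?_
  by_cases h0 : monoCoeff lam u = 0
  · rw [h0, zero_smul]; exact Submodule.zero_mem _
  · exact Submodule.smul_mem _ _ (Submodule.subset_span ⟨lam, h lam h0, rfl⟩)

theorem exists_powerSumMap_eq {f : PolySeq} (hf : f ∈ SymFun) : ∃ u, powerSumMap u = f := by
  obtain ⟨s, hs⟩ := exists_finset_symCoeff hf
  refine ⟨∑ lam ∈ s, symCoeff lam f • mono lam, ?_⟩
  rw [map_sum]
  simp only [map_smul, powerSumMap_mono]
  exact (symFun_eq_sum hf hs).symm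

theorem powerSumMap_powerSumExpansion (f : SymFun) : powerSumMap (powerSumExpansion f) = f :=
  Function.invFun_eq (exists_powerSumMap_eq f.2)

theorem powerSumExpansion_mk (u : PowSum) :
    powerSumExpansion ⟨powerSumMap u, powerSumMap_mem u⟩ = u :=
  powerSumMap_injective (powerSumMap_powerSumExpansion _)

theorem scalar_eq_pairing (q t : ℝ) (f g : SymFun) :
    scalar q t f g = pairing q t (powerSumExpansion f) (powerSumExpansion g) := rfl

end MacdonaldInt

end

/-! ### Triangularity of the operator and its eigenvalues -/

noncomputable section

namespace MacdonaldInt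

open MvPolynomial

/-! ### Triangularity with respect to the dominance order -/

theorem sum_le_sum_range_of_antitone {f : ℕ → ℕ} (hf : Antitone f) (s : Finset ℕ) :
    ∑ i ∈ s, f i ≤ ∑ i ∈ Finset.range s.card, f i := by
  induction hk : s.card generalizing s with
  | zero => simp [Finset.card_eq_zero.1 hk]
  | succ k ih =>
    have hne : s.Nonempty := Finset.card_pos.1 (by omega)
    set M := s.max' hne
    have hM : M ∈ s := s.max'_mem hne
    have hkM : k ≤ M := by
      have : s ⊆ Finset.range (M + 1) := fun i hi =>
        Finset.mem_range.2 (Nat.lt_succ_of_le (s.le_max' i hi))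
      have := Finset.card_le_card this
      rw [Finset.card_range] at this
      omega
    rw [← Finset.sum_erase_add _ _ hM, Finset.sum_range_succ]
    exact add_le_add (ih _ (by rw [Finset.card_erase_of_mem hM]; omega)) (hf hkM)

/-- The weight counting the first `k` exponents. -/
def headWt (n k : ℕ) (i : Fin n) : ℕ := if (i : ℕ) < k then 1 else 0

theorem wt_headWt_res {lam : Ptn} {n : ℕ} (hl : HasLen lam n) (k : ℕ) :
    wt (headWt n k) (res lam n) = ∑ i ∈ Finset.range k, lam.1 i := by
  have h1 : wt (headWt n k) (res lam n) =
      ∑ i ∈ Finset.range n, if i < k then lam.1 i else 0 := by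
    rw [← Fin.sum_univ_eq_sum_range fun i => if i < k then lam.1 i else 0]
    exact Finset.sum_congr rfl fun i _ => by simp [headWt]
  rw [h1, ← Finset.sum_filter]
  refine Finset.sum_subset (fun i hi => ?_) fun i hi hi' => hl i ?_
  · simp only [Finset.mem_filter, Finset.mem_range] at hi ⊢
    exact hi.2
  · simp only [Finset.mem_filter, Finset.mem_range, not_and] at hi hi'
    by_contra h
    exact hi' (not_le.1 h) hi

theorem wt_headWt_le_of_parts {lam : Ptn} {n : ℕ} {a : Fin n →₀ ℕ} (h : parts a = parts lam.1)
    (k : ℕ) : wt (headWt n k) a ≤ ∑ i ∈ Finset.range k, lam.1 i := by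
  obtain ⟨mu, hm, σ, hσ⟩ := exists_ptn_perm a
  have hmu : mu = lam := parts_injective (by
    rw [← (exists_perm_iff_parts hm a).1 ⟨σ, hσ⟩, h])
  subst hmu
  have h1 : wt (headWt n k) a =
      ∑ i ∈ (Finset.univ.filter fun i : Fin n => (i : ℕ) < k).map
        (σ.toEmbedding.trans Fin.valEmbedding), mu.1 i := by
    rw [Finset.sum_map, Finset.sum_filter]
    exact Finset.sum_congr rfl fun i _ => by simp [headWt, hσ]
  rw [h1]
  refine (sum_le_sum_range_of_antitone (ptn_antitone mu) _).trans
    (Finset.sum_le_sum_of_subset fun i hi => ?_)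
  rw [Finset.card_map] at hi
  refine Finset.mem_range.2 ((Finset.mem_range.1 hi).trans_le ?_)
  have : ((Finset.univ.filter fun i : Fin n => (i : ℕ) < k).map Fin.valEmbedding) ⊆
      Finset.range k := fun i hi => by
    obtain ⟨j, hj, rfl⟩ := Finset.mem_map.1 hi
    simpa using (Finset.mem_filter.1 hj).2
  simpa using Finset.card_le_card this

theorem toVars_mono (lam : Ptn) (n : ℕ) : toVars n (mono lam) = monomialSym lam n := by
  rw [← powerSumMap_apply, powerSumMap_mono]

theorem wt_headWt_le_of_coeff_mono {lam : Ptn} {n : ℕ} {a : Fin n →₀ ℕ}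
    (h : (toVars n (mono lam)).coeff a ≠ 0) (k : ℕ) :
    wt (headWt n k) a ≤ ∑ i ∈ Finset.range k, lam.1 i := by
  classical
  rw [toVars_mono, coeff_monomialSym] at h
  exact wt_headWt_le_of_parts (by by_contra h'; exact h (if_neg h')) k

/-- The k-th dominance inequality is the degree bound for the grading in which the first k variables
have weight 1 and the others weight 0. Equality of sizes is homogeneity. -/
theorem domLT_or_eq_of_monoCoeff_macOp_ne_zero (q : ℝ) {t : ℝ} (ht : t ≠ 0) {lam mu : Ptn}
    (h : monoCoeff mu (macOp q t (mono lam)) ≠ 0) : mu = lam ∨ DomLT mu lam := by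
  by_cases hne : mu = lam
  · exact Or.inl hne
  set n := mu.1.degree
  have hm : HasLen mu n := hasLen_degree mu
  rw [← coeff_toVars_res hm] at h
  refine Or.inr ⟨hne, ?_, fun k => ?_⟩
  · have h1 : (toVars n (mono lam)).IsHomogeneous lam.1.degree := by
      rw [toVars_mono]; exact isHomogeneous_monomialSym lam n
    have h2 := isHomogeneous_macOp q ht h1 h
    rw [← hm.degree_res, Finsupp.degree_eq_weight_one]
    exact h2
  · rw [← wt_headWt_res hm]
    exact wt_le_of_coeff_macOp_ne_zero (headWt n k) q ht
      (fun a ha => wt_headWt_le_of_coeff_mono ha k) h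

/-! ### The diagonal coefficients -/

theorem toLex_le_of_wt_headWt_le {n : ℕ} {a b : Fin n →₀ ℕ}
    (h : ∀ k, wt (headWt n k) a ≤ wt (headWt n k) b) : toLex a ≤ toLex b := by
  by_contra hlt
  obtain ⟨j, hj, hj'⟩ := Finsupp.Lex.lt_iff.1 (not_le.1 hlt)
  simp only [ofLex_toLex] at hj hj'
  refine absurd (h (j + 1)) (not_le.2 ?_)
  refine Finset.sum_lt_sum (fun i _ => ?_) ⟨j, Finset.mem_univ j, by simpa [headWt] using hj'⟩
  simp only [headWt]
  split_ifs with hi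
  · rcases (Nat.lt_succ_iff.1 hi).eq_or_lt with h' | h'
    · rw [Fin.ext h']; simpa using hj'.le
    · rw [hj i h']
  · simp

/-- Leading coefficients multiply. Only upper bounds for the leading exponents are required, so the
coefficients involved are allowed to vanish. -/
theorem coeff_prod_of_degree_le {σ ι : Type*} (m : MonomialOrder σ) (P : ι → MvPolynomial σ ℝ)
    (b : ι → σ →₀ ℕ) (s : Finset ι) (h : ∀ i ∈ s, m.toSyn (m.degree (P i)) ≤ m.toSyn (b i)) :
    m.toSyn (m.degree (∏ i ∈ s, P i)) ≤ m.toSyn (∑ i ∈ s, b i) ∧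
      (∏ i ∈ s, P i).coeff (∑ i ∈ s, b i) = ∏ i ∈ s, (P i).coeff (b i) := by
  classical
  induction s using Finset.induction_on with
  | empty => simp
  | insert j s hj ih =>
    obtain ⟨h1, h2⟩ := ih fun i hi => h i (Finset.mem_insert_of_mem hi)
    have h3 := h j (Finset.mem_insert_self _ _)
    rw [Finset.prod_insert hj, Finset.sum_insert hj, Finset.prod_insert hj]
    refine ⟨m.degree_mul_le.trans ?_, ?_⟩
    · rw [map_add, map_add]
      exact add_le_add h3 h1
    · rw [m.coeff_mul_of_add_of_degree_le h3 h1, h2]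

/-- The leading exponent of `∏_{i ≠ j} (x_i - x_j)`. -/
def discrExpo (n : ℕ) : Fin n →₀ ℕ :=
  ∑ p ∈ (Finset.univ : Finset (Fin n)).offDiag, Finsupp.single (min p.1 p.2) 1

theorem lex_degree_factor_le {n : ℕ} (c : ℝ) (a b : Fin n) :
    MonomialOrder.lex.toSyn (MonomialOrder.lex.degree (C c * X a - X b : MvPolynomial (Fin n) ℝ)) ≤
      MonomialOrder.lex.toSyn (Finsupp.single (min a b) 1) := by
  classical
  rw [MonomialOrder.degree_le_iff]
  intro e he
  rw [mem_support_iff, coeff_sub, coeff_C_mul, coeff_X, coeff_X] at he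
  by_cases h1 : Finsupp.single a 1 = e
  · subst h1
    exact Finsupp.Lex.single_le_iff.2 (min_le_left _ _)
  · by_cases h2 : Finsupp.single b 1 = e
    · subst h2
      exact Finsupp.Lex.single_le_iff.2 (min_le_right _ _)
    · simp [h1, h2] at he

theorem coeff_factor {n : ℕ} (c : ℝ) {a b : Fin n} (hab : a ≠ b) :
    (C c * X a - X b : MvPolynomial (Fin n) ℝ).coeff (Finsupp.single (min a b) 1) =
      if a < b then c else -1 := by
  classical
  rw [coeff_sub, coeff_C_mul, coeff_X, coeff_X]
  have hs : ∀ i j : Fin n, (Finsupp.single i 1 = Finsupp.single j 1) ↔ i = j := fun i j =>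
    (Finsupp.single_left_injective (one_ne_zero (α := ℕ))).eq_iff
  simp only [hs]
  rcases lt_or_gt_of_ne hab with h | h
  · simp [min_eq_left h.le, h, hab.symm]
  · simp [min_eq_right h.le, not_lt.2 h.le, hab]

/-- In the lexicographic order the leading variable of each factor is the one of smaller index. The
parameter t enters the leading coefficient once for every j > i, that is n - 1 - i times. -/
theorem coeff_discrShift (n : ℕ) (t : ℝ) (i : Fin n) :
    MonomialOrder.lex.toSyn (MonomialOrder.lex.degree (discrShift n t i)) ≤
      MonomialOrder.lex.toSyn (discrExpo n) ∧
    (discrShift n t i).coeff (discrExpo n) =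
      (∏ p ∈ (Finset.univ : Finset (Fin n)).offDiag, if p.1 < p.2 then 1 else -1) *
        t ^ (n - 1 - i) := by
  obtain ⟨h1, h2⟩ := coeff_prod_of_degree_le MonomialOrder.lex
    (fun p : Fin n × Fin n => C (if p.1 = i then t else 1) * X p.1 - X p.2)
    (fun p => Finsupp.single (min p.1 p.2) 1) (Finset.univ : Finset (Fin n)).offDiag
    fun p _ => lex_degree_factor_le _ _ _
  refine ⟨h1, h2.trans ?_⟩
  have h3 : t ^ (n - 1 - i) = ∏ p ∈ (Finset.univ : Finset (Fin n)).offDiag,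
      if p.1 = i then (if i < p.2 then t else 1) else 1 := by
    rw [prod_offDiag_fst i fun j => if i < j then t else 1, Finset.prod_ite, Finset.prod_const,
      Finset.prod_const_one, mul_one]
    congr 1
    have : (Finset.univ.erase i).filter (fun j => i < j) = Finset.Ioi i := by
      ext j
      simp only [Finset.mem_filter, Finset.mem_erase, Finset.mem_univ, and_true, Finset.mem_Ioi]
      exact ⟨fun h => h.2, fun h => ⟨h.ne', h⟩⟩
    rw [this, Fin.card_Ioi]
  rw [h3, ← Finset.prod_mul_distrib]
  refine Finset.prod_congr rfl fun p hp => ?_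
  rw [coeff_factor _ (Finset.mem_offDiag.1 hp).2.2]
  by_cases hi : p.1 = i
  · by_cases hlt : p.1 < p.2
    · have hlt' : i < p.2 := hi ▸ hlt
      simp [hi, hlt']
    · have hlt' : ¬ i < p.2 := hi ▸ hlt
      simp [hi, hlt']
  · simp [hi]

theorem coeff_discr (n : ℕ) :
    MonomialOrder.lex.toSyn (MonomialOrder.lex.degree (discr n)) ≤
      MonomialOrder.lex.toSyn (discrExpo n) ∧
    (discr n).coeff (discrExpo n) =
      ∏ p ∈ (Finset.univ : Finset (Fin n)).offDiag, if p.1 < p.2 then 1 else -1 := by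
  obtain ⟨h1, h2⟩ := coeff_prod_of_degree_le MonomialOrder.lex
    (fun p : Fin n × Fin n => C 1 * X p.1 - X p.2)
    (fun p => Finsupp.single (min p.1 p.2) 1) (Finset.univ : Finset (Fin n)).offDiag
    fun p _ => lex_degree_factor_le _ _ _
  have h3 : ∏ p ∈ (Finset.univ : Finset (Fin n)).offDiag, (C 1 * X p.1 - X p.2) = discr n := by
    simp only [C_1, one_mul]; rfl
  rw [h3] at h1 h2
  exact ⟨h1, h2.trans (Finset.prod_congr rfl fun p hp =>
    coeff_factor _ (Finset.mem_offDiag.1 hp).2.2)⟩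

/-- The eigenvalue of the Macdonald operator on `P_lam`. -/
def eig (q t : ℝ) (lam : Ptn) : ℝ :=
  1 + (t - 1) * lam.1.sum fun i k => t⁻¹ ^ (i + 1) * (q ^ k - 1)

theorem eig_eq_sum_range (q t : ℝ) {lam : Ptn} {n : ℕ} (hl : HasLen lam n) : eig q t lam =
    1 + (t - 1) * ∑ i ∈ Finset.range n, t⁻¹ ^ (i + 1) * (q ^ lam.1 i - 1) := by
  rw [eig, Finsupp.sum_of_support_subset _ hl.support_subset _ (by simp)]

/-- The eigenvalue in its usual n-variable form. The stable form subtracts 1 from each q^{λ_i},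
which is compensated by the geometric sum t^n - 1 = (t - 1) ∑ t^i. -/
theorem pow_mul_eig (q : ℝ) {t : ℝ} (ht : t ≠ 0) {lam : Ptn} {n : ℕ} (hl : HasLen lam n) :
    t ^ n * eig q t lam = 1 + (t - 1) * ∑ i : Fin n, t ^ (n - 1 - i : ℕ) * q ^ lam.1 i := by
  rw [eig_eq_sum_range q t hl, Fin.sum_univ_eq_sum_range fun i => t ^ (n - 1 - i : ℕ) * q ^ lam.1 i]
  have h1 : ∀ i ∈ Finset.range n, t ^ n * (t⁻¹ ^ (i + 1) * (q ^ lam.1 i - 1)) =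
      t ^ (n - 1 - i) * q ^ lam.1 i - t ^ (n - 1 - i) := fun i hi => by
    have : t ^ n = t ^ (n - 1 - i) * t ^ (i + 1) := by
      rw [← pow_add]; congr 1; have := Finset.mem_range.1 hi; omega
    rw [this, inv_pow]
    field_simp
  have h2 : ∑ i ∈ Finset.range n, t ^ (n - 1 - i) * (t - 1) = t ^ n - 1 := by
    rw [← Finset.sum_mul, Finset.sum_range_reflect fun i => t ^ i]
    exact geom_sum_mul t n
  rw [mul_add, mul_left_comm, Finset.mul_sum, Finset.sum_congr rfl h1, Finset.sum_sub_distrib,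
    mul_sub]
  rw [← Finset.sum_mul] at h2
  linear_combination -h2

/-- Comparison of the coefficients of the lexicographically leading monomial in `discr_mul_macOp`.
The sign contributed by the discriminant is common to all terms and cancels. -/
theorem monoCoeff_macOp_self (q : ℝ) {t : ℝ} (ht : t ≠ 0) (lam : Ptn) :
    monoCoeff lam (macOp q t (mono lam)) = eig q t lam := by
  classical
  set n := lam.1.degree
  have hl : HasLen lam n := hasLen_degree lam
  have hle : ∀ (f : MvPolynomial (Fin n) ℝ), (∀ a, f.coeff a ≠ 0 → ∀ k,
      wt (headWt n k) a ≤ ∑ i ∈ Finset.range k, lam.1 i) →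
      MonomialOrder.lex.toSyn (MonomialOrder.lex.degree f) ≤
        MonomialOrder.lex.toSyn (res lam n) := by
    intro f hf
    rw [MonomialOrder.degree_le_iff]
    intro a ha
    refine toLex_le_of_wt_headWt_le fun k => ?_
    rw [wt_headWt_res hl]
    exact hf a (mem_support_iff.1 ha) k
  have h0 := hle (toVars n (mono lam)) fun a ha k => wt_headWt_le_of_coeff_mono ha k
  have h1 := hle (toVars n (macOp q t (mono lam))) fun a ha k =>
    wt_le_of_coeff_macOp_ne_zero (headWt n k) q ht
      (fun a ha => wt_headWt_le_of_coeff_mono ha k) ha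
  have h2 : ∀ i, MonomialOrder.lex.toSyn (MonomialOrder.lex.degree
      (scaleVar i q (toVars n (mono lam)))) ≤ MonomialOrder.lex.toSyn (res lam n) := fun i =>
    hle _ fun a ha k => by
      rw [coeff_scaleVar] at ha
      exact wt_headWt_le_of_coeff_mono (right_ne_zero_of_mul ha) k
  have h3 : (toVars n (mono lam)).coeff (res lam n) = 1 := by
    rw [coeff_toVars_res hl, monoCoeff_mono, if_pos rfl]
  have key := congrArg (coeff (discrExpo n + res lam n)) (discr_mul_macOp q ht n (mono lam))
  rw [coeff_C_mul, coeff_add, coeff_C_mul, coeff_sum,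
    MonomialOrder.lex.coeff_mul_of_add_of_degree_le (coeff_discr n).1 h1,
    MonomialOrder.lex.coeff_mul_of_add_of_degree_le (coeff_discr n).1 h0,
    Finset.sum_congr rfl fun i _ =>
      MonomialOrder.lex.coeff_mul_of_add_of_degree_le (coeff_discrShift n t i).1 (h2 i)] at key
  simp only [(coeff_discr n).2, (coeff_discrShift n t _).2, coeff_scaleVar, h3,
    coeff_toVars_res hl, mul_one] at key
  set ε : ℝ := ∏ p ∈ (Finset.univ : Finset (Fin n)).offDiag, if p.1 < p.2 then 1 else -1 with hε
  have hε0 : ε ≠ 0 := Finset.prod_ne_zero_iff.2 fun p _ => by split_ifs <;> norm_num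
  have hp := pow_mul_eig q ht hl
  refine mul_left_cancel₀ (mul_ne_zero hε0 (pow_ne_zero n ht)) ?_
  simp only [mul_assoc ε, ← Finset.mul_sum, res_apply] at key
  linear_combination key - ε * hp

/-! ### Separation of the eigenvalues -/

/-- Convexity of k ↦ q^k bounds the difference of the two sums ∑ t^{-i} q^{λ_i} and ∑ t^{-i} q^{μ_i}
from below by log q · ∑ c_i (λ_i - μ_i), where c_i = t^{-i} q^{μ_i} increases with i. Summation by
parts and dominance make the latter sum negative, and log q < 0. -/
theorem eig_ne_of_domLT {q t : ℝ} (hq0 : 0 < q) (hq1 : q < 1) (ht0 : 0 < t) (ht1 : t < 1)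
    {lam mu : Ptn} (h : DomLT mu lam) : eig q t lam ≠ eig q t mu := by
  set n := lam.1.degree with hn
  have hl : HasLen lam n := hasLen_degree lam
  have hm : HasLen mu n := by rw [hn, ← h.2.1]; exact hasLen_degree mu
  set c : ℕ → ℝ := fun i => t⁻¹ ^ (i + 1) * q ^ mu.1 i with hc
  set x : ℕ → ℝ := fun i => (lam.1 i : ℝ) - mu.1 i with hx
  set L := Real.log q with hL
  have hL0 : L < 0 := Real.log_neg hq0 hq1
  have ht' : 1 < t⁻¹ := (one_lt_inv₀ ht0).2 ht1
  have hcmono : ∀ i, c i < c (i + 1) := fun i => by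
    have h1 : t⁻¹ ^ (i + 1) < t⁻¹ ^ (i + 1 + 1) := pow_lt_pow_right₀ ht' (Nat.lt_succ_self _)
    have h2 : q ^ mu.1 i ≤ q ^ mu.1 (i + 1) :=
      pow_le_pow_of_le_one hq0.le hq1.le (ptn_antitone mu (Nat.le_succ i))
    exact mul_lt_mul h1 h2 (by positivity) (by positivity)
  have hX : ∀ k, ∑ i ∈ Finset.range k, x i =
      ((∑ i ∈ Finset.range k, lam.1 i : ℕ) : ℝ) - (∑ i ∈ Finset.range k, mu.1 i : ℕ) := fun k => by
    rw [Finset.sum_sub_distrib]; push_cast; rfl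
  have hX0 : ∀ k, 0 ≤ ∑ i ∈ Finset.range k, x i := fun k => by
    rw [hX, sub_nonneg]; exact_mod_cast h.2.2 k
  have hXn : ∑ i ∈ Finset.range n, x i = 0 := by
    rw [hX, hl.sum_range, hm.sum_range, h.2.1, sub_self]
  -- The tangent line at μ_i lies below the graph of the exponential.
  have htan : ∀ i, q ^ mu.1 i * (L * x i) ≤ q ^ lam.1 i - q ^ mu.1 i := fun i => by
    have h1 : q ^ lam.1 i = q ^ mu.1 i * Real.exp (L * x i) := by
      have hq : ∀ k : ℕ, q ^ k = Real.exp (L * k) := fun k => by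
        rw [mul_comm, Real.exp_nat_mul, Real.exp_log hq0]
      rw [hq, hq, ← Real.exp_add]
      congr 1
      simp only [hx]
      ring
    have h2 := mul_le_mul_of_nonneg_left (Real.add_one_le_exp (L * x i))
      (pow_pos hq0 (mu.1 i)).le
    rw [h1]
    linarith
  have hpos : ∃ k < n, 0 < ∑ i ∈ Finset.range k, x i := by
    by_contra hcon
    push Not at hcon
    have hz : ∀ k, ∑ i ∈ Finset.range k, x i = 0 := fun k => by
      rcases lt_trichotomy k n with hk | rfl | hk
      · exact le_antisymm (hcon k hk) (hX0 k)
      · exact hXn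
      · rw [← hXn]
        refine (Finset.sum_subset (Finset.range_mono hk.le) fun i _ hi => ?_).symm
        have hi : n ≤ i := by simpa using hi
        simp [hx, hl i hi, hm i hi]
    refine h.1 (Subtype.ext (Finsupp.ext fun i => ?_))
    have h1 := hz (i + 1)
    rw [Finset.sum_range_succ, hz i, zero_add] at h1
    have : (lam.1 i : ℝ) = mu.1 i := sub_eq_zero.1 h1
    exact_mod_cast this.symm
  -- The boundary term of the summation by parts vanishes because |λ| = |μ|. The rest is minus the
  -- sum of the increments of c times the partial sums of λ - μ, of which one is positive.
  have habel : ∑ i ∈ Finset.range n, c i * x i < 0 := by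
    have h1 := Finset.sum_range_by_parts c x n
    simp only [smul_eq_mul] at h1
    rw [h1, hXn, mul_zero, zero_sub, neg_lt_zero]
    obtain ⟨k, hk, hk0⟩ := hpos
    rcases k with - | k
    · simp at hk0
    refine Finset.sum_pos' (fun i _ => mul_nonneg (sub_nonneg.2 (hcmono i).le) (hX0 _))
      ⟨k, Finset.mem_range.2 (by omega), mul_pos (sub_pos.2 (hcmono k)) hk0⟩
  have hlt : ∑ i ∈ Finset.range n, t⁻¹ ^ (i + 1) * (q ^ mu.1 i - 1) <
      ∑ i ∈ Finset.range n, t⁻¹ ^ (i + 1) * (q ^ lam.1 i - 1) := by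
    rw [← sub_pos, ← Finset.sum_sub_distrib]
    refine lt_of_lt_of_le (mul_pos_of_neg_of_neg hL0 habel) ?_
    rw [Finset.mul_sum]
    refine Finset.sum_le_sum fun i _ => ?_
    have := mul_le_mul_of_nonneg_left (htan i) (pow_pos (inv_pos.2 ht0) (i + 1)).le
    simp only [hc]
    linarith
  rw [eig_eq_sum_range q t hl, eig_eq_sum_range q t hm]
  intro heq
  have h1 := mul_left_cancel₀ (sub_ne_zero.2 ht1.ne) (add_left_cancel heq)
  exact hlt.ne' h1

/-- For `lam ≠ mu`, the eigenvalues are different for all but finitely many `q`. -/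
theorem finite_setOf_eig_eq {t : ℝ} (ht0 : 0 < t) (ht1 : t < 1) {lam mu : Ptn} (h : lam ≠ mu) :
    {q | eig q t lam = eig q t mu}.Finite := by
  classical
  wlog hlt : ∃ i, (∀ j < i, lam.1 j = mu.1 j) ∧ mu.1 i < lam.1 i generalizing lam mu
  · have hex : ∃ i, lam.1 i ≠ mu.1 i := by
      by_contra hcon
      push Not at hcon
      exact h (Subtype.ext (Finsupp.ext hcon))
    have hmin : ∀ j < Nat.find hex, lam.1 j = mu.1 j := fun j hj => not_not.1 (Nat.find_min hex hj)
    have hne := Nat.find_spec hex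
    refine (this h.symm ⟨Nat.find hex, fun j hj => (hmin j hj).symm, ?_⟩).subset
      fun q hq => hq.symm
    refine lt_of_le_of_ne (not_lt.1 fun h' => hlt ⟨_, hmin, h'⟩) hne
  obtain ⟨i₀, hi₀, hgt⟩ := hlt
  set n := max lam.1.degree mu.1.degree
  have hl : HasLen lam n := (hasLen_degree lam).mono (le_max_left _ _)
  have hm : HasLen mu n := (hasLen_degree mu).mono (le_max_right _ _)
  let p : Ptn → Polynomial ℝ := fun nu =>
    ∑ i ∈ Finset.range n, Polynomial.C (t⁻¹ ^ (i + 1)) * Polynomial.X ^ nu.1 i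
  -- At the first index where λ and μ differ, λ has the larger part. Look at the coefficient of q to
  -- that power: earlier terms cancel, and from there on μ has only smaller parts, so nothing
  -- negative occurs.
  have hp : p lam - p mu ≠ 0 := by
    intro h0
    have h1 := congrArg (fun r => r.coeff (lam.1 i₀)) h0
    simp only [p, Polynomial.coeff_sub, Polynomial.finsetSum_coeff, Polynomial.coeff_C_mul,
      Polynomial.coeff_X_pow, Polynomial.coeff_zero, ← Finset.sum_sub_distrib] at h1
    refine (Finset.sum_pos' (fun i _ => ?_) ⟨i₀, ?_, ?_⟩).ne' h1
    · rcases lt_or_ge i i₀ with hi | hi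
      · rw [hi₀ i hi, sub_self]
      · have : mu.1 i ≤ mu.1 i₀ := ptn_antitone mu hi
        rw [if_neg (by omega : ¬ lam.1 i₀ = mu.1 i), mul_zero, sub_zero]
        split_ifs <;> positivity
    · by_contra hcon
      have : n ≤ i₀ := by simpa using hcon
      rw [hl i₀ this] at hgt
      omega
    · rw [if_pos rfl, if_neg hgt.ne', mul_zero, mul_one, sub_zero]
      positivity
  refine ((p lam - p mu).rootSet_finite ℝ).subset fun q hq => ?_
  rw [Polynomial.mem_rootSet]
  refine ⟨hp, ?_⟩
  have hq : eig q t lam = eig q t mu := hq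
  rw [eig_eq_sum_range q t hl, eig_eq_sum_range q t hm] at hq
  have h1 := mul_left_cancel₀ (sub_ne_zero.2 ht1.ne) (add_left_cancel hq)
  simp only [mul_sub, Finset.sum_sub_distrib, sub_left_inj] at h1
  simpa [p, Polynomial.eval_finsetSum, sub_eq_zero] using h1

end MacdonaldInt

end

/-! ### Construction of the eigenvectors, and the shift by a rectangle -/

noncomputable section

namespace MacdonaldInt

open MvPolynomial

/-! ### Eigenvectors -/

/-- The finite number of partitions below λ strictly decreases along the order. -/
theorem domLT_wf : WellFounded DomLT := by
  refine Subrelation.wf (r := InvImage (· < ·) fun lam => {mu | DomLT mu lam}.ncard) ?_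
    (InvImage.wf _ wellFounded_lt)
  intro mu lam h
  refine Set.ncard_lt_ncard ⟨fun nu hnu => domLT_trans hnu h, fun hsub => ?_⟩
    (finite_setOf_domLT lam)
  exact (hsub h : DomLT mu mu).1 rfl

/-- The span of the `m_mu`, `mu < lam`. -/
def lowSpan (lam : Ptn) : Submodule ℝ PowSum := Submodule.span ℝ (mono '' {mu | DomLT mu lam})

theorem mono_mem_lowSpan {lam mu : Ptn} (h : DomLT mu lam) : mono mu ∈ lowSpan lam :=
  Submodule.subset_span ⟨mu, h, rfl⟩

theorem lowSpan_mono {lam mu : Ptn} (h : DomLT mu lam) : lowSpan mu ≤ lowSpan lam :=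
  Submodule.span_mono (Set.image_mono fun _ hnu => domLT_trans hnu h)

theorem monoCoeff_eq_zero_of_mem_lowSpan {lam mu : Ptn} (h : ¬ DomLT mu lam) {u : PowSum}
    (hu : u ∈ lowSpan lam) : monoCoeff mu u = 0 := by
  classical
  induction hu using Submodule.span_induction with
  | mem v hv =>
    obtain ⟨nu, hnu, rfl⟩ := hv
    rw [monoCoeff_mono, if_neg]
    rintro rfl
    exact h hnu
  | zero => exact map_zero _
  | add v w _ _ hv hw => rw [map_add, hv, hw, add_zero]
  | smul c v _ hv => rw [map_smul, hv, smul_zero]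

theorem macOp_mono_sub_mem (q : ℝ) {t : ℝ} (ht : t ≠ 0) (lam : Ptn) :
    macOp q t (mono lam) - eig q t lam • mono lam ∈ lowSpan lam := by
  classical
  refine mem_span_mono fun mu hmu => ?_
  rw [map_sub, map_smul, monoCoeff_mono] at hmu
  by_cases h : mu = lam
  · subst h
    rw [monoCoeff_macOp_self q ht, if_pos rfl, smul_eq_mul, mul_one, sub_self] at hmu
    exact absurd rfl hmu
  · rw [if_neg h, smul_zero, sub_zero] at hmu
    exact (domLT_or_eq_of_monoCoeff_macOp_ne_zero q ht hmu).resolve_left h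

theorem macOp_mem_lowSpan (q : ℝ) {t : ℝ} (ht : t ≠ 0) {lam : Ptn} {u : PowSum}
    (hu : u ∈ lowSpan lam) : macOp q t u ∈ lowSpan lam := by
  induction hu using Submodule.span_induction with
  | mem v hv =>
    obtain ⟨nu, hnu, rfl⟩ := hv
    rw [← sub_add_cancel (macOp q t (mono nu)) (eig q t nu • mono nu)]
    exact Submodule.add_mem _ (lowSpan_mono hnu (macOp_mono_sub_mem q ht nu))
      (Submodule.smul_mem _ _ (mono_mem_lowSpan hnu))
  | zero => rw [map_zero]; exact Submodule.zero_mem _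
  | add v w _ _ hv hw => rw [map_add]; exact Submodule.add_mem _ hv hw
  | smul c v _ hv => rw [map_smul]; exact Submodule.smul_mem _ _ hv

/-- A polynomial in the operator. -/
def opPoly (q t : ℝ) (p : Polynomial ℝ) : PowSum →ₗ[ℝ] PowSum :=
  Polynomial.aeval (A := Module.End ℝ PowSum) (macOp q t) p

theorem opPoly_mul (q t : ℝ) (p p' : Polynomial ℝ) (u : PowSum) :
    opPoly q t (p * p') u = opPoly q t p (opPoly q t p' u) := by
  simp only [opPoly, map_mul]
  rfl

theorem opPoly_X_sub_C (q t c : ℝ) (u : PowSum) :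
    opPoly q t (Polynomial.X - Polynomial.C c) u = macOp q t u - c • u := by
  simp only [opPoly, map_sub, Polynomial.aeval_X, Polynomial.aeval_C, LinearMap.sub_apply,
    Module.algebraMap_end_apply]

theorem opPoly_one (q t : ℝ) (u : PowSum) : opPoly q t 1 u = u := by
  simp [opPoly]

theorem opPoly_mem {q t : ℝ} {W : Submodule ℝ PowSum} (hW : ∀ u ∈ W, macOp q t u ∈ W)
    (p : Polynomial ℝ) {u : PowSum} (hu : u ∈ W) : opPoly q t p u ∈ W := by
  induction p using Polynomial.induction_on generalizing u with
  | C a =>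
    simp only [opPoly, Polynomial.aeval_C, Module.algebraMap_end_apply]
    exact W.smul_mem _ hu
  | add p p' hp hp' =>
    simp only [opPoly, map_add, LinearMap.add_apply]
    exact W.add_mem (hp hu) (hp' hu)
  | monomial n a h =>
    rw [pow_succ, ← mul_assoc, opPoly_mul]
    refine h ?_
    simp only [opPoly, Polynomial.aeval_X]
    exact hW u hu

/-- On the quotient by the invariant subspace W the vector u is an eigenvector with eigenvalue e, so
p(E) acts on it as p(e). -/
theorem opPoly_sub_mem {q t : ℝ} {W : Submodule ℝ PowSum} (hW : ∀ u ∈ W, macOp q t u ∈ W)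
    (p : Polynomial ℝ) {u : PowSum} {e : ℝ} (hu : macOp q t u - e • u ∈ W) :
    opPoly q t p u - p.eval e • u ∈ W := by
  obtain ⟨p', hp'⟩ := Polynomial.X_sub_C_dvd_sub_C_eval (p := p) (a := e)
  have h1 : opPoly q t p u - p.eval e • u = opPoly q t (p - Polynomial.C (p.eval e)) u := by
    simp only [opPoly, map_sub, Polynomial.aeval_C, LinearMap.sub_apply,
      Module.algebraMap_end_apply]
  rw [h1, hp', mul_comm, opPoly_mul, opPoly_X_sub_C]
  exact opPoly_mem hW _ hu

/-- Cayley–Hamilton for a triangular operator: the factor belonging to λ sends m_λ into the span of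
lower m_μ, which the remaining factors annihilate by induction. -/
theorem opPoly_prod_mono {q t : ℝ} (ht : t ≠ 0) (lam : Ptn) (s : Finset Ptn) (hs : lam ∈ s)
    (hs' : ∀ mu, DomLT mu lam → mu ∈ s) :
    opPoly q t (∏ mu ∈ s, (Polynomial.X - Polynomial.C (eig q t mu))) (mono lam) = 0 := by
  classical
  induction lam using domLT_wf.induction generalizing s with
  | _ lam ih =>
  rw [← Finset.mul_prod_erase _ _ hs, mul_comm, opPoly_mul, opPoly_X_sub_C]
  have key : lowSpan lam ≤ LinearMap.ker
      (opPoly q t (∏ mu ∈ s.erase lam, (Polynomial.X - Polynomial.C (eig q t mu)))) := by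
    refine Submodule.span_le.2 ?_
    rintro _ ⟨nu, hnu, rfl⟩
    exact ih nu hnu _ (Finset.mem_erase.2 ⟨hnu.1, hs' nu hnu⟩) fun mu hmu =>
      Finset.mem_erase.2 ⟨(domLT_trans hmu hnu).1, hs' mu (domLT_trans hmu hnu)⟩
  exact key (macOp_mono_sub_mem q ht lam)

/-- The polynomial with the roots `e_mu`, `mu < lam`. -/
def lowPoly (q t : ℝ) (lam : Ptn) : Polynomial ℝ :=
  ∏ mu ∈ (finite_setOf_domLT lam).toFinset, (Polynomial.X - Polynomial.C (eig q t mu))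

theorem opPoly_lowPoly {q t : ℝ} (ht : t ≠ 0) {lam : Ptn} {u : PowSum} (hu : u ∈ lowSpan lam) :
    opPoly q t (lowPoly q t lam) u = 0 := by
  have key : lowSpan lam ≤ LinearMap.ker (opPoly q t (lowPoly q t lam)) := by
    refine Submodule.span_le.2 ?_
    rintro _ ⟨nu, hnu, rfl⟩
    refine opPoly_prod_mono ht nu _ ?_ fun mu hmu => ?_ <;> rw [Set.Finite.mem_toFinset]
    · exact hnu
    · exact domLT_trans hmu hnu
  exact key hu

theorem lowPoly_eval_ne_zero {q t : ℝ} (hq0 : 0 < q) (hq1 : q < 1) (ht0 : 0 < t) (ht1 : t < 1)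
    (lam : Ptn) : (lowPoly q t lam).eval (eig q t lam) ≠ 0 := by
  rw [lowPoly, Polynomial.eval_prod]
  refine Finset.prod_ne_zero_iff.2 fun mu hmu => ?_
  rw [Set.Finite.mem_toFinset] at hmu
  simpa using sub_ne_zero.2 (eig_ne_of_domLT hq0 hq1 ht0 ht1 hmu)

/-- The eigenvector of `macOp` of the form `m_lam + ∑_{mu < lam} c_mu m_mu`. -/
def eigP (q t : ℝ) (lam : Ptn) : PowSum :=
  ((lowPoly q t lam).eval (eig q t lam))⁻¹ • opPoly q t (lowPoly q t lam) (mono lam)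

/-- Modulo lower terms, applying `lowPoly` to E multiplies m_λ by a number, which is nonzero because
e_λ differs from every lower eigenvalue. The normalization in `eigP` divides by it. -/
theorem eigP_sub_mono_mem {q t : ℝ} (hq0 : 0 < q) (hq1 : q < 1) (ht0 : 0 < t) (ht1 : t < 1)
    (lam : Ptn) : eigP q t lam - mono lam ∈ lowSpan lam := by
  have h0 := lowPoly_eval_ne_zero hq0 hq1 ht0 ht1 lam
  have h := opPoly_sub_mem (fun u hu => macOp_mem_lowSpan q ht0.ne' hu) (lowPoly q t lam)
    (macOp_mono_sub_mem q ht0.ne' lam)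
  have := Submodule.smul_mem _ ((lowPoly q t lam).eval (eig q t lam))⁻¹ h
  rwa [smul_sub, smul_smul, inv_mul_cancel₀ h0, one_smul] at this

theorem macOp_eigP {q t : ℝ} (ht0 : 0 < t)
    (lam : Ptn) : macOp q t (eigP q t lam) = eig q t lam • eigP q t lam := by
  classical
  have h1 : opPoly q t ((Polynomial.X - Polynomial.C (eig q t lam)) * lowPoly q t lam)
      (mono lam) = 0 := by
    have hnot : lam ∉ (finite_setOf_domLT lam).toFinset := fun h => by
      rw [Set.Finite.mem_toFinset] at h
      exact (show DomLT lam lam from h).1 rfl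
    rw [lowPoly, ← Finset.prod_insert (f := fun mu => Polynomial.X - Polynomial.C (eig q t mu))
      hnot]
    refine opPoly_prod_mono ht0.ne' lam _ (Finset.mem_insert_self _ _) fun mu hmu =>
      Finset.mem_insert_of_mem ?_
    rw [Set.Finite.mem_toFinset]
    exact hmu
  rw [opPoly_mul, opPoly_X_sub_C, sub_eq_zero] at h1
  rw [eigP, map_smul, h1, smul_comm]

/-- Uniqueness of the eigenvector when the eigenvalue equation is only known in n variables. The
difference d of two candidates lies in the lower span, so `lowPoly` of E kills it. In n variables d
is an eigenvector for e_λ, so the same operator multiplies it by a nonzero number. Hence d vanishes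
in n variables. -/
theorem toVars_eq_of_macOp_sub {q t : ℝ} (hq0 : 0 < q) (hq1 : q < 1) (ht0 : 0 < t) (ht1 : t < 1)
    {n : ℕ} {lam : Ptn} {u : PowSum} (hu : u - mono lam ∈ lowSpan lam)
    (h : toVars n (macOp q t u - eig q t lam • u) = 0) : toVars n u = toVars n (eigP q t lam) := by
  set W : Submodule ℝ PowSum := LinearMap.ker (toVars n).toLinearMap
  -- The operator descends to n variables: by `discr_mul_macOp` the image of E v depends only on the
  -- image of v.
  have hW : ∀ v ∈ W, macOp q t v ∈ W := by
    intro v hv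
    have hv : toVars n v = 0 := hv
    have h1 := discr_mul_macOp q ht0.ne' n v
    rw [hv] at h1
    simp only [map_zero, mul_zero, Finset.sum_const_zero, add_zero] at h1
    have h2 := (mul_eq_zero.1 h1).resolve_left
      (C_ne_zero.2 (pow_ne_zero _ ht0.ne'))
    exact (mul_eq_zero.1 h2).resolve_left (discr_ne_zero n)
  set d := u - eigP q t lam with hd
  have hdl : d ∈ lowSpan lam := by
    have := Submodule.sub_mem _ hu (eigP_sub_mono_mem hq0 hq1 ht0 ht1 lam)
    rwa [sub_sub_sub_cancel_right] at this
  have hdW : macOp q t d - eig q t lam • d ∈ W := by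
    have : macOp q t d - eig q t lam • d = macOp q t u - eig q t lam • u := by
      rw [hd, map_sub, smul_sub, macOp_eigP ht0]
      abel
    rw [this]
    exact h
  have h2 := opPoly_sub_mem hW (lowPoly q t lam) hdW
  rw [opPoly_lowPoly ht0.ne' hdl, zero_sub, Submodule.neg_mem_iff] at h2
  have h3 := (Submodule.smul_mem_iff _ (lowPoly_eval_ne_zero hq0 hq1 ht0 ht1 lam)).1 h2
  have h4 : toVars n d = 0 := h3
  rwa [hd, map_sub, sub_eq_zero] at h4

theorem monoCoeff_eigP_self {q t : ℝ} (hq0 : 0 < q) (hq1 : q < 1) (ht0 : 0 < t) (ht1 : t < 1)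
    (lam : Ptn) : monoCoeff lam (eigP q t lam) = 1 := by
  classical
  have h := monoCoeff_eq_zero_of_mem_lowSpan (mu := lam) (fun h => h.1 rfl)
    (eigP_sub_mono_mem hq0 hq1 ht0 ht1 lam)
  rwa [map_sub, monoCoeff_mono, if_pos rfl, sub_eq_zero] at h

theorem eigP_ne_zero {q t : ℝ} (hq0 : 0 < q) (hq1 : q < 1) (ht0 : 0 < t) (ht1 : t < 1)
    (lam : Ptn) : eigP q t lam ≠ 0 := fun h => by
  have := monoCoeff_eigP_self hq0 hq1 ht0 ht1 lam
  rw [h, map_zero] at this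
  exact zero_ne_one this

theorem toVars_eigP_ne_zero {q t : ℝ} (hq0 : 0 < q) (hq1 : q < 1) (ht0 : 0 < t) (ht1 : t < 1)
    {lam : Ptn} {n : ℕ} (hl : HasLen lam n) :
    toVars n (eigP q t lam) ≠ 0 := fun h => by
  have := monoCoeff_eigP_self hq0 hq1 ht0 ht1 lam
  rw [← coeff_toVars_res hl, h, coeff_zero] at this
  exact zero_ne_one this

theorem isHomogeneous_eigP {q t : ℝ} (ht0 : 0 < t)
    (lam : Ptn) (n : ℕ) :
    (toVars n (eigP q t lam)).IsHomogeneous lam.1.degree := by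
  let W : Submodule ℝ PowSum :=
    (homogeneousSubmodule (Fin n) ℝ lam.1.degree).comap (toVars n).toLinearMap
  have h : opPoly q t (lowPoly q t lam) (mono lam) ∈ W :=
    opPoly_mem (W := W) (fun u hu => isHomogeneous_macOp q ht0.ne' hu) _ (by
      change (toVars n (mono lam)).IsHomogeneous lam.1.degree
      rw [toVars_mono]
      exact isHomogeneous_monomialSym lam n)
  exact W.smul_mem _ h

theorem mono_mem_span_eigP {q t : ℝ} (hq0 : 0 < q) (hq1 : q < 1) (ht0 : 0 < t) (ht1 : t < 1)
    (lam : Ptn) :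
    mono lam ∈ Submodule.span ℝ (Set.range (eigP q t)) := by
  induction lam using domLT_wf.induction with
  | _ lam ih =>
  have h1 : lowSpan lam ≤ Submodule.span ℝ (Set.range (eigP q t)) := by
    refine Submodule.span_le.2 ?_
    rintro _ ⟨nu, hnu, rfl⟩
    exact ih nu hnu
  rw [← sub_sub_cancel (eigP q t lam) (mono lam)]
  exact Submodule.sub_mem _ (Submodule.subset_span ⟨lam, rfl⟩)
    (h1 (eigP_sub_mono_mem hq0 hq1 ht0 ht1 lam))

theorem span_eigP {q t : ℝ} (hq0 : 0 < q) (hq1 : q < 1) (ht0 : 0 < t) (ht1 : t < 1)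
    : Submodule.span ℝ (Set.range (eigP q t)) = ⊤ := by
  refine eq_top_iff.2 fun u _ => ?_
  have h : u ∈ Submodule.span ℝ (mono '' Set.univ) := mem_span_mono fun _ _ => Set.mem_univ _
  refine Submodule.span_le.2 ?_ h
  rintro _ ⟨nu, -, rfl⟩
  exact mono_mem_span_eigP hq0 hq1 ht0 ht1 nu

/-! ### Multiplication by the product of the variables -/

theorem toVars_mono_eq_zero {lam : Ptn} {n : ℕ} (hl : ¬ HasLen lam n) : toVars n (mono lam) = 0 := by
  rw [toVars_mono]
  exact if_neg hl

theorem rect_apply (s r i : ℕ) : (rect s r).1 i = if i < r then s else 0 := rfl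

theorem ptn_add_apply (lam mu : Ptn) (i : ℕ) : (lam + mu).1 i = lam.1 i + mu.1 i := rfl

theorem hasLen_add_rect {lam : Ptn} {n : ℕ} (hl : HasLen lam n) (s : ℕ) :
    HasLen (lam + rect s n) n := fun i hi => by
  rw [ptn_add_apply, rect_apply, if_neg (not_lt.2 hi), hl i hi]

theorem toVars_mono_add_rect {lam : Ptn} {n : ℕ} (hl : HasLen lam n) (s : ℕ) :
    toVars n (mono (lam + rect s n)) = (∏ i, X i ^ s) * toVars n (mono lam) := by
  classical
  rw [toVars_mono, toVars_mono, monomialSym, monomialSym]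
  have hl' : ∀ i, n ≤ i → lam.1 i = 0 := hl
  rw [if_pos (show ∀ i, n ≤ i → (lam + rect s n).1 i = 0 from hasLen_add_rect hl s), if_pos hl',
    Finset.mul_sum]
  have h1 : ∀ (σ : Equiv.Perm (Fin n)) (i : Fin n), (lam + rect s n).1 (σ i) = lam.1 (σ i) + s :=
    fun σ i => by rw [ptn_add_apply, rect_apply, if_pos (σ i).2]
  have h2 : Finset.univ.image (fun (σ : Equiv.Perm (Fin n)) (i : Fin n) =>
      (lam + rect s n).1 (σ i : ℕ)) =
      (Finset.univ.image (fun (σ : Equiv.Perm (Fin n)) (i : Fin n) => lam.1 (σ i : ℕ))).image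
        fun α i => α i + s := by
    rw [Finset.image_image]
    congr 1
    funext σ i
    exact h1 σ i
  rw [h2, Finset.sum_image]
  · refine Finset.sum_congr rfl fun α _ => ?_
    rw [← Finset.prod_mul_distrib]
    exact Finset.prod_congr rfl fun i _ => by rw [pow_add, mul_comm]
  · intro α _ β _ h
    funext i
    exact Nat.add_right_cancel (congrFun h i)

theorem domLT_add_rect {lam mu : Ptn} {n : ℕ} (h : DomLT mu lam) (s : ℕ) :
    DomLT (mu + rect s n) (lam + rect s n) := by
  refine ⟨fun he => h.1 (Subtype.ext (Finsupp.ext fun i => ?_)), ?_, fun k => ?_⟩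
  · have := congrArg (fun nu : Ptn => nu.1 i) he
    simp only [ptn_add_apply] at this
    omega
  · change (mu.1 + (rect s n).1).degree = (lam.1 + (rect s n).1).degree
    rw [map_add, map_add, h.2.1]
  · simp only [ptn_add_apply, Finset.sum_add_distrib]
    exact Nat.add_le_add_right (h.2.2 k) _

/-- Multiplication by ∏ x_i^s exists only in n variables, so the product has to be lifted. Those m_ν
with more than n parts vanish there and are lifted to 0. -/
theorem exists_mem_lowSpan_add_rect {lam : Ptn} {n : ℕ} (s : ℕ) {d : PowSum}
    (hd : d ∈ lowSpan lam) : ∃ d' ∈ lowSpan (lam + rect s n),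
      toVars n d' = (∏ i, X i ^ s) * toVars n d := by
  induction hd using Submodule.span_induction with
  | mem v hv =>
    obtain ⟨nu, hnu, rfl⟩ := hv
    by_cases hl : HasLen nu n
    · exact ⟨_, mono_mem_lowSpan (domLT_add_rect hnu s), toVars_mono_add_rect hl s⟩
    · exact ⟨0, Submodule.zero_mem _, by rw [toVars_mono_eq_zero hl, map_zero, mul_zero]⟩
  | zero => exact ⟨0, Submodule.zero_mem _, by simp⟩
  | add v w _ _ hv hw =>
    obtain ⟨a, ha, ha'⟩ := hv
    obtain ⟨b, hb, hb'⟩ := hw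
    exact ⟨a + b, Submodule.add_mem _ ha hb, by rw [map_add, map_add, ha', hb', mul_add]⟩
  | smul c v _ hv =>
    obtain ⟨a, ha, ha'⟩ := hv
    exact ⟨c • a, Submodule.smul_mem _ _ ha, by rw [map_smul, map_smul, ha', mul_smul_comm]⟩

theorem scaleVar_prod_X_pow {n : ℕ} (i : Fin n) (c : ℝ) (s : ℕ) :
    scaleVar i c (∏ j, X j ^ s) = C (c ^ s) * ∏ j, X j ^ s := by
  classical
  simp only [scaleVar, map_prod, map_pow, aeval_X, mul_pow, Finset.prod_mul_distrib]
  rw [Finset.prod_eq_single i (fun j _ hj => by rw [if_neg hj, C_1, one_pow]) (by simp), if_pos rfl,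
    Finset.prod_pow]

/-- The monomial ∏ x_i^s is multiplied by q^s under each shift x_i ↦ q x_i. So the product is again
an eigenvector in n variables, with the triangular form belonging to λ + (s^n), and uniqueness
identifies it. -/
theorem toVars_eigP_add_rect {q t : ℝ} (hq0 : 0 < q) (hq1 : q < 1) (ht0 : 0 < t) (ht1 : t < 1)
    {lam : Ptn} {n : ℕ} (hl : HasLen lam n) (s : ℕ) :
    toVars n (eigP q t (lam + rect s n)) = (∏ i, X i ^ s) * toVars n (eigP q t lam) := by
  obtain ⟨d, hd, hd'⟩ := exists_mem_lowSpan_add_rect (n := n) s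
    (eigP_sub_mono_mem hq0 hq1 ht0 ht1 lam)
  set κ := lam + rect s n with hκ
  set M : MvPolynomial (Fin n) ℝ := ∏ i, X i ^ s with hM
  set u := mono κ + d with hu
  have huv : toVars n u = M * toVars n (eigP q t lam) := by
    rw [hu, map_add, hd', toVars_mono_add_rect hl, ← mul_add, map_sub]
    congr 1
    abel
  rw [← huv]
  refine (toVars_eq_of_macOp_sub hq0 hq1 ht0 ht1 (by rwa [hu, add_sub_cancel_left]) ?_).symm
  set g := toVars n (eigP q t lam)
  have h1 := discr_mul_macOp q ht0.ne' n u
  have h2 := discr_mul_macOp q ht0.ne' n (eigP q t lam)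
  rw [macOp_eigP ht0, map_smul, smul_eq_C_mul] at h2
  have h3 : ∑ i, discrShift n t i * scaleVar i q (toVars n u) =
      C (q ^ s) * M * ∑ i, discrShift n t i * scaleVar i q g := by
    rw [Finset.mul_sum]
    refine Finset.sum_congr rfl fun i _ => ?_
    rw [huv, map_mul, hM, scaleVar_prod_X_pow]
    ring
  rw [h3, huv] at h1
  -- Adding s to each of the first n parts multiplies the sum over i in the n-variable eigenvalue by
  -- q^s.
  have h4 : t ^ n * eig q t κ = 1 + q ^ s * (t ^ n * eig q t lam - 1) := by
    rw [pow_mul_eig q ht0.ne' (hasLen_add_rect hl s), pow_mul_eig q ht0.ne' hl,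
      add_sub_cancel_left, mul_left_comm (q ^ s), Finset.mul_sum Finset.univ _ (q ^ s)]
    refine congrArg (fun z => 1 + (t - 1) * z) (Finset.sum_congr rfl fun i _ => ?_)
    rw [ptn_add_apply, rect_apply, if_pos i.2, pow_add]
    ring
  have h5 : (C (t ^ n) * C (eig q t κ) : MvPolynomial (Fin n) ℝ) =
      1 + C (q ^ s) * (C (t ^ n) * C (eig q t lam) - 1) := by
    rw [← C_mul, h4, C_add, C_mul, C_sub, C_mul, C_1]
  have h6 : C (t ^ n) * (discr n * toVars n (macOp q t u - eig q t κ • u)) = 0 := by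
    rw [map_sub, map_smul, smul_eq_C_mul, huv, mul_sub, mul_sub, h1]
    linear_combination (-C (q ^ s) * M) * h2 - discr n * M * g * h5
  exact (mul_eq_zero.1 ((mul_eq_zero.1 h6).resolve_left
    (C_ne_zero.2 (pow_ne_zero _ ht0.ne')))).resolve_left (discr_ne_zero n)

end MacdonaldInt

end

/-! ### Orthogonality by continuity in q; existence and uniqueness of the Macdonald family -/

noncomputable section

namespace MacdonaldInt

open MvPolynomial

/-! ### Dependence on `q` -/

/-- Finite sums of `φ(q) • a` with `φ` continuous on `(0,1)`. -/
def Curves : Submodule ℝ (ℝ → PowSum) :=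
  Submodule.span ℝ {u | ∃ (φ : ℝ → ℝ) (a : PowSum), ContinuousOn φ (Set.Ioo 0 1) ∧
    u = fun q => φ q • a}

theorem smul_const_mem_curves {φ : ℝ → ℝ} (hφ : ContinuousOn φ (Set.Ioo 0 1)) (a : PowSum) :
    (fun q => φ q • a) ∈ Curves :=
  Submodule.subset_span ⟨φ, a, hφ, rfl⟩

theorem const_mem_curves (a : PowSum) : (fun _ => a) ∈ Curves := by
  simpa using smul_const_mem_curves (φ := fun _ => 1) continuousOn_const a

theorem add_mem_curves {u v : ℝ → PowSum} (hu : u ∈ Curves) (hv : v ∈ Curves) :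
    (fun q => u q + v q) ∈ Curves := Submodule.add_mem _ hu hv

@[elab_as_elim]
theorem curves_induction {p : (u : ℝ → PowSum) → u ∈ Curves → Prop}
    (smul : ∀ (φ : ℝ → ℝ) (a : PowSum) (hφ : ContinuousOn φ (Set.Ioo 0 1)),
      p (fun q => φ q • a) (smul_const_mem_curves hφ a))
    (add : ∀ (u v : ℝ → PowSum) (hu : u ∈ Curves) (hv : v ∈ Curves), p u hu → p v hv →
      p (fun q => u q + v q) (add_mem_curves hu hv)) {u : ℝ → PowSum}
    (hu : u ∈ Curves) : p u hu := by
  refine Submodule.closure_induction (p := p) ?_ (fun u v hu hv => add u v hu hv) ?_ hu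
  · have h : (0 : ℝ → PowSum) = fun _ => (0 : ℝ) • (0 : PowSum) := by
      funext q; simp
    simp only [h]
    exact smul (fun _ => 0) 0 continuousOn_const
  · rintro c _ ⟨φ, a, hφ, rfl⟩
    have h : (c • fun q => φ q • a : ℝ → PowSum) = fun q => (c * φ q) • a := by
      funext q; simp [mul_smul]
    simp only [h]
    exact smul (fun q => c * φ q) a (continuousOn_const.mul hφ)

theorem smul_mem_curves {φ : ℝ → ℝ} (hφ : ContinuousOn φ (Set.Ioo 0 1)) {u : ℝ → PowSum}
    (hu : u ∈ Curves) : (fun q => φ q • u q) ∈ Curves := by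
  induction hu using curves_induction with
  | smul ψ a hψ =>
    simp only [smul_smul]
    exact smul_const_mem_curves (hφ.mul hψ) a
  | add v w _ _ hv hw =>
    simp only [smul_add]
    exact add_mem_curves hv hw

theorem map_mem_curves (f : PowSum →ₗ[ℝ] PowSum) {u : ℝ → PowSum}
    (hu : u ∈ Curves) : (fun q => f (u q)) ∈ Curves := by
  induction hu using curves_induction with
  | smul ψ a hψ =>
    simp only [map_smul]
    exact smul_const_mem_curves hψ (f a)
  | add v w _ _ hv hw =>
    simp only [map_add]
    exact add_mem_curves hv hw

theorem mul_mem_curves (a : PowSum) {u : ℝ → PowSum} (hu : u ∈ Curves) :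
    (fun q => a * u q) ∈ Curves :=
  map_mem_curves (LinearMap.mulLeft ℝ a) hu

/-- The bound on the degree in z is uniform in q, so `macOp` applied to a fixed u is a sum over a
range of k that does not depend on q. -/
theorem shiftCoeff_mem_curves (u : PowSum) :
    (∀ k, (fun q => shiftCoeff q k u) ∈ Curves) ∧ ∃ K, ∀ q, (shift q u).natDegree < K := by
  induction u using MvPolynomial.induction_on with
  | C a =>
    refine ⟨fun k => ?_, 1, fun q => ?_⟩
    · simp only [shiftCoeff_apply, shift_C, Polynomial.coeff_C]
      exact const_mem_curves _
    · simp
  | add u v hu hv =>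
    obtain ⟨hu, K, hK⟩ := hu
    obtain ⟨hv, K', hK'⟩ := hv
    refine ⟨fun k => ?_, max K K', fun q => ?_⟩
    · simp only [map_add]
      exact Submodule.add_mem _ (hu k) (hv k)
    · rw [map_add]
      exact (Polynomial.natDegree_add_le _ _).trans_lt
        (max_lt_max (hK q) (hK' q))
  | mul_X u r hu =>
    obtain ⟨hu, K, hK⟩ := hu
    refine ⟨fun k => ?_, K + r, fun q => ?_⟩
    · have h1 : ∀ q, shiftCoeff q k (u * X r) = X r * shiftCoeff q k u +
          (q ^ (r : ℕ) - 1) • if (r : ℕ) ≤ k then shiftCoeff q (k - r) u else 0 := by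
        intro q
        simp only [shiftCoeff_apply]
        rw [map_mul, shift_X, mul_add, Polynomial.coeff_add, Polynomial.coeff_mul_C, mul_comm]
        congr 1
        rw [← mul_assoc, Polynomial.coeff_mul_X_pow', Polynomial.coeff_mul_C]
        split_ifs with h
        · rw [smul_eq_C_mul, mul_comm]
        · rw [smul_zero]
      simp only [h1]
      refine Submodule.add_mem _ (mul_mem_curves _ (hu k)) (smul_mem_curves (by fun_prop) ?_)
      split_ifs with h
      · exact hu _
      · exact const_mem_curves 0
    · rw [map_mul, shift_X]
      refine Polynomial.natDegree_mul_le.trans_lt (add_lt_add_of_lt_of_le (hK q) ?_)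
      refine (Polynomial.natDegree_add_le _ _).trans (max_le (by simp) ?_)
      exact Polynomial.natDegree_C_mul_X_pow_le _ _

theorem macOp_mem_curves (t : ℝ) {u : ℝ → PowSum} (hu : u ∈ Curves) :
    (fun q => macOp q t (u q)) ∈ Curves := by
  induction hu using curves_induction with
  | smul ψ a hψ =>
    simp only [map_smul]
    refine smul_mem_curves hψ ?_
    obtain ⟨h, K, hK⟩ := shiftCoeff_mem_curves a
    have h1 : (fun q => macOp q t a) =
        ∑ k ∈ Finset.range K, fun q => gen t k * shiftCoeff q k a := by
      funext q
      rw [macOp_eq_sum q t a (hK q), Finset.sum_apply]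
    rw [h1]
    exact Submodule.sum_mem _ fun k _ => mul_mem_curves _ (h k)
  | add v w _ _ hv hw =>
    simp only [map_add]
    exact add_mem_curves hv hw

theorem continuous_eig (t : ℝ) (lam : Ptn) : Continuous fun q => eig q t lam := by
  simp only [eig, Finsupp.sum]
  fun_prop

theorem opPoly_prod_mem_curves (t : ℝ) (s : Finset Ptn) {u : ℝ → PowSum} (hu : u ∈ Curves) :
    (fun q => opPoly q t (∏ mu ∈ s, (Polynomial.X - Polynomial.C (eig q t mu))) (u q)) ∈ Curves := by
  classical
  induction s using Finset.induction_on with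
  | empty => simpa only [Finset.prod_empty, opPoly_one] using hu
  | insert mu s hmu ih =>
    simp only [Finset.prod_insert hmu, opPoly_mul, opPoly_X_sub_C]
    exact Submodule.sub_mem _ (macOp_mem_curves t ih)
      (smul_mem_curves (continuous_eig t mu).continuousOn ih)

/-- Only eigenvalues of comparable partitions enter the denominator of `eigP`, and these differ for
every q in (0,1). So there is no singular q. -/
theorem eigP_mem_curves {t : ℝ} (ht0 : 0 < t) (ht1 : t < 1) (lam : Ptn) :
    (fun q => eigP q t lam) ∈ Curves := by
  refine smul_mem_curves ?_ (opPoly_prod_mem_curves t _ (const_mem_curves (mono lam)))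
  refine ContinuousOn.inv₀ ?_ fun q hq => lowPoly_eval_ne_zero hq.1 hq.2 ht0 ht1 lam
  simp only [lowPoly, Polynomial.eval_prod, Polynomial.eval_sub, Polynomial.eval_X,
    Polynomial.eval_C]
  exact (continuous_finsetProd _ fun mu _ =>
    (continuous_eig t lam).sub (continuous_eig t mu)).continuousOn

theorem continuousOn_form {F : Type*} [NormedAddCommGroup F] [NormedSpace ℝ F]
    {B : ℝ → PowSum →ₗ[ℝ] PowSum →ₗ[ℝ] F}
    (hB : ∀ a b, ContinuousOn (fun q => B q a b) (Set.Ioo 0 1)) {u v : ℝ → PowSum}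
    (hu : u ∈ Curves) (hv : v ∈ Curves) :
    ContinuousOn (fun q => B q (u q) (v q)) (Set.Ioo 0 1) := by
  have h1 : ∀ a, ContinuousOn (fun q => B q a (v q)) (Set.Ioo 0 1) := by
    intro a
    induction hv using curves_induction with
    | smul ψ b hψ =>
      simp only [map_smul]
      exact hψ.smul (hB a b)
    | add v w _ _ hv hw =>
      simp only [map_add]
      exact hv.add hw
  induction hu using curves_induction with
  | smul ψ b hψ =>
    simp only [map_smul, LinearMap.smul_apply]
    exact hψ.smul (h1 b)
  | add v w _ _ hv hw =>
    simp only [map_add, LinearMap.add_apply]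
    exact hv.add hw

/-- A form for which `macOp` is self-adjoint makes the eigenvectors orthogonal, also when eigenvalues
coincide for the given `q`, provided that it depends continuously on `q`. -/
theorem form_eigP_eq_zero {F : Type*} [NormedAddCommGroup F] [NormedSpace ℝ F]
    {B : ℝ → PowSum →ₗ[ℝ] PowSum →ₗ[ℝ] F} {t : ℝ} (ht0 : 0 < t) (ht1 : t < 1)
    (hB : ∀ a b, ContinuousOn (fun q => B q a b) (Set.Ioo 0 1))
    (hadj : ∀ q ∈ Set.Ioo (0 : ℝ) 1, ∀ a b, B q (macOp q t a) b = B q a (macOp q t b))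
    {lam mu : Ptn} (h : lam ≠ mu) {q : ℝ} (hq : q ∈ Set.Ioo (0 : ℝ) 1) :
    B q (eigP q t lam) (eigP q t mu) = 0 := by
  have hfin := finite_setOf_eig_eq ht0 ht1 h
  have hc := continuousOn_form hB (eigP_mem_curves ht0 ht1 lam) (eigP_mem_curves ht0 ht1 mu)
  have hcq : Filter.Tendsto (fun q => B q (eigP q t lam) (eigP q t mu)) (nhdsWithin q {q}ᶜ)
      (nhds (B q (eigP q t lam) (eigP q t mu))) :=
    (hc.continuousAt (isOpen_Ioo.mem_nhds hq)).tendsto.mono_left nhdsWithin_le_nhds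
  refine tendsto_nhds_unique (hcq.congr' ?_) tendsto_const_nhds |>.symm ▸ rfl
  have h1 : ∀ᶠ p in nhdsWithin q {q}ᶜ, p ∈ Set.Ioo (0 : ℝ) 1 :=
    nhdsWithin_le_nhds (isOpen_Ioo.mem_nhds hq)
  -- The eigenvalues may coincide at q itself. The other coincidences form a finite, hence closed,
  -- set not containing q.
  have h2 : ∀ᶠ p in nhdsWithin q {q}ᶜ, eig p t lam ≠ eig p t mu := by
    have h3 : ({p | eig p t lam = eig p t mu} \ {q}).Finite := hfin.subset Set.sdiff_subset
    filter_upwards [nhdsWithin_le_nhds (h3.isClosed.isOpen_compl.mem_nhds (by simp)),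
      self_mem_nhdsWithin] with p hp hpq hpe
    exact hp ⟨hpe, hpq⟩
  filter_upwards [h1, h2] with p hp hpe
  have h4 := hadj p hp (eigP p t lam) (eigP p t mu)
  rw [macOp_eigP ht0, macOp_eigP ht0, map_smul, map_smul, LinearMap.smul_apply, ← sub_eq_zero,
    ← sub_smul] at h4
  exact (smul_eq_zero.1 h4).resolve_left (sub_ne_zero.2 hpe)

/-! ### The Macdonald symmetric functions -/

theorem pairing_eigP_eq_zero {q t : ℝ} (hq0 : 0 < q) (hq1 : q < 1) (ht0 : 0 < t) (ht1 : t < 1)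
    {lam mu : Ptn} (h : lam ≠ mu) : pairing q t (eigP q t lam) (eigP q t mu) = 0 := by
  refine form_eigP_eq_zero (B := fun q => pairingForm q t) ht0 ht1 (fun a b => ?_)
    (fun p _ a b => pairing_macOp ht0 ht1 a b) h ⟨hq0, hq1⟩
  simp only [pairingForm_apply, pairing, zWeight, Finsupp.prod]
  fun_prop

theorem mem_lowSpan_iff {lam : Ptn} {u : PowSum} : u ∈ lowSpan lam ↔
    powerSumMap u ∈ Submodule.span ℝ (monomialSym '' {mu | DomLT mu lam}) := by
  have h : (lowSpan lam).map powerSumMap.toLinearMap =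
      Submodule.span ℝ (monomialSym '' {mu | DomLT mu lam}) := by
    rw [lowSpan, Submodule.map_span, Set.image_image]
    simp [powerSumMap_mono]
  rw [← h]
  constructor
  · exact fun hu => ⟨u, hu, rfl⟩
  · rintro ⟨v, hv, hvu⟩
    rwa [← powerSumMap_injective hvu]

/-- The symmetric function of a polynomial in the power sums. -/
def toSymFun (u : PowSum) : SymFun := ⟨powerSumMap u, powerSumMap_mem u⟩

theorem scalar_toSymFun (q t : ℝ) (u v : PowSum) :
    scalar q t (toSymFun u) (toSymFun v) = pairing q t u v := by
  rw [scalar_eq_pairing, toSymFun, toSymFun, powerSumExpansion_mk, powerSumExpansion_mk]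

theorem isMacdonaldFamily_eigP {q t : ℝ} (hq0 : 0 < q) (hq1 : q < 1) (ht0 : 0 < t) (ht1 : t < 1)
    : IsMacdonaldFamily q t fun lam => toSymFun (eigP q t lam) where
  triangular lam := by
    have h := mem_lowSpan_iff.1 (eigP_sub_mono_mem hq0 hq1 ht0 ht1 lam)
    rwa [map_sub, powerSumMap_mono] at h
  orthogonal lam mu h := by
    rw [scalar_toSymFun, pairing_eigP_eq_zero hq0 hq1 ht0 ht1 h]

/-- Gram–Schmidt along the dominance order. If the families agree below λ, both candidates for λ are
orthogonal to the lower span. Their difference lies in that span, so it is orthogonal to itself and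
vanishes by positivity. -/
theorem eq_eigP_of_isMacdonaldFamily {q t : ℝ} (hq0 : 0 < q) (hq1 : q < 1) (ht0 : 0 < t) (ht1 : t < 1)
    {P : Ptn → SymFun} (hP : IsMacdonaldFamily q t P)
    (lam : Ptn) : P lam = toSymFun (eigP q t lam) := by
  set Q : Ptn → PowSum := fun mu => powerSumExpansion (P mu) with hQ
  have hQP : ∀ mu, P mu = toSymFun (Q mu) := fun mu =>
    Subtype.ext (powerSumMap_powerSumExpansion _).symm
  have hQl : ∀ mu, Q mu - mono mu ∈ lowSpan mu := fun mu => by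
    rw [mem_lowSpan_iff, map_sub, powerSumMap_mono, hQ, powerSumMap_powerSumExpansion]
    exact hP.triangular mu
  have hQo : ∀ mu nu, mu ≠ nu → pairing q t (Q mu) (Q nu) = 0 := fun mu nu h => by
    rw [← scalar_eq_pairing]
    exact hP.orthogonal mu nu h
  rw [hQP]
  congr 1
  have hspan : ∀ mu, (∀ nu, DomLT nu mu → Q nu = eigP q t nu) →
      ∀ u ∈ lowSpan mu, pairing q t (Q mu) u = 0 ∧ pairing q t (eigP q t mu) u = 0 := by
    intro mu hmu
    have hmono : ∀ nu, DomLT nu mu →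
        mono nu ∈ Submodule.span ℝ (eigP q t '' {nu | DomLT nu mu}) := by
      intro nu
      induction nu using domLT_wf.induction with
      | _ nu ih =>
      intro hnu
      have h1 : lowSpan nu ≤ Submodule.span ℝ (eigP q t '' {nu | DomLT nu mu}) := by
        refine Submodule.span_le.2 ?_
        rintro _ ⟨ka, hka, rfl⟩
        exact ih ka hka (domLT_trans hka hnu)
      rw [← sub_sub_cancel (eigP q t nu) (mono nu)]
      exact Submodule.sub_mem _ (Submodule.subset_span ⟨nu, hnu, rfl⟩)
        (h1 (eigP_sub_mono_mem hq0 hq1 ht0 ht1 nu))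
    have hle : lowSpan mu ≤
        LinearMap.ker (pairingForm q t (Q mu)) ⊓ LinearMap.ker (pairingForm q t (eigP q t mu)) := by
      refine (Submodule.span_le.2 ?_).trans
        (Submodule.span_le.2 (?_ : eigP q t '' {nu | DomLT nu mu} ⊆ _))
      · rintro _ ⟨nu, hnu, rfl⟩
        exact hmono nu hnu
      · rintro _ ⟨nu, hnu, rfl⟩
        refine ⟨?_, ?_⟩
        · change pairing q t (Q mu) (eigP q t nu) = 0
          rw [← hmu nu hnu]
          exact hQo _ _ hnu.1.symm
        · exact pairing_eigP_eq_zero hq0 hq1 ht0 ht1 hnu.1.symm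
    exact fun u hu => hle hu
  induction lam using domLT_wf.induction with
  | _ lam ih =>
  by_contra hne
  have hd : Q lam - eigP q t lam ∈ lowSpan lam := by
    have := Submodule.sub_mem _ (hQl lam) (eigP_sub_mono_mem hq0 hq1 ht0 ht1 lam)
    rwa [sub_sub_sub_cancel_right] at this
  obtain ⟨h1, h2⟩ := hspan lam ih _ hd
  refine (pairing_self_pos hq0 hq1 ht0 ht1 (sub_ne_zero.2 hne)).ne' ?_
  rw [sub_eq_add_neg (Q lam), ← neg_one_smul ℝ (eigP q t lam), pairing_add_left, pairing_smul_left,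
    neg_one_smul, ← sub_eq_add_neg, h1, h2, mul_zero, add_zero]

theorem existsUnique_isMacdonaldFamily {q t : ℝ} (hq0 : 0 < q) (hq1 : q < 1) (ht0 : 0 < t) (ht1 : t < 1)
    : ∃! P : Ptn → SymFun, IsMacdonaldFamily q t P :=
  ⟨_, isMacdonaldFamily_eigP hq0 hq1 ht0 ht1, fun _ hP =>
    funext fun lam => eq_eigP_of_isMacdonaldFamily hq0 hq1 ht0 ht1 hP lam⟩

theorem macdonaldP_eq {q t : ℝ} (hq0 : 0 < q) (hq1 : q < 1) (ht0 : 0 < t) (ht1 : t < 1)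
    (lam : Ptn) : macdonaldP q t lam = toSymFun (eigP q t lam) :=
  eq_eigP_of_isMacdonaldFamily hq0 hq1 ht0 ht1
    (Classical.epsilon_spec ⟨_, isMacdonaldFamily_eigP hq0 hq1 ht0 ht1⟩) lam

theorem macdonaldP_apply {q t : ℝ} (hq0 : 0 < q) (hq1 : q < 1) (ht0 : 0 < t) (ht1 : t < 1)
    (lam : Ptn) (n : ℕ) :
    (macdonaldP q t lam).1 n = toVars n (eigP q t lam) := by
  rw [macdonaldP_eq hq0 hq1 ht0 ht1]
  exact powerSumMap_apply _ _

end MacdonaldInt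

end

/-! ### Analysis of (a;q)_∞ and exponential series over infinitely many variables -/

noncomputable section

namespace MacdonaldInt

/-! ### The infinite product `(a;q)_∞` -/

theorem summable_norm_mul_pow (a : ℂ) {q : ℝ} (hq : q ∈ Set.Ioo (0 : ℝ) 1) :
    Summable fun k : ℕ => ‖-(a * (q : ℂ) ^ k)‖ := by
  have : (fun k : ℕ => ‖-(a * (q : ℂ) ^ k)‖) = fun k => ‖a‖ * q ^ k := by
    funext k
    rw [norm_neg, norm_mul, norm_pow, Complex.norm_real, Real.norm_of_nonneg hq.1.le]
  rw [this]
  exact (summable_geometric_of_lt_one hq.1.le hq.2).mul_left _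

theorem multipliable_qPoch (a : ℂ) {q : ℝ} (hq : q ∈ Set.Ioo (0 : ℝ) 1) :
    Multipliable fun k : ℕ => 1 - a * (q : ℂ) ^ k := by
  simpa only [← sub_eq_add_neg] using multipliable_one_add_of_summable (summable_norm_mul_pow a hq)

theorem qPoch_eq_mul (a : ℂ) {q : ℝ} (hq : q ∈ Set.Ioo (0 : ℝ) 1) :
    qPoch a q = (1 - a) * qPoch (a * q) q := by
  have h : ∀ k : ℕ, 1 - a * (q : ℂ) ^ (k + 1) = 1 - a * q * (q : ℂ) ^ k := fun k => by
    rw [pow_succ]; ring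
  rw [qPoch, tprod_eq_zero_mul' (by simpa only [h] using multipliable_qPoch (a * q) hq), qPoch]
  simp only [h, pow_zero, mul_one]

theorem qPoch_ne_zero {a : ℂ} (ha : ‖a‖ < 1) {q : ℝ} (hq : q ∈ Set.Ioo (0 : ℝ) 1) :
    qPoch a q ≠ 0 := by
  rw [qPoch]
  simp only [sub_eq_add_neg]
  refine tprod_one_add_ne_zero_of_summable (fun k h => ?_) (summable_norm_mul_pow a hq)
  rw [← sub_eq_add_neg, sub_eq_zero] at h
  have h1 : ‖a * (q : ℂ) ^ k‖ < 1 := by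
    rw [norm_mul, norm_pow, Complex.norm_real, Real.norm_of_nonneg hq.1.le]
    exact (mul_le_of_le_one_right (norm_nonneg a) (pow_le_one₀ hq.1.le hq.2.le)).trans_lt ha
  rw [← h, norm_one] at h1
  exact lt_irrefl _ h1

/-- Joint continuity in a and q, by dominated convergence of the product; continuity in q is what
the limiting argument for orthogonality on the torus needs. -/
theorem continuousOn_qPoch :
    ContinuousOn (fun p : ℂ × ℝ => qPoch p.1 p.2) (Set.univ ×ˢ Set.Ioo (0 : ℝ) 1) := by
  rintro ⟨a, q⟩ ⟨-, hq⟩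
  refine ContinuousAt.continuousWithinAt ?_
  obtain ⟨ρ, hρ1, hρ2⟩ := exists_between hq.2
  simp only [ContinuousAt, qPoch, sub_eq_add_neg]
  refine tendsto_tprod_one_add_of_dominated_convergence (bound := fun k => (‖a‖ + 1) * ρ ^ k)
    ((summable_geometric_of_lt_one (hq.1.trans hρ1).le hρ2).mul_left _) (fun k => ?_) ?_
  · have : Continuous fun p : ℂ × ℝ => -(p.1 * (p.2 : ℂ) ^ k) := by fun_prop
    exact this.tendsto (a, q)
  · have h1 : ∀ᶠ p : ℂ × ℝ in nhds (a, q), ‖p.1‖ < ‖a‖ + 1 :=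
      (continuous_fst.norm.tendsto (a, q)).eventually_lt_const (lt_add_one _)
    have h2 : ∀ᶠ p : ℂ × ℝ in nhds (a, q), ‖p.2‖ < ρ :=
      (continuous_snd.norm.tendsto (a, q)).eventually_lt_const
        (by simpa [abs_of_pos hq.1] using hρ1)
    filter_upwards [h1, h2] with p hp1 hp2 k
    rw [norm_neg, norm_mul, norm_pow, Complex.norm_real]
    gcongr

theorem continuousOn_qPoch_comp {X : Type*} [TopologicalSpace X] {s : Set X} {f : X → ℂ}
    {g : X → ℝ} (hf : ContinuousOn f s) (hg : ContinuousOn g s)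
    (h : ∀ x ∈ s, g x ∈ Set.Ioo (0 : ℝ) 1) : ContinuousOn (fun x => qPoch (f x) (g x)) s :=
  continuousOn_qPoch.comp (hf.prodMk hg) fun x hx => ⟨Set.mem_univ _, h x hx⟩

theorem continuous_qPoch {q : ℝ} (hq : q ∈ Set.Ioo (0 : ℝ) 1) : Continuous fun a => qPoch a q :=
  continuousOn_univ.1 (continuousOn_qPoch_comp continuousOn_id continuousOn_const fun _ _ => hq)

theorem differentiable_qPoch {q : ℝ} (hq : q ∈ Set.Ioo (0 : ℝ) 1) :
    Differentiable ℂ fun a => qPoch a q := by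
  have key : ∀ R : ℝ, DifferentiableOn ℂ (fun a => qPoch a q) (Metric.ball 0 R) := by
    intro R
    have h : HasProdLocallyUniformlyOn (fun (k : ℕ) (a : ℂ) => 1 + -(a * (q : ℂ) ^ k))
        (fun a => ∏' k : ℕ, (1 + -(a * (q : ℂ) ^ k))) (Metric.ball 0 R) := by
      refine Summable.hasProdLocallyUniformlyOn_nat_one_add (u := fun k => R * q ^ k)
        Metric.isOpen_ball ((summable_geometric_of_lt_one hq.1.le hq.2).mul_left _)
        (Filter.Eventually.of_forall fun k a ha => ?_) fun k => by fun_prop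
      rw [norm_neg, norm_mul, norm_pow, Complex.norm_real, Real.norm_of_nonneg hq.1.le]
      have : ‖a‖ < R := by simpa using ha
      have hq0 := hq.1.le
      gcongr
    simp only [qPoch, sub_eq_add_neg]
    exact h.differentiableOn (Filter.Eventually.of_forall fun s => by
      simpa [Finset.prod_fn] using DifferentiableOn.finsetProd (fun _ _ => by fun_prop))
      Metric.isOpen_ball
  intro a
  exact (key (‖a‖ + 1)).differentiableAt
    (Metric.isOpen_ball.mem_nhds (by simp))

theorem conj_qPoch (a : ℂ) {q : ℝ} (hq : q ∈ Set.Ioo (0 : ℝ) 1) :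
    (starRingEnd ℂ) (qPoch a q) = qPoch ((starRingEnd ℂ) a) q := by
  rw [qPoch, Multipliable.map_tprod (multipliable_qPoch a hq) _ Complex.continuous_conj, qPoch]
  simp

/-! ### The exponential formula -/

theorem hasSum_of_eq {ι : Type*} {f g : ι → ℂ} {a : ℂ} (hg : HasSum g a) (h : ∀ i, f i = g i) :
    HasSum f a := by
  rwa [funext h]

theorem hasSum_pnat_pow_div {z : ℂ} (hz : ‖z‖ < 1) :
    HasSum (fun r : ℕ+ => z ^ (r : ℕ) / (r : ℕ)) (-Complex.log (1 - z)) := by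
  rw [← Equiv.pnatEquivNat.symm.hasSum_iff]
  refine hasSum_of_eq (Complex.hasSum_taylorSeries_neg_log' hz) fun n => ?_
  simp

/-- The coefficients of `log ((t a;q)_∞ / (a;q)_∞)`. -/
def kerWeight (q t : ℝ) (r : ℕ+) : ℝ := (1 - t ^ (r : ℕ)) / ((1 - q ^ (r : ℕ)) * (r : ℕ))

/-- The logarithm is an absolutely convergent double series over k (factors of the product) and r
(Taylor expansion of the logarithm). Summing over k first gives geometric series and the weights.
Summing over r first gives logarithms of the factors, whose exponentials multiply to the quotient.
-/
theorem exists_hasSum_kerWeight {q t : ℝ} (hq : q ∈ Set.Ioo (0 : ℝ) 1) (ht0 : 0 < t) (ht1 : t < 1)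
    {a : ℂ} (ha : ‖a‖ < 1) : ∃ S, HasSum (fun r : ℕ+ => (kerWeight q t r : ℂ) * a ^ (r : ℕ)) S ∧
      Complex.exp S = qPoch (t * a) q / qPoch a q := by
  set A : ℕ × ℕ+ → ℂ := fun p => (a * (q : ℂ) ^ p.1) ^ (p.2 : ℕ) / (p.2 : ℕ) * (1 - (t : ℂ) ^ (p.2 : ℕ))
    with hA
  have hq0 := hq.1.le
  have hAs : Summable A := by
    have h1 : Summable fun p : ℕ × ℕ+ => q ^ p.1 * ‖a‖ ^ (p.2 : ℕ) := by
      refine (summable_geometric_of_lt_one hq.1.le hq.2).mul_of_nonneg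
        ((summable_geometric_of_lt_one (norm_nonneg a) ha).comp_injective PNat.coe_injective)
        (fun k => pow_nonneg hq0 k) fun r => pow_nonneg (norm_nonneg a) _
    refine Summable.of_norm_bounded h1 ?_
    rintro ⟨k, r⟩
    have h2 : ‖(1 - (t : ℂ) ^ (r : ℕ))‖ ≤ 1 := by
      have : (1 - (t : ℂ) ^ (r : ℕ)) = ((1 - t ^ (r : ℕ) : ℝ) : ℂ) := by push_cast; ring
      rw [this, Complex.norm_real, Real.norm_eq_abs, abs_le]
      have h3 : t ^ (r : ℕ) ≤ 1 := pow_le_one₀ ht0.le ht1.le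
      have h4 : 0 < t ^ (r : ℕ) := by positivity
      constructor <;> linarith
    have h3 : (1 : ℝ) ≤ (r : ℕ) := by exact_mod_cast r.pos
    have h4 : (q ^ k) ^ (r : ℕ) ≤ q ^ k :=
      pow_le_of_le_one (by positivity) (pow_le_one₀ hq.1.le hq.2.le) r.ne_zero
    simp only [hA, norm_mul, norm_div, norm_pow, Complex.norm_natCast, Complex.norm_real,
      Real.norm_of_nonneg hq.1.le, mul_pow]
    calc ‖a‖ ^ (r : ℕ) * (q ^ k) ^ (r : ℕ) / (r : ℕ) * ‖(1 - (t : ℂ) ^ (r : ℕ))‖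
        ≤ ‖a‖ ^ (r : ℕ) * (q ^ k) ^ (r : ℕ) / 1 * 1 := by gcongr
      _ ≤ q ^ k * ‖a‖ ^ (r : ℕ) := by
        rw [div_one, mul_one, mul_comm]
        gcongr
  refine ⟨∑' p, A p, ?_, ?_⟩
  · have h1 : HasSum (fun p : ℕ+ × ℕ => A (p.2, p.1)) (∑' p, A p) := by
      have h := (Equiv.hasSum_iff (f := A) (a := ∑' p, A p) (Equiv.prodComm ℕ+ ℕ)).2 hAs.hasSum
      exact hasSum_of_eq h fun p => rfl
    refine h1.prod_fiberwise fun r => ?_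
    have h2 : ‖(q : ℂ) ^ (r : ℕ)‖ < 1 := by
      rw [norm_pow, Complex.norm_real, Real.norm_of_nonneg hq.1.le]
      exact pow_lt_one₀ hq.1.le hq.2 r.ne_zero
    have h3 := (hasSum_geometric_of_norm_lt_one h2).mul_left
      (a ^ (r : ℕ) / (r : ℕ) * (1 - (t : ℂ) ^ (r : ℕ)))
    have h4 : (kerWeight q t r : ℂ) * a ^ (r : ℕ) =
        a ^ (r : ℕ) / (r : ℕ) * (1 - (t : ℂ) ^ (r : ℕ)) * (1 - (q : ℂ) ^ (r : ℕ))⁻¹ := by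
      rw [kerWeight]
      push_cast
      rw [div_eq_mul_inv, mul_inv]
      ring
    rw [h4]
    refine hasSum_of_eq h3 fun k => ?_
    simp only [hA]
    rw [mul_pow, ← pow_mul, ← pow_mul, mul_comm k]
    ring
  · have hk : ∀ k : ℕ, ‖a * (q : ℂ) ^ k‖ < 1 := fun k => by
      rw [norm_mul, norm_pow, Complex.norm_real, Real.norm_of_nonneg hq.1.le]
      exact (mul_le_of_le_one_right (norm_nonneg a) (pow_le_one₀ hq.1.le hq.2.le)).trans_lt ha
    have hk' : ∀ k : ℕ, ‖t * (a * (q : ℂ) ^ k)‖ < 1 := fun k => by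
      rw [norm_mul, Complex.norm_real, Real.norm_of_nonneg ht0.le]
      exact (mul_le_of_le_one_left (norm_nonneg _) ht1.le).trans_lt (hk k)
    have hne : ∀ z : ℂ, ‖z‖ < 1 → 1 - z ≠ 0 := fun z hz h => by
      rw [sub_eq_zero] at h
      rw [← h, norm_one] at hz
      exact lt_irrefl _ hz
    have h1 : HasSum (fun k : ℕ => -Complex.log (1 - a * (q : ℂ) ^ k) -
        -Complex.log (1 - t * (a * (q : ℂ) ^ k))) (∑' p, A p) := by
      refine hAs.hasSum.prod_fiberwise fun k => ?_
      refine hasSum_of_eq ((hasSum_pnat_pow_div (hk k)).sub (hasSum_pnat_pow_div (hk' k)))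
        fun r => ?_
      simp only [hA]
      rw [mul_pow (t : ℂ)]
      ring
    have h2 := h1.cexp.mul (multipliable_qPoch a hq).hasProd
    rw [eq_div_iff (qPoch_ne_zero ha hq)]
    refine h2.unique ?_
    rw [qPoch]
    convert (multipliable_qPoch (t * a) hq).hasProd using 1
    funext k
    simp only [Function.comp]
    rw [neg_sub_neg, Complex.exp_sub, Complex.exp_log (hne _ (hk' k)), Complex.exp_log (hne _ (hk k)),
      div_mul_cancel₀ _ (hne _ (hk k)), mul_assoc]

theorem prod_finsupp_box {ι R : Type*} [CommSemiring R] (f : ι → ℕ → R)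
    (hf : ∀ i, f i 0 = 1) (s : Finset ι) (K : ℕ) :
    ∑ m ∈ s.finsupp fun _ => Finset.range K, m.prod f = ∏ i ∈ s, ∑ k ∈ Finset.range K, f i k := by
  classical
  rw [Finset.prod_sum, Finset.finsupp, Finset.sum_map]
  refine Finset.sum_congr rfl fun p hp => ?_
  rw [Function.Embedding.coeFn_mk, Finsupp.prod_of_support_subset _ (Finsupp.support_indicator_subset _ _) _ fun i _ => hf i,
    ← Finset.prod_attach]
  refine Finset.prod_congr rfl fun i _ => ?_
  simp

/-- The boxes of exponents. -/
def expBox (n K : ℕ) : Finset (ℕ+ →₀ ℕ) :=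
  ((Finset.range n).image Nat.succPNat).finsupp fun _ => Finset.range (K + 1)

theorem monotone_expBox : Monotone fun p : ℕ × ℕ => expBox p.1 p.2 := by
  classical
  rintro ⟨n, K⟩ ⟨n', K'⟩ ⟨h1, h2⟩ m hm
  simp only [expBox, Finset.mem_finsupp_iff, Finset.mem_range] at hm ⊢
  refine ⟨hm.1.trans (Finset.image_subset_image (Finset.range_mono h1)), fun i hi => ?_⟩
  by_cases h : i ∈ m.support
  · exact (hm.2 i (hm.1 h)).trans_le (Nat.succ_le_succ h2)
  · rw [Finsupp.notMem_support_iff.1 h]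
    exact Nat.succ_pos _

theorem exists_mem_expBox (m : ℕ+ →₀ ℕ) : ∃ p : ℕ × ℕ, m ∈ expBox p.1 p.2 := by
  classical
  refine ⟨⟨m.support.sup (fun r => (r : ℕ)), m.support.sup m⟩, ?_⟩
  simp only [expBox, Finset.mem_finsupp_iff, Finset.mem_range]
  refine ⟨fun r hr => ?_, fun r _ => ?_⟩
  · rw [Finset.mem_image]
    refine ⟨r.natPred, ?_, PNat.succPNat_natPred r⟩
    have h1 : (r : ℕ) ≤ m.support.sup (fun r => (r : ℕ)) :=
      Finset.le_sup (f := fun r : ℕ+ => (r : ℕ)) hr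
    have h2 := PNat.natPred_add_one r
    rw [Finset.mem_range]
    omega
  · by_cases h : r ∈ m.support
    · exact Nat.lt_succ_of_le (Finset.le_sup (f := m) h)
    · rw [Finsupp.notMem_support_iff.1 h]
      exact Nat.succ_pos _

theorem tendsto_expBox :
    Filter.Tendsto (fun p : ℕ × ℕ => expBox p.1 p.2) Filter.atTop Filter.atTop :=
  Filter.tendsto_atTop_finset_of_monotone monotone_expBox exists_mem_expBox

theorem summable_prod_pow_div_factorial {b : ℕ+ → ℝ} (hb0 : ∀ r, 0 ≤ b r) (hb : Summable b) :
    Summable fun m : ℕ+ →₀ ℕ => m.prod fun r k => b r ^ k / (k.factorial : ℝ) := by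
  classical
  have hnn : ∀ m : ℕ+ →₀ ℕ, 0 ≤ m.prod fun r k => b r ^ k / (k.factorial : ℝ) := fun m =>
    Finset.prod_nonneg fun r _ => div_nonneg (pow_nonneg (hb0 r) _) (Nat.cast_nonneg _)
  refine summable_of_sum_le hnn (c := Real.exp (∑' r, b r)) fun T => ?_
  obtain ⟨p, hp⟩ := (tendsto_expBox.eventually (Filter.eventually_ge_atTop T)).exists
  refine (Finset.sum_le_sum_of_subset_of_nonneg hp fun m _ _ => hnn m).trans ?_
  rw [expBox, prod_finsupp_box _ (by simp)]
  refine (Finset.prod_le_prod (fun r _ => Finset.sum_nonneg fun k _ =>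
    div_nonneg (pow_nonneg (hb0 r) _) (Nat.cast_nonneg _)) fun r _ =>
    Real.sum_le_exp_of_nonneg (hb0 r) (p.2 + 1)).trans ?_
  rw [← Real.exp_sum]
  exact Real.exp_le_exp.2 (hb.sum_le_tsum _ fun r _ => hb0 r)

/-- This is exp(∑ b_r) = ∏ exp(b_r), multiplied out over all finitely supported exponents. Over a
finite box of exponents the expansion is an exact product of partial exponential sums, and the boxes
exhaust all exponents. -/
theorem hasSum_prod_pow_div_factorial {b : ℕ+ → ℂ} (hb : Summable fun r => ‖b r‖) :
    HasSum (fun m : ℕ+ →₀ ℕ => m.prod fun r k => b r ^ k / (k.factorial : ℂ))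
      (Complex.exp (∑' r, b r)) := by
  classical
  have hs : Summable fun m : ℕ+ →₀ ℕ => m.prod fun r k => b r ^ k / (k.factorial : ℂ) := by
    refine Summable.of_norm_bounded
      (summable_prod_pow_div_factorial (fun r => norm_nonneg (b r)) hb) fun m => ?_
    rw [Finsupp.prod, norm_prod]
    refine le_of_eq (Finset.prod_congr rfl fun r _ => ?_)
    rw [norm_div, norm_pow, Complex.norm_natCast]
  set S := ∑' m : ℕ+ →₀ ℕ, m.prod fun r k => b r ^ k / (k.factorial : ℂ) with hS
  -- The sum over boxes converges jointly in the number of variables and the bound on the exponents,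
  -- so the limit may be taken first in the exponent bound and then in the number of variables.
  have h1 := hs.hasSum.comp tendsto_expBox
  have h2 : ∀ n : ℕ, Filter.Tendsto (fun K => ∑ m ∈ expBox n K,
      m.prod fun r k => b r ^ k / (k.factorial : ℂ)) Filter.atTop
      (nhds (Complex.exp (∑ i ∈ Finset.range n, b (Nat.succPNat i)))) := by
    intro n
    simp only [expBox]
    simp_rw [prod_finsupp_box (fun r k => b r ^ k / (k.factorial : ℂ)) (by simp),
      Finset.prod_image fun i _ j _ h => Nat.succPNat_injective h, Complex.exp_sum]
    refine tendsto_finsetProd _ fun i _ => ?_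
    have := (NormedSpace.expSeries_div_hasSum_exp (b (Nat.succPNat i))).tendsto_sum_nat
    rw [← Complex.exp_eq_exp_ℂ] at this
    exact (Filter.tendsto_add_atTop_iff_nat 1).2 this
  have h3 : Filter.Tendsto (fun n => Complex.exp (∑ i ∈ Finset.range n, b (Nat.succPNat i)))
      Filter.atTop (nhds S) := by
    rw [Metric.tendsto_atTop]
    intro ε hε
    obtain ⟨⟨N, M⟩, hN⟩ := Metric.tendsto_atTop.1 h1 (ε / 2) (half_pos hε)
    refine ⟨N, fun n hn => ?_⟩
    refine (le_of_tendsto ((h2 n).dist tendsto_const_nhds)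
      (Filter.eventually_atTop.2 ⟨M, fun K hK => ?_⟩)).trans_lt (half_lt_self hε)
    exact (hN (n, K) ⟨hn, hK⟩).le
  have h4 : Filter.Tendsto (fun n => Complex.exp (∑ i ∈ Finset.range n, b (Nat.succPNat i)))
      Filter.atTop (nhds (Complex.exp (∑' r, b r))) := by
    refine (Complex.continuous_exp.tendsto _).comp ?_
    exact (Equiv.pnatEquivNat.symm.hasSum_iff.2 hb.of_norm.hasSum).tendsto_sum_nat
  rw [tendsto_nhds_unique h4 h3]
  exact hs.hasSum

end MacdonaldInt

end

/-! ### The Cauchy expansion of Π -/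

noncomputable section

namespace MacdonaldInt

open MvPolynomial

/-! ### Expansion of the kernel in power sums -/

theorem psEval_monomial {n : ℕ} (x : Fin n → ℂ) (k : ℕ+ →₀ ℕ) :
    psEval x (monomial k 1) = k.prod fun r e => (∑ i, x i ^ (r : ℕ)) ^ e := by
  rw [monomial_eq, C_1, one_mul, Finsupp.prod, map_prod]
  simp only [map_pow, psEval_X]
  rfl

theorem kerWeight_pos {q t : ℝ} (hq : q ∈ Set.Ioo (0 : ℝ) 1) (ht0 : 0 < t) (ht1 : t < 1) (r : ℕ+) :
    0 < kerWeight q t r := by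
  have h1 : q ^ (r : ℕ) < 1 := pow_lt_one₀ hq.1.le hq.2 r.ne_zero
  have h2 : t ^ (r : ℕ) < 1 := pow_lt_one₀ ht0.le ht1 r.ne_zero
  have h3 : (0 : ℝ) < (r : ℕ) := by exact_mod_cast r.pos
  exact div_pos (by linarith) (mul_pos (by linarith) h3)

/-- Shows that the weights of the scalar product are the inverses of the coefficients that arise
from exponentiating the logarithm of the kernel. -/
theorem inv_zWeight (q t : ℝ) (k : ℕ+ →₀ ℕ) :
    (zWeight q t k)⁻¹ = k.prod fun r e => kerWeight q t r ^ e / (e.factorial : ℝ) := by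
  rw [zWeight, Finsupp.prod, Finsupp.prod, ← Finset.prod_inv_distrib]
  refine Finset.prod_congr rfl fun r _ => ?_
  rw [kerWeight, mul_inv, mul_inv, ← inv_pow, ← inv_pow, inv_div, mul_right_comm, ← mul_pow,
    div_eq_mul_inv _ ((k r).factorial : ℝ)]
  congr 2
  rw [div_eq_mul_inv, div_eq_mul_inv, mul_inv]
  ring

/-- A summable bound for the terms of the expansion of the kernel. -/
def kerBound (q t : ℝ) (n m : ℕ) (θ : ℝ) (k : ℕ+ →₀ ℕ) : ℝ :=
  k.prod fun r e => (kerWeight q t r * (n * m * θ ^ (r : ℕ))) ^ e / (e.factorial : ℝ)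

/-- The terms of the expansion of the kernel. -/
def kerTerm (q t : ℝ) {n m : ℕ} (x : Fin n → ℂ) (y : Fin m → ℂ) (k : ℕ+ →₀ ℕ) : ℂ :=
  ((zWeight q t k)⁻¹ : ℝ) * (psEval x (monomial k 1) * psEval y (monomial k 1))

theorem kerTerm_eq (q t : ℝ) {n m : ℕ} (x : Fin n → ℂ) (y : Fin m → ℂ) (k : ℕ+ →₀ ℕ) :
    kerTerm q t x y k = k.prod fun r e => ((kerWeight q t r : ℂ) *
      ((∑ i, x i ^ (r : ℕ)) * ∑ j, y j ^ (r : ℕ))) ^ e / (e.factorial : ℂ) := by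
  rw [kerTerm, inv_zWeight, psEval_monomial, psEval_monomial, Finsupp.prod, Finsupp.prod,
    Finsupp.prod, Finsupp.prod, Complex.ofReal_prod, ← Finset.prod_mul_distrib,
    ← Finset.prod_mul_distrib]
  refine Finset.prod_congr rfl fun r _ => ?_
  push_cast
  rw [mul_pow, mul_pow]
  ring


theorem norm_kerWeight_mul_le {q t : ℝ} (hq : q ∈ Set.Ioo (0 : ℝ) 1) (ht0 : 0 < t) (ht1 : t < 1)
    {n m : ℕ} {x : Fin n → ℂ} {y : Fin m → ℂ} {X Y : ℝ} (hx : ∀ i, ‖x i‖ ≤ X) (hy : ∀ j, ‖y j‖ ≤ Y)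
    (r : ℕ+) : ‖(kerWeight q t r : ℂ) * ((∑ i, x i ^ (r : ℕ)) * ∑ j, y j ^ (r : ℕ))‖ ≤
      kerWeight q t r * (n * m * (X * Y) ^ (r : ℕ)) := by
  have h1 : ‖∑ i, x i ^ (r : ℕ)‖ ≤ n * X ^ (r : ℕ) := by
    refine ((norm_sum_le _ _).trans (Finset.sum_le_card_nsmul _ _ (X ^ (r : ℕ))
      fun i _ => ?_)).trans_eq (by simp)
    rw [norm_pow]
    exact pow_le_pow_left₀ (norm_nonneg _) (hx i) _
  have h2 : ‖∑ i, y i ^ (r : ℕ)‖ ≤ m * Y ^ (r : ℕ) := by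
    refine ((norm_sum_le _ _).trans (Finset.sum_le_card_nsmul _ _ (Y ^ (r : ℕ))
      fun i _ => ?_)).trans_eq (by simp)
    rw [norm_pow]
    exact pow_le_pow_left₀ (norm_nonneg _) (hy i) _
  have h0 := kerWeight_pos hq ht0 ht1 r
  rw [norm_mul, norm_mul, Complex.norm_real, Real.norm_of_nonneg h0.le, mul_pow]
  refine mul_le_mul_of_nonneg_left ?_ h0.le
  exact (mul_le_mul h1 h2 (norm_nonneg _) ((norm_nonneg _).trans h1)).trans_eq (by ring)

theorem summable_kerWeight_mul {q t : ℝ} (hq : q ∈ Set.Ioo (0 : ℝ) 1) (ht0 : 0 < t) (ht1 : t < 1)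
    (n m : ℕ) {θ : ℝ} (h0 : 0 ≤ θ) (h1 : θ < 1) :
    Summable fun r : ℕ+ => kerWeight q t r * (n * m * θ ^ (r : ℕ)) := by
  obtain ⟨S, hS, -⟩ := exists_hasSum_kerWeight hq ht0 ht1 (a := (θ : ℂ))
    (by rwa [Complex.norm_real, Real.norm_of_nonneg h0])
  have h2 : Summable fun r : ℕ+ => kerWeight q t r * θ ^ (r : ℕ) := by
    rw [← Complex.summable_ofReal]
    simpa using hS.summable
  refine (h2.mul_left (n * m : ℝ)).congr fun r => ?_
  ring

theorem summable_kerBound {q t : ℝ} (hq : q ∈ Set.Ioo (0 : ℝ) 1) (ht0 : 0 < t) (ht1 : t < 1)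
    (n m : ℕ) {θ : ℝ} (h0 : 0 ≤ θ) (h1 : θ < 1) : Summable (kerBound q t n m θ) :=
  summable_prod_pow_div_factorial
    (fun r => mul_nonneg (kerWeight_pos hq ht0 ht1 r).le (by positivity))
    (summable_kerWeight_mul hq ht0 ht1 n m h0 h1)

theorem norm_kerTerm_le {q t : ℝ} (hq : q ∈ Set.Ioo (0 : ℝ) 1) (ht0 : 0 < t) (ht1 : t < 1)
    {n m : ℕ} {x : Fin n → ℂ} {y : Fin m → ℂ} {X Y : ℝ} (hx : ∀ i, ‖x i‖ ≤ X) (hy : ∀ j, ‖y j‖ ≤ Y)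
    (k : ℕ+ →₀ ℕ) : ‖kerTerm q t x y k‖ ≤ kerBound q t n m (X * Y) k := by
  rw [kerTerm_eq, kerBound, Finsupp.prod, Finsupp.prod, norm_prod]
  refine Finset.prod_le_prod (fun _ _ => norm_nonneg _) fun r _ => ?_
  rw [norm_div, norm_pow, Complex.norm_natCast]
  gcongr
  exact norm_kerWeight_mul_le hq ht0 ht1 hx hy r

/-- The logarithm of Π is ∑_r w_r p_r(x) p_r(y), with w_r given by `kerWeight`; exponentiating it
gives ∑ z_μ^{-1} p_μ(x) p_μ(y). The bounds X and Y are separate so that the estimate for the terms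
is uniform while y runs over a torus. -/
theorem hasSum_kerTerm {q t : ℝ} (hq : q ∈ Set.Ioo (0 : ℝ) 1) (ht0 : 0 < t) (ht1 : t < 1)
    {n m : ℕ} {x : Fin n → ℂ} {y : Fin m → ℂ} {X Y : ℝ} (hx : ∀ i, ‖x i‖ ≤ X) (hy : ∀ j, ‖y j‖ ≤ Y)
    (hX : 0 ≤ X) (hY : 0 ≤ Y) (hXY : X * Y < 1) : HasSum (kerTerm q t x y) (kerPi q t x y) := by
  have hxy : ∀ i j, ‖x i * y j‖ < 1 := fun i j => by
    rw [norm_mul]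
    exact (mul_le_mul (hx i) (hy j) (norm_nonneg _) hX).trans_lt hXY
  choose S hS hSe using fun i j => exists_hasSum_kerWeight hq ht0 ht1 (hxy i j)
  have h1 : HasSum (fun r : ℕ+ => (kerWeight q t r : ℂ) *
      ((∑ i, x i ^ (r : ℕ)) * ∑ j, y j ^ (r : ℕ))) (∑ i, ∑ j, S i j) := by
    refine hasSum_of_eq (hasSum_sum fun i _ => hasSum_sum fun j _ => hS i j) fun r => ?_
    rw [Finset.sum_mul_sum, Finset.mul_sum]
    refine Finset.sum_congr rfl fun i _ => ?_
    rw [Finset.mul_sum]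
    simp only [mul_pow]
  have h2 : kerPi q t x y = Complex.exp (∑ i, ∑ j, S i j) := by
    simp only [kerPi, Complex.exp_sum, hSe]
  rw [h2, ← h1.tsum_eq, show kerTerm q t x y = _ from funext fun k => kerTerm_eq q t x y k]
  exact hasSum_prod_pow_div_factorial (Summable.of_nonneg_of_le (fun _ => norm_nonneg _)
    (norm_kerWeight_mul_le hq ht0 ht1 hx hy)
    (summable_kerWeight_mul hq ht0 ht1 n m (mul_nonneg hX hY) hXY))

end MacdonaldInt

end

/-! ### Fubini and Cauchy for integrals over tori -/

noncomputable section

namespace MacdonaldInt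

open MeasureTheory

/-! ### Contour integrals -/

/-- The point of the torus with the given radii and angles. -/
def torusPt {ι : Type*} (R : ι → ℝ) (θ : ι → ℝ) : ι → ℂ := fun i => circleMap 0 (R i) (θ i)

theorem continuous_torusPt {ι : Type*} (R : ι → ℝ) : Continuous (torusPt R) :=
  continuous_pi fun i => (continuous_circleMap 0 (R i)).comp (continuous_apply i)

theorem norm_torusPt {ι : Type*} {R : ι → ℝ} (θ : ι → ℝ) {i : ι} (h : 0 ≤ R i) :
    ‖torusPt R θ i‖ = R i := by
  rw [torusPt, norm_circleMap_zero, abs_of_nonneg h]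

theorem contour_def {ι : Type*} [Fintype ι] (R : ι → ℝ) (F : (ι → ℂ) → ℂ) :
    contour R F = ((2 * Real.pi : ℂ) ^ Fintype.card ι)⁻¹ *
      ∫ θ in Set.Icc (0 : ι → ℝ) (fun _ => 2 * Real.pi), F (torusPt R θ) := rfl

theorem contour_congr {ι : Type*} [Fintype ι] {R : ι → ℝ} {F G : (ι → ℂ) → ℂ}
    (h : ∀ θ, F (torusPt R θ) = G (torusPt R θ)) : contour R F = contour R G := by
  simp only [contour_def, h]

theorem contour_const_mul {ι : Type*} [Fintype ι] (R : ι → ℝ) (c : ℂ) (F : (ι → ℂ) → ℂ) :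
    contour R (fun x => c * F x) = c * contour R F := by
  simp only [contour_def, integral_const_mul]
  ring

theorem integrableOn_torusPt {ι : Type*} [Fintype ι] {R : ι → ℝ} {F : (ι → ℂ) → ℂ}
    (hF : Continuous fun θ => F (torusPt R θ)) :
    IntegrableOn (fun θ => F (torusPt R θ)) (Set.Icc (0 : ι → ℝ) (fun _ => 2 * Real.pi)) :=
  hF.continuousOn.integrableOn_compact isCompact_Icc

theorem contour_add {ι : Type*} [Fintype ι] {R : ι → ℝ} {F G : (ι → ℂ) → ℂ}
    (hF : Continuous fun θ => F (torusPt R θ)) (hG : Continuous fun θ => G (torusPt R θ)) :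
    contour R (fun x => F x + G x) = contour R F + contour R G := by
  simp only [contour_def]
  rw [integral_add (integrableOn_torusPt hF) (integrableOn_torusPt hG), mul_add]

theorem contour_sum {ι κ : Type*} [Fintype ι] {R : ι → ℝ} (s : Finset κ) {F : κ → (ι → ℂ) → ℂ}
    (hF : ∀ k ∈ s, Continuous fun θ => F k (torusPt R θ)) :
    contour R (fun x => ∑ k ∈ s, F k x) = ∑ k ∈ s, contour R (F k) := by
  simp only [contour_def]
  rw [integral_finsetSum _ fun k hk => integrableOn_torusPt (hF k hk), Finset.mul_sum]

theorem contour_conj {ι : Type*} [Fintype ι] (R : ι → ℝ) (F : (ι → ℂ) → ℂ) :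
    (starRingEnd ℂ) (contour R F) = contour R fun x => (starRingEnd ℂ) (F x) := by
  simp only [contour_def, map_mul, map_inv₀, map_pow, map_ofNat, Complex.conj_ofReal, integral_conj]

theorem contour_isEmpty {ι : Type*} [Fintype ι] [IsEmpty ι] (R : ι → ℝ) (F : (ι → ℂ) → ℂ) :
    contour R F = F isEmptyElim := by
  have h : ∀ θ, torusPt R θ = isEmptyElim := fun θ => Subsingleton.elim _ _
  rw [contour_def]
  simp only [h, setIntegral_const]
  have h2 : Set.Icc (0 : ι → ℝ) (fun _ => 2 * Real.pi) = Set.univ := by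
    ext θ
    simp [Set.mem_Icc]
  rw [h2, measureReal_def, volume_pi, Measure.pi_univ]
  simp

theorem contour_reindex {ι κ : Type*} [Fintype ι] [Fintype κ] (e : ι ≃ κ) (R : κ → ℝ)
    (F : (κ → ℂ) → ℂ) : contour R F = contour (R ∘ e) fun x => F (x ∘ e.symm) := by
  have h := volume_measurePreserving_piCongrLeft (fun _ : κ => ℝ) e
  have h1 : ∀ (φ : ι → ℝ), MeasurableEquiv.piCongrLeft (fun _ : κ => ℝ) e φ = φ ∘ e.symm := by
    intro φ
    funext k
    obtain ⟨i, rfl⟩ := e.surjective k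
    rw [MeasurableEquiv.coe_piCongrLeft, Equiv.piCongrLeft_apply_apply]
    simp
  rw [contour_def, contour_def, Fintype.card_congr e,
    ← h.setIntegral_preimage_emb (MeasurableEquiv.measurableEmbedding _)]
  congr 1
  have h2 : MeasurableEquiv.piCongrLeft (fun _ : κ => ℝ) e ⁻¹'
      Set.Icc (0 : κ → ℝ) (fun _ => 2 * Real.pi) = Set.Icc (0 : ι → ℝ) (fun _ => 2 * Real.pi) := by
    ext φ
    rw [Set.mem_preimage, h1]
    simp only [Set.mem_Icc, Pi.le_def, Function.comp]
    exact and_congr ⟨fun h i => by simpa using h (e i), fun h k => h _⟩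
      ⟨fun h i => by simpa using h (e i), fun h k => h _⟩
  rw [h2]
  refine integral_congr_ae (Filter.Eventually.of_forall fun φ => ?_)
  simp only [h1]
  congr 1
  funext k
  simp [torusPt]

theorem contour_sumType {ι κ : Type*} [Fintype ι] [Fintype κ] (R : ι ⊕ κ → ℝ)
    {F : (ι ⊕ κ → ℂ) → ℂ} (hF : Continuous fun θ => F (torusPt R θ)) :
    contour R F = contour (R ∘ Sum.inr) fun y => contour (R ∘ Sum.inl) fun x => F (Sum.elim x y) := by
  have h := (volume_measurePreserving_sumPiEquivProdPi_symm (fun _ : ι ⊕ κ => ℝ))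
  have h0 : ∀ p : (ι → ℝ) × (κ → ℝ),
      (MeasurableEquiv.sumPiEquivProdPi (fun _ : ι ⊕ κ => ℝ)).symm p = Sum.elim p.1 p.2 := by
    rintro ⟨a, b⟩
    funext i
    rcases i with i | i <;> rfl
  have h1 : ∀ a b, torusPt R (Sum.elim a b) =
      Sum.elim (torusPt (R ∘ Sum.inl) a) (torusPt (R ∘ Sum.inr) b) := fun a b => by
    funext i
    rcases i with i | i <;> rfl
  have hpre : (MeasurableEquiv.sumPiEquivProdPi (fun _ : ι ⊕ κ => ℝ)).symm ⁻¹'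
      Set.Icc (0 : ι ⊕ κ → ℝ) (fun _ => 2 * Real.pi) =
      Set.Icc (0 : ι → ℝ) (fun _ => 2 * Real.pi) ×ˢ Set.Icc (0 : κ → ℝ) (fun _ => 2 * Real.pi) := by
    ext p
    rw [Set.mem_preimage, h0]
    simp only [Set.mem_Icc, Pi.le_def, Set.mem_prod, Sum.forall, Sum.elim_inl, Sum.elim_inr,
      Pi.zero_apply]
    tauto
  have hcont : Continuous fun p : (κ → ℝ) × (ι → ℝ) => F (torusPt R (Sum.elim p.2 p.1)) := by
    refine hF.comp (continuous_pi fun i => ?_)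
    rcases i with i | i
    · exact (continuous_apply i).comp continuous_snd
    · exact (continuous_apply i).comp continuous_fst
  rw [contour_def, ← h.setIntegral_preimage_emb (MeasurableEquiv.measurableEmbedding _), hpre]
  simp only [h0]
  rw [Measure.volume_eq_prod, ← setIntegral_prod_swap, setIntegral_prod]
  · simp only [contour_def, integral_const_mul, h1, Prod.swap]
    rw [Fintype.card_sum, pow_add, mul_inv, mul_assoc, mul_left_comm]
  · exact hcont.continuousOn.integrableOn_compact (isCompact_Icc.prod isCompact_Icc)

theorem contour_unique {ι : Type*} [hf : Fintype ι] [Unique ι] (R : ι → ℝ) (F : (ι → ℂ) → ℂ) :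
    contour R F = (2 * Real.pi : ℂ)⁻¹ *
      ∫ θ in Set.Icc (0 : ℝ) (2 * Real.pi), F fun _ => circleMap 0 (R default) θ := by
  obtain rfl : hf = Unique.fintype := Subsingleton.elim _ _
  have h := (volume_preserving_funUnique ι ℝ).symm
  rw [contour_def, Fintype.card_unique, pow_one,
    ← h.setIntegral_preimage_emb (MeasurableEquiv.measurableEmbedding _)]
  congr 1
  have h2 : (MeasurableEquiv.funUnique ι ℝ).symm ⁻¹'
      Set.Icc (0 : ι → ℝ) (fun _ => 2 * Real.pi) = Set.Icc (0 : ℝ) (2 * Real.pi) := by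
    ext φ
    simp [Set.mem_Icc, Pi.le_def]
  rw [h2]
  refine integral_congr_ae (Filter.Eventually.of_forall fun φ => ?_)
  refine congrArg F (funext fun i => ?_)
  rw [torusPt, Unique.eq_default i]
  rfl

/-- Cauchy's theorem on the annulus 1 ≤ |z| ≤ c for F(z)/z, since dθ = dz/(iz). -/
theorem contour_unique_eq {ι : Type*} [Fintype ι] [Unique ι] {c : ℝ} (hc : 1 ≤ c)
    {F : (ι → ℂ) → ℂ}
    (hF : ∀ z : ℂ, 1 ≤ ‖z‖ → ‖z‖ ≤ c → DifferentiableAt ℂ (fun z => F fun _ => z) z) :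
    contour (fun _ => c) F = contour (fun _ => 1) F := by
  have key : ∀ R : ℝ, 0 < R → (∮ z in C(0, R), (z - 0)⁻¹ • F fun _ => z) =
      Complex.I * ∫ θ in Set.Icc (0 : ℝ) (2 * Real.pi), F fun _ => circleMap 0 R θ := by
    intro R hR
    rw [circleIntegral, intervalIntegral.integral_of_le Real.two_pi_pos.le,
      ← integral_Icc_eq_integral_Ioc, ← integral_const_mul]
    refine integral_congr_ae (Filter.Eventually.of_forall fun θ => ?_)
    have h0 : circleMap 0 R θ ≠ 0 := circleMap_ne_center hR.ne'
    simp only [deriv_circleMap, smul_eq_mul, sub_zero]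
    field_simp
  have h1 := Complex.circleIntegral_sub_center_inv_smul_eq_of_differentiable_on_annulus_off_countable
    (c := 0) one_pos hc (f := fun z => F fun _ => z) Set.countable_empty (fun z hz => by
      simp only [Set.mem_sdiff, Metric.mem_closedBall, dist_zero_right, Metric.mem_ball, not_lt] at hz
      exact (hF z hz.2 hz.1).continuousAt.continuousWithinAt) (fun z hz => by
      simp only [Set.mem_sdiff, Metric.mem_closedBall, dist_zero_right, Metric.mem_ball, not_le] at hz
      exact hF z hz.1.2.le hz.1.1.le)
  rw [key c (one_pos.trans_le hc), key 1 one_pos] at h1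
  rw [contour_unique, contour_unique, mul_left_cancel₀ Complex.I_ne_zero h1]

/-- Deforming the contour of one variable. -/
theorem contour_deform {n : ℕ} (i : Fin n) {c : ℝ} (hc : 1 ≤ c) {F : (Fin n → ℂ) → ℂ}
    (hF1 : Continuous fun θ => F (torusPt (fun _ => 1) θ))
    (hFc : Continuous fun θ => F (torusPt (fun j => if j = i then c else 1) θ))
    (hF : ∀ x : Fin n → ℂ, (∀ j, j ≠ i → ‖x j‖ = 1) → 1 ≤ ‖x i‖ → ‖x i‖ ≤ c →
      DifferentiableAt ℂ (fun z => F (Function.update x i z)) (x i)) :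
    contour (fun _ => 1) F = contour (fun _ => 1) fun x => F (Function.update x i (c * x i)) := by
  classical
  -- Fubini isolates the i-th variable as the inner integral, where the one-variable deformation
  -- applies with the others fixed.
  set e := Equiv.sumCompl (fun j : Fin n => j = i) with he
  have hcomp : ∀ (R : Fin n → ℝ) (θ : {j // j = i} ⊕ {j // ¬ j = i} → ℝ),
      torusPt (R ∘ e) θ ∘ e.symm = torusPt R (θ ∘ e.symm) := fun R θ => by
    funext j
    simp [torusPt]
  have hcont : ∀ R : Fin n → ℝ, (Continuous fun θ => F (torusPt R θ)) →
      Continuous fun θ => (fun x => F (x ∘ e.symm)) (torusPt (R ∘ e) θ) := by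
    intro R h
    simp only [hcomp]
    exact h.comp (continuous_pi fun j => continuous_apply _)
  have h1 : contour (fun _ => 1) (fun x => F (Function.update x i (c * x i))) =
      contour (fun j => if j = i then c else 1) F := by
    simp only [contour_def]
    congr 1
    refine integral_congr_ae (Filter.Eventually.of_forall fun θ => ?_)
    refine congrArg F (funext fun j => ?_)
    by_cases h : j = i
    · subst h
      simp [torusPt, circleMap]
    · simp [torusPt, circleMap, h]
  rw [h1, contour_reindex e, contour_reindex e (fun j => if j = i then c else 1),
    contour_sumType _ (hcont _ hF1), contour_sumType _ (hcont _ hFc)]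
  have hinr : (((fun j => if j = i then c else 1) ∘ e) ∘ Sum.inr : {j // ¬ j = i} → ℝ) =
      ((fun _ => 1) ∘ e) ∘ Sum.inr := by
    funext j
    have : e (Sum.inr j) = j.1 := by simp [he]
    simp only [Function.comp, this, if_neg j.2]
  have hinl : (((fun j => if j = i then c else 1) ∘ e) ∘ Sum.inl : {j // j = i} → ℝ) =
      fun _ => c := by
    funext j
    have : e (Sum.inl j) = j.1 := by simp [he]
    simp only [Function.comp, this, if_pos j.2]
  rw [hinr, hinl]
  refine contour_congr fun θ => ?_
  set y := torusPt (((fun _ => 1) ∘ e) ∘ Sum.inr) θ with hy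
  refine (contour_unique_eq hc fun z hz1 hzc => ?_).symm
  set x : Fin n → ℂ := (Sum.elim (fun _ => z) y) ∘ e.symm with hx
  have hxi : x i = z := by
    simp [hx, he, Equiv.sumCompl_symm_apply_of_pos]
  have hxj : ∀ j, j ≠ i → ‖x j‖ = 1 := fun j hj => by
    have : x j = y ⟨j, hj⟩ := by
      simp [hx, he, Equiv.sumCompl_symm_apply_of_neg (p := fun j : Fin n => j = i) hj]
    rw [this, hy, norm_torusPt _ (by simp)]
    rfl
  have h3 := hF x hxj (hxi ▸ hz1) (hxi ▸ hzc)
  rw [hxi] at h3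
  refine h3.congr_of_eventuallyEq (Filter.Eventually.of_forall fun w => ?_)
  refine congrArg F (funext fun j => ?_)
  by_cases h : j = i
  · subst h
    simp [he, Equiv.sumCompl_symm_apply_of_pos]
  · simp [hx, he, h, Equiv.sumCompl_symm_apply_of_neg (p := fun j : Fin n => j = i) h]

end MacdonaldInt

end

/-! ### The torus scalar product and the action of the operator under it -/

noncomputable section

namespace MacdonaldInt

open MvPolynomial MeasureTheory

/-! ### The weight function on the torus -/

theorem differentiable_psEval {n : ℕ} (u : PowSum) :
    Differentiable ℂ fun x : Fin n → ℂ => psEval x u := by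
  induction u using MvPolynomial.induction_on with
  | C a =>
    simp only [psEval_C]
    exact differentiable_const _
  | add u v hu hv =>
    simp only [map_add]
    exact hu.add hv
  | mul_X u r hu =>
    simp only [map_mul, psEval_X]
    refine hu.mul ?_
    fun_prop

theorem continuous_psEval {n : ℕ} (u : PowSum) : Continuous fun x : Fin n → ℂ => psEval x u :=
  (differentiable_psEval u).continuous

theorem conj_psEval {n : ℕ} (x : Fin n → ℂ) (u : PowSum) :
    (starRingEnd ℂ) (psEval x u) = psEval (fun i => (starRingEnd ℂ) (x i)) u := by
  induction u using MvPolynomial.induction_on with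
  | C a => simp
  | add u v hu hv => rw [map_add, map_add, map_add, hu, hv]
  | mul_X u r hu => rw [map_mul, map_mul, map_mul, hu, psEval_X, psEval_X]; simp

/-- The function `(z;q)_∞ / (t z;q)_∞`. -/
def hFun (q t : ℝ) (z : ℂ) : ℂ := qPoch z q / qPoch (t * z) q

theorem kerDelta_eq (q t : ℝ) {n : ℕ} (x : Fin n → ℂ) : kerDelta q t x =
    ∏ p ∈ (Finset.univ : Finset (Fin n)).offDiag, hFun q t (x p.1 / x p.2) := rfl

theorem norm_mul_lt_one {t : ℝ} (ht0 : 0 < t) (ht1 : t < 1) {z : ℂ} (hz : ‖z‖ ≤ 1) :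
    ‖(t : ℂ) * z‖ < 1 := by
  rw [norm_mul, Complex.norm_real, Real.norm_of_nonneg ht0.le]
  exact (mul_le_of_le_one_right ht0.le hz).trans_lt ht1

theorem differentiableAt_hFun {q t : ℝ} (hq : q ∈ Set.Ioo (0 : ℝ) 1) (ht0 : 0 < t) (ht1 : t < 1)
    {z : ℂ} (hz : ‖z‖ ≤ 1) : DifferentiableAt ℂ (hFun q t) z := by
  refine DifferentiableAt.fun_div (differentiable_qPoch hq z) ?_
    (qPoch_ne_zero (norm_mul_lt_one ht0 ht1 hz) hq)
  exact ((differentiable_qPoch hq).comp (differentiable_id.const_mul (t : ℂ))) z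

theorem continuous_hFun_comp {q t : ℝ} (hq : q ∈ Set.Ioo (0 : ℝ) 1) (ht0 : 0 < t) (ht1 : t < 1)
    {X : Type*} [TopologicalSpace X] {f : X → ℂ} (hf : Continuous f) (h : ∀ x, ‖f x‖ ≤ 1) :
    Continuous fun x => hFun q t (f x) :=
  continuous_iff_continuousAt.2 fun x =>
    ContinuousAt.comp (f := f) (differentiableAt_hFun hq ht0 ht1 (h x)).continuousAt hf.continuousAt

/-- From (z;q)_∞ = (1 - z)(qz;q)_∞. With z = x_i/x_j the rational coefficient of the operator turns
a factor of Δ into its q-shift, and its pole disappears. -/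
theorem hFun_mul {q t : ℝ} (hq : q ∈ Set.Ioo (0 : ℝ) 1) (ht0 : 0 < t) (ht1 : t < 1) {z : ℂ}
    (hz : ‖z‖ ≤ 1) (hz1 : z ≠ 1) : (t * z - 1) / (z - 1) * hFun q t z = hFun q t (q * z) := by
  have h1 := qPoch_ne_zero (norm_mul_lt_one ht0 ht1 hz) hq
  have h2 := qPoch_eq_mul z hq
  have h3 := qPoch_eq_mul (t * z) hq
  rw [h3] at h1
  obtain ⟨h4, h5⟩ := mul_ne_zero_iff.1 h1
  rw [hFun, hFun, h2, h3, mul_comm (q : ℂ) z, ← mul_assoc (t : ℂ) z]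
  have h6 := sub_ne_zero.2 hz1
  field_simp
  ring

theorem conj_hFun {q t : ℝ} (hq : q ∈ Set.Ioo (0 : ℝ) 1) (z : ℂ) :
    (starRingEnd ℂ) (hFun q t z) = hFun q t ((starRingEnd ℂ) z) := by
  rw [hFun, map_div₀, conj_qPoch _ hq, conj_qPoch _ hq, map_mul, Complex.conj_ofReal, hFun]

theorem hFun_ne_zero {q t : ℝ} (hq : q ∈ Set.Ioo (0 : ℝ) 1) (ht0 : 0 < t) (ht1 : t < 1) {z : ℂ}
    (hz : ‖z‖ ≤ 1) (hz1 : z ≠ 1) : hFun q t z ≠ 0 := by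
  refine div_ne_zero ?_ (qPoch_ne_zero (norm_mul_lt_one ht0 ht1 hz) hq)
  rw [qPoch_eq_mul z hq]
  refine mul_ne_zero (sub_ne_zero.2 hz1.symm) (qPoch_ne_zero ?_ hq)
  rw [mul_comm]
  exact norm_mul_lt_one hq.1 hq.2 hz

theorem prod_offDiag_swap {n : ℕ} {M : Type*} [CommMonoid M] (f : Fin n × Fin n → M) :
    ∏ p ∈ (Finset.univ : Finset (Fin n)).offDiag, f p.swap =
      ∏ p ∈ (Finset.univ : Finset (Fin n)).offDiag, f p := by
  refine Finset.prod_nbij' Prod.swap Prod.swap ?_ ?_ ?_ ?_ ?_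
  all_goals simp [Finset.mem_offDiag, eq_comm]

theorem conj_div_of_norm_eq_one {z w : ℂ} (hz : ‖z‖ = 1) (hw : ‖w‖ = 1) :
    (starRingEnd ℂ) (z / w) = w / z := by
  rw [map_div₀, ← Complex.inv_eq_conj hz, ← Complex.inv_eq_conj hw, div_inv_eq_mul, mul_comm,
    div_eq_mul_inv]

theorem conj_kerDelta {q t : ℝ} (hq : q ∈ Set.Ioo (0 : ℝ) 1) {n : ℕ} {x : Fin n → ℂ}
    (hx : ∀ i, ‖x i‖ = 1) : (starRingEnd ℂ) (kerDelta q t x) = kerDelta q t x := by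
  rw [kerDelta_eq, map_prod, ← prod_offDiag_swap]
  refine Finset.prod_congr rfl fun p _ => ?_
  rw [conj_hFun hq, conj_div_of_norm_eq_one (hx _) (hx _)]
  rfl

theorem norm_torusPt_one {n : ℕ} (θ : Fin n → ℝ) (i : Fin n) :
    ‖torusPt (fun _ => 1) θ i‖ = 1 := norm_torusPt θ zero_le_one

theorem torusPt_ne_zero {n : ℕ} {R : Fin n → ℝ} (θ : Fin n → ℝ) {i : Fin n} (hR : 0 < R i) :
    torusPt R θ i ≠ 0 := circleMap_ne_center hR.ne'

theorem continuous_torusPt_apply {n : ℕ} (R : Fin n → ℝ) (i : Fin n) :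
    Continuous fun θ : Fin n → ℝ => torusPt R θ i := (continuous_apply i).comp (continuous_torusPt R)

theorem continuousOn_kerDelta {t : ℝ} (ht0 : 0 < t) (ht1 : t < 1) (n : ℕ) :
    ContinuousOn (fun p : ℝ × (Fin n → ℝ) => kerDelta p.1 t (torusPt (fun _ => 1) p.2))
      (Set.Ioo (0 : ℝ) 1 ×ˢ Set.univ) := by
  simp only [kerDelta]
  have hdiv : ∀ i j : Fin n, Continuous fun p : ℝ × (Fin n → ℝ) =>
      torusPt (fun _ => 1) p.2 i / torusPt (fun _ => 1) p.2 j := fun i j =>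
    Continuous.div ((continuous_torusPt_apply (fun _ => 1) i).comp continuous_snd)
      ((continuous_torusPt_apply (fun _ => 1) j).comp continuous_snd) fun p => torusPt_ne_zero _ one_pos
  refine continuousOn_finsetProd _ fun p _ => ContinuousOn.div ?_ ?_ ?_
  · exact continuousOn_qPoch_comp (hdiv _ _).continuousOn continuousOn_fst fun x hx => hx.1
  · exact continuousOn_qPoch_comp ((hdiv _ _).const_mul _).continuousOn continuousOn_fst
      fun x hx => hx.1
  · intro x hx
    refine qPoch_ne_zero (norm_mul_lt_one ht0 ht1 ?_) hx.1
    rw [norm_div, norm_torusPt_one, norm_torusPt_one, div_one]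

theorem continuous_kerDelta {q t : ℝ} (hq : q ∈ Set.Ioo (0 : ℝ) 1) (ht0 : 0 < t) (ht1 : t < 1)
    (n : ℕ) : Continuous fun θ : Fin n → ℝ => kerDelta q t (torusPt (fun _ => 1) θ) :=
  (continuousOn_kerDelta ht0 ht1 n).comp_continuous (f := fun θ => (q, θ)) (by fun_prop)
    fun θ => ⟨hq, Set.mem_univ _⟩

/-! ### The scalar product on the torus -/

/-- The integral of `u(1/x) v(x) Δ(x)`. -/
def torusInt (q t : ℝ) (n : ℕ) (u v : PowSum) : ℂ :=
  contour (fun _ : Fin n => (1 : ℝ)) fun x => psEval x⁻¹ u * psEval x v * kerDelta q t x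

theorem scalar'_toVars (q t : ℝ) (n : ℕ) (u v : PowSum) :
    scalar' q t (toVars n u) (toVars n v) = (n.factorial : ℂ)⁻¹ * torusInt q t n u v := by
  simp only [scalar', aeval_toVars]
  rfl

theorem continuous_inv_torusPt {n : ℕ} {R : Fin n → ℝ} (hR : ∀ i, 0 < R i) :
    Continuous fun θ : Fin n → ℝ => (torusPt R θ)⁻¹ :=
  continuous_pi fun i => Continuous.inv₀ (continuous_torusPt_apply R i)
    fun θ => torusPt_ne_zero θ (hR i)

theorem continuous_torusInt_integrand {q t : ℝ} (hq : q ∈ Set.Ioo (0 : ℝ) 1) (ht0 : 0 < t)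
    (ht1 : t < 1) {n : ℕ} (u v : PowSum) : Continuous fun θ : Fin n → ℝ =>
      (fun x : Fin n → ℂ => psEval x⁻¹ u * psEval x v * kerDelta q t x) (torusPt (fun _ => 1) θ) :=
  (((continuous_psEval u).comp (continuous_inv_torusPt fun _ => one_pos)).mul
    ((continuous_psEval v).comp (continuous_torusPt _))).mul (continuous_kerDelta hq ht0 ht1 n)

theorem torusInt_add_right {q t : ℝ} (hq : q ∈ Set.Ioo (0 : ℝ) 1) (ht0 : 0 < t)
    (ht1 : t < 1) {n : ℕ} (u v v' : PowSum) :
    torusInt q t n u (v + v') = torusInt q t n u v + torusInt q t n u v' := by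
  rw [torusInt, torusInt, torusInt, ← contour_add (continuous_torusInt_integrand hq ht0 ht1 u v)
    (continuous_torusInt_integrand hq ht0 ht1 u v')]
  refine contour_congr fun θ => ?_
  rw [map_add]
  ring

theorem torusInt_smul_right (q t : ℝ) {n : ℕ} (c : ℝ) (u v : PowSum) :
    torusInt q t n u (c • v) = c * torusInt q t n u v := by
  rw [torusInt, torusInt, ← contour_const_mul]
  refine contour_congr fun θ => ?_
  rw [map_smul, Complex.real_smul]
  ring

theorem inv_torusPt {n : ℕ} (θ : Fin n → ℝ) :
    (torusPt (fun _ => 1) θ)⁻¹ = fun i => (starRingEnd ℂ) (torusPt (fun _ => 1) θ i) :=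
  funext fun i => Complex.inv_eq_conj (norm_torusPt_one θ i)

/-- On the unit torus conjugation is inversion of the variables, Δ is real, and the coefficients are
real. -/
theorem conj_torusInt {q t : ℝ} (hq : q ∈ Set.Ioo (0 : ℝ) 1) {n : ℕ} (u v : PowSum) :
    (starRingEnd ℂ) (torusInt q t n u v) = torusInt q t n v u := by
  rw [torusInt, contour_conj, torusInt]
  refine contour_congr fun θ => ?_
  rw [map_mul, map_mul, conj_kerDelta hq (norm_torusPt_one θ), inv_torusPt, conj_psEval, conj_psEval]
  simp only [Complex.conj_conj]
  ring

theorem torusInt_add_left {q t : ℝ} (hq : q ∈ Set.Ioo (0 : ℝ) 1) (ht0 : 0 < t)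
    (ht1 : t < 1) {n : ℕ} (u u' v : PowSum) :
    torusInt q t n (u + u') v = torusInt q t n u v + torusInt q t n u' v := by
  rw [← conj_torusInt hq, torusInt_add_right hq ht0 ht1, map_add, conj_torusInt hq, conj_torusInt hq]

theorem torusInt_smul_left {q : ℝ} (hq : q ∈ Set.Ioo (0 : ℝ) 1) (t : ℝ) {n : ℕ} (c : ℝ)
    (u v : PowSum) : torusInt q t n (c • u) v = c * torusInt q t n u v := by
  rw [← conj_torusInt hq, torusInt_smul_right, map_mul, conj_torusInt hq, Complex.conj_ofReal]

/-- Identities with denominators x_i - x_j are proved at these points and extended by continuity.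
Coincidence of two coordinates means that a difference of angles lies in a countable set. -/
theorem dense_injective_torusPt (n : ℕ) :
    Dense {θ : Fin n → ℝ | Function.Injective (torusPt (fun _ => 1) θ)} := by
  have hexp : ∀ i j (θ : Fin n → ℝ), torusPt (fun _ => 1) θ i = torusPt (fun _ => 1) θ j ↔
      θ i - θ j ∈ Set.range fun k : ℤ => (k : ℝ) * (2 * Real.pi) := by
    intro i j θ
    simp only [torusPt, circleMap, zero_add, Complex.ofReal_one, one_mul, Complex.exp_eq_exp_iff_exists_int,
      Set.mem_range]
    refine exists_congr fun k => ?_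
    rw [← Complex.ofReal_inj]
    push_cast
    constructor
    · intro h
      have := mul_right_cancel₀ Complex.I_ne_zero
        (h.trans (by ring : _ = ((θ j : ℂ) + k * (2 * Real.pi)) * Complex.I))
      rw [this]; ring
    · intro h
      rw [show (θ i : ℂ) = θ j + k * (2 * Real.pi) by rw [h]; ring]
      ring
  have hset : {θ : Fin n → ℝ | Function.Injective (torusPt (fun _ => 1) θ)} =
      ⋂ p : {p : Fin n × Fin n // p.1 ≠ p.2},
        {θ | torusPt (fun _ => 1) θ p.1.1 ≠ torusPt (fun _ => 1) θ p.1.2} := by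
    ext θ
    simp only [Set.mem_iInter, Set.mem_ofPred_eq, Subtype.forall, Prod.forall]
    constructor
    · exact fun h a b hab he => hab (h he)
    · exact fun h a b he => by_contra fun hab => h a b hab he
  rw [hset]
  refine dense_iInter_of_isOpen (fun p => ?_) fun p => ?_
  · exact isOpen_ne_fun (continuous_torusPt_apply _ _) (continuous_torusPt_apply _ _)
  · have h1 : {θ | torusPt (fun _ => 1) θ p.1.1 ≠ torusPt (fun _ => 1) θ p.1.2} =
        (fun θ : Fin n → ℝ => θ p.1.1 - θ p.1.2) ⁻¹'
          (Set.range fun k : ℤ => (k : ℝ) * (2 * Real.pi))ᶜ := by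
      ext θ
      rw [Set.mem_preimage, Set.mem_compl_iff, ← hexp]
      rfl
    rw [h1]
    refine Dense.preimage ((Set.countable_range _).dense_compl ℝ) ?_
    let L : (Fin n → ℝ) →L[ℝ] ℝ :=
      ContinuousLinearMap.proj (R := ℝ) (φ := fun _ : Fin n => ℝ) p.1.1 -
        ContinuousLinearMap.proj (R := ℝ) (φ := fun _ : Fin n => ℝ) p.1.2
    refine L.isOpenMap fun y => ⟨Pi.single p.1.1 y, ?_⟩
    simp [L, Pi.single_eq_of_ne p.2.symm]

/-- The product of `∏_{j ≠ i} (t x_i - x_j) / (x_i - x_j)` and `Δ`, without its denominators. -/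
def shiftDelta (q t : ℝ) {n : ℕ} (i : Fin n) (x : Fin n → ℂ) : ℂ :=
  (∏ j ∈ Finset.univ.erase i, hFun q t (q * (x i / x j)) * hFun q t (x j / x i)) *
    ∏ p ∈ (Finset.univ : Finset (Fin n)).offDiag,
      if p.1 ≠ i ∧ p.2 ≠ i then hFun q t (x p.1 / x p.2) else 1

theorem prod_offDiag_snd {n : ℕ} {M : Type*} [CommMonoid M] (i : Fin n) (f : Fin n → M) :
    ∏ p ∈ (Finset.univ : Finset (Fin n)).offDiag, (if p.2 = i then f p.1 else 1) =
      ∏ j ∈ Finset.univ.erase i, f j := by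
  rw [← prod_offDiag_fst, ← prod_offDiag_swap]
  rfl

theorem prod_mul_kerDelta {q t : ℝ} (hq : q ∈ Set.Ioo (0 : ℝ) 1) (ht0 : 0 < t) (ht1 : t < 1)
    {n : ℕ} {x : Fin n → ℂ} (hx : ∀ i, ‖x i‖ = 1) (hinj : Function.Injective x) (i : Fin n) :
    (∏ j ∈ Finset.univ.erase i, (t * x i - x j) / (x i - x j)) * kerDelta q t x =
      shiftDelta q t i x := by
  classical
  have h1 : kerDelta q t x = ((∏ j ∈ Finset.univ.erase i, hFun q t (x i / x j)) *
      ∏ j ∈ Finset.univ.erase i, hFun q t (x j / x i)) *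
      ∏ p ∈ (Finset.univ : Finset (Fin n)).offDiag,
        if p.1 ≠ i ∧ p.2 ≠ i then hFun q t (x p.1 / x p.2) else 1 := by
    rw [kerDelta_eq, ← prod_offDiag_fst i fun j => hFun q t (x i / x j),
      ← prod_offDiag_snd i fun j => hFun q t (x j / x i), ← Finset.prod_mul_distrib,
      ← Finset.prod_mul_distrib]
    refine Finset.prod_congr rfl fun p hp => ?_
    have hne := (Finset.mem_offDiag.1 hp).2.2
    by_cases ha : p.1 = i
    · have hb : p.2 ≠ i := fun hb => hne (ha.trans hb.symm)
      simp [ha, hb]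
    · by_cases hb : p.2 = i <;> simp [ha, hb]
  rw [h1, shiftDelta, ← mul_assoc, ← mul_assoc, ← Finset.prod_mul_distrib, ← Finset.prod_mul_distrib]
  congr 1
  refine Finset.prod_congr rfl fun j hj => ?_
  have hne : x i ≠ x j := fun h => (Finset.ne_of_mem_erase hj) (hinj h).symm
  have h0 : x j ≠ 0 := fun h => by simpa [h] using hx j
  rw [← hFun_mul hq ht0 ht1 (z := x i / x j) (by rw [norm_div, hx, hx, div_one])
    fun h => hne ((div_eq_one_iff_eq h0).1 h)]
  congr 2
  have h2 := sub_ne_zero.2 hne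
  have h3 : x i / x j - 1 ≠ 0 := by
    rw [div_sub_one h0]
    exact div_ne_zero h2 h0
  rw [div_eq_div_iff h2 h3]
  field_simp

/-- The factor at q x_i/x_j requires |x_i| ≤ 1/q and the factor at x_j/x_i requires |x_i| ≥ 1. So
exactly the annulus needed for the contour shift is free of poles. -/
theorem continuous_shiftDelta {q t : ℝ} (hq : q ∈ Set.Ioo (0 : ℝ) 1) (ht0 : 0 < t) (ht1 : t < 1)
    {n : ℕ} (i : Fin n) {R : Fin n → ℝ} (hR : ∀ j, j ≠ i → R j = 1) (h1 : 1 ≤ R i)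
    (h2 : q * R i ≤ 1) : Continuous fun θ : Fin n → ℝ => shiftDelta q t i (torusPt R θ) := by
  have hR0 : ∀ j, 0 < R j := fun j => by
    by_cases h : j = i
    · rw [h]; exact one_pos.trans_le h1
    · rw [hR j h]; exact one_pos
  have hdiv : ∀ a b : Fin n, Continuous fun θ : Fin n → ℝ => torusPt R θ a / torusPt R θ b :=
    fun a b => (continuous_torusPt_apply _ a).div (continuous_torusPt_apply _ b) fun θ => torusPt_ne_zero θ (hR0 b)
  refine (continuous_finsetProd _ fun j hj => ?_).mul (continuous_finsetProd _ fun p _ => ?_)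
  · have hj := Finset.ne_of_mem_erase hj
    refine (continuous_hFun_comp hq ht0 ht1 ((hdiv _ _).const_mul _) fun θ => ?_).mul
      (continuous_hFun_comp hq ht0 ht1 (hdiv _ _) fun θ => ?_)
    · rw [norm_mul, norm_div, norm_torusPt θ (hR0 _).le, norm_torusPt θ (hR0 _).le, hR j hj, div_one,
        Complex.norm_real, Real.norm_of_nonneg hq.1.le]
      exact h2
    · rw [norm_div, norm_torusPt θ (hR0 _).le, norm_torusPt θ (hR0 _).le, hR j hj]
      exact div_le_one_of_le₀ h1 (hR0 i).le
  · split_ifs with h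
    · refine continuous_hFun_comp hq ht0 ht1 (hdiv _ _) fun θ => ?_
      rw [norm_div, norm_torusPt θ (hR0 _).le, norm_torusPt θ (hR0 _).le, hR _ h.1, hR _ h.2, div_one]
    · exact continuous_const

theorem psEval_macOp_mul_kerDelta {q t : ℝ} (hq : q ∈ Set.Ioo (0 : ℝ) 1) (ht0 : 0 < t)
    (ht1 : t < 1) {n : ℕ} (v : PowSum) (θ : Fin n → ℝ) :
    (t : ℂ) ^ n * (psEval (torusPt (fun _ => 1) θ) (macOp q t v) *
      kerDelta q t (torusPt (fun _ => 1) θ)) =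
    psEval (torusPt (fun _ => 1) θ) v * kerDelta q t (torusPt (fun _ => 1) θ) + (t - 1) *
      ∑ i, psEval (Function.update (torusPt (fun _ => 1) θ) i (q * torusPt (fun _ => 1) θ i)) v *
        shiftDelta q t i (torusPt (fun _ => 1) θ) := by
  have hT : Continuous fun θ : Fin n → ℝ => torusPt (fun _ => 1) θ := continuous_torusPt _
  have hΔ := continuous_kerDelta hq ht0 ht1 n
  have hl : Continuous fun θ : Fin n → ℝ => (t : ℂ) ^ n * (psEval (torusPt (fun _ => 1) θ)
      (macOp q t v) * kerDelta q t (torusPt (fun _ => 1) θ)) :=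
    (((continuous_psEval _).comp hT).mul hΔ).const_mul _
  have hr : Continuous fun θ : Fin n → ℝ => psEval (torusPt (fun _ => 1) θ) v *
      kerDelta q t (torusPt (fun _ => 1) θ) + ((t : ℂ) - 1) *
      ∑ i, psEval (Function.update (torusPt (fun _ => 1) θ) i (q * torusPt (fun _ => 1) θ i)) v *
        shiftDelta q t i (torusPt (fun _ => 1) θ) := by
    refine (((continuous_psEval _).comp hT).mul hΔ).add
      ((continuous_finsetSum _ fun i _ => ?_).const_mul _)
    refine Continuous.mul ((continuous_psEval v).comp (hT.update i
      ((continuous_torusPt_apply _ i).const_mul _))) ?_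
    exact continuous_shiftDelta hq ht0 ht1 i (fun _ _ => rfl) le_rfl (by simpa using hq.2.le)
  -- After multiplication by Δ both sides are continuous on the whole torus, so distinct coordinates
  -- may be assumed.
  refine congrFun (Continuous.ext_on (dense_injective_torusPt n) hl hr fun θ hθ => ?_) θ
  have hn := norm_torusPt_one θ
  set x := torusPt (fun _ => 1) θ with hx
  have hθ : Function.Injective x := hθ
  have h := psEval_macOp q ht0.ne' hθ (fun i => torusPt_ne_zero θ one_pos) v
  simp only [Complex.coe_algebraMap] at h
  rw [← mul_assoc, h, add_mul, mul_assoc, Finset.sum_mul]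
  congr 2
  refine Finset.sum_congr rfl fun i _ => ?_
  rw [← prod_mul_kerDelta hq ht0 ht1 hn hθ]
  ring

/-- The integral of `u(1/x) v(T_i x)` times the weight of the operator. -/
def shiftInt (q t : ℝ) {n : ℕ} (i : Fin n) (u v : PowSum) : ℂ :=
  contour (fun _ : Fin n => (1 : ℝ)) fun x =>
    psEval x⁻¹ u * psEval (Function.update x i (q * x i)) v * shiftDelta q t i x

theorem continuous_shiftInt_integrand {q t : ℝ} (hq : q ∈ Set.Ioo (0 : ℝ) 1) (ht0 : 0 < t)
    (ht1 : t < 1) {n : ℕ} (i : Fin n) (u v : PowSum) {R : Fin n → ℝ} (hR : ∀ j, j ≠ i → R j = 1)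
    (h1 : 1 ≤ R i) (h2 : q * R i ≤ 1) : Continuous fun θ : Fin n → ℝ =>
      (fun x : Fin n → ℂ => psEval x⁻¹ u * psEval (Function.update x i (q * x i)) v * shiftDelta q t i x)
        (torusPt R θ) := by
  have hR0 : ∀ j, 0 < R j := fun j => by
    by_cases h : j = i
    · rw [h]; exact one_pos.trans_le h1
    · rw [hR j h]; exact one_pos
  refine Continuous.mul (((continuous_psEval u).comp (continuous_inv_torusPt hR0)).mul
    ((continuous_psEval v).comp ((continuous_torusPt R).update i
      ((continuous_torusPt_apply R i).const_mul _))))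
    (continuous_shiftDelta hq ht0 ht1 i hR h1 h2)

theorem pow_mul_torusInt_macOp {q t : ℝ} (hq : q ∈ Set.Ioo (0 : ℝ) 1) (ht0 : 0 < t)
    (ht1 : t < 1) {n : ℕ} (u v : PowSum) : (t : ℂ) ^ n * torusInt q t n u (macOp q t v) =
      torusInt q t n u v + (t - 1) * ∑ i : Fin n, shiftInt q t i u v := by
  have hs : ∀ i : Fin n, Continuous fun θ : Fin n → ℝ =>
      (fun x : Fin n → ℂ => psEval x⁻¹ u * psEval (Function.update x i (q * x i)) v * shiftDelta q t i x)
        (torusPt (fun _ => 1) θ) := fun i =>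
    continuous_shiftInt_integrand hq ht0 ht1 i u v (fun _ _ => rfl) le_rfl (by simpa using hq.2.le)
  simp only [shiftInt]
  rw [torusInt, ← contour_const_mul, torusInt, ← contour_sum _ fun i _ => hs i,
    ← contour_const_mul, ← contour_add (continuous_torusInt_integrand hq ht0 ht1 u v)
      ((continuous_finsetSum _ fun i _ => hs i).const_mul _)]
  refine contour_congr fun θ => ?_
  have h := psEval_macOp_mul_kerDelta hq ht0 ht1 v θ
  rw [mul_assoc (psEval (torusPt (fun _ => 1) θ)⁻¹ u), mul_left_comm, h, mul_add, ← mul_assoc,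
    mul_left_comm, Finset.mul_sum]
  congr 2
  exact Finset.sum_congr rfl fun i _ => by ring

end MacdonaldInt

end

/-! ### Self-adjointness on the torus by a contour shift, and positivity -/

noncomputable section

namespace MacdonaldInt

open MvPolynomial MeasureTheory

theorem inv_update {n : ℕ} (x : Fin n → ℂ) (i : Fin n) (z : ℂ) :
    (Function.update x i z)⁻¹ = Function.update x⁻¹ i z⁻¹ := by
  funext j
  by_cases h : j = i
  · subst h; simp
  · simp [h]

theorem differentiableAt_update {n : ℕ} (x : Fin n → ℂ) (i : Fin n) {f : ℂ → ℂ} {z : ℂ}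
    (hf : DifferentiableAt ℂ f z) : DifferentiableAt ℂ (fun w => Function.update x i (f w)) z := by
  refine differentiableAt_pi.2 fun j => ?_
  by_cases h : j = i
  · subst h; simpa using hf
  · simp [h]

theorem differentiableAt_shiftDelta {q t : ℝ} (hq : q ∈ Set.Ioo (0 : ℝ) 1) (ht0 : 0 < t)
    (ht1 : t < 1) {n : ℕ} (i : Fin n) {x : Fin n → ℂ} (hx : ∀ j, j ≠ i → ‖x j‖ = 1)
    (h1 : 1 ≤ ‖x i‖) (h2 : q * ‖x i‖ ≤ 1) :
    DifferentiableAt ℂ (fun z => shiftDelta q t i (Function.update x i z)) (x i) := by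
  have hi0 : x i ≠ 0 := fun h => by rw [h, norm_zero] at h1; linarith
  refine DifferentiableAt.fun_mul (DifferentiableAt.fun_finsetProd fun j hj => ?_)
    (DifferentiableAt.fun_finsetProd fun p _ => ?_)
  · have hj := Finset.ne_of_mem_erase hj
    simp only [Function.update_self, Function.update_of_ne hj]
    have hj0 : x j ≠ 0 := fun h => by simpa [h] using hx j hj
    refine DifferentiableAt.fun_mul ?_ ?_
    · refine DifferentiableAt.fun_comp' (x i) (differentiableAt_hFun hq ht0 ht1 ?_)
        (by fun_prop (disch := assumption))
      rw [norm_mul, norm_div, hx j hj, div_one, Complex.norm_real, Real.norm_of_nonneg hq.1.le]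
      exact h2
    · refine DifferentiableAt.fun_comp' (x i) (differentiableAt_hFun hq ht0 ht1 ?_)
        (by fun_prop (disch := assumption))
      rw [norm_div, hx j hj]
      exact div_le_one_of_le₀ h1 (norm_nonneg _)
  · split_ifs with h
    · simp [Function.update_of_ne h.1, Function.update_of_ne h.2]
    · exact differentiableAt_const _

/-- Conjugation inverts the ratios: h(q x_i/x_j) h(x_j/x_i) becomes h(q x_j/x_i) h(x_i/x_j), and
this is the original expression at x_i/q with its two factors exchanged. -/
theorem conj_shiftDelta {q t : ℝ} (hq : q ∈ Set.Ioo (0 : ℝ) 1) {n : ℕ} (i : Fin n)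
    {x : Fin n → ℂ} (hn : ∀ j, ‖x j‖ = 1) : (starRingEnd ℂ) (shiftDelta q t i x) =
      shiftDelta q t i (Function.update x i ((q⁻¹ : ℝ) * x i)) := by
  classical
  have hq0 : (q : ℂ) ≠ 0 := by exact_mod_cast hq.1.ne'
  rw [shiftDelta, shiftDelta, map_mul, map_prod, map_prod]
  refine congrArg₂ _ ?_ ?_
  · refine Finset.prod_congr rfl fun j hj => ?_
    have hj := Finset.ne_of_mem_erase hj
    have hx0 : x i ≠ 0 := fun h => by simpa [h] using hn i
    rw [map_mul, conj_hFun hq, conj_hFun hq, map_mul, conj_div_of_norm_eq_one (hn _) (hn _),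
      conj_div_of_norm_eq_one (hn _) (hn _), Complex.conj_ofReal, Function.update_self,
      Function.update_of_ne hj, mul_comm, Complex.ofReal_inv]
    refine congrArg₂ (fun a b => hFun q t a * hFun q t b) ?_ ?_
    · rw [mul_div_assoc, mul_inv_cancel_left₀ hq0]
    · rw [div_mul_eq_div_div, div_inv_eq_mul, mul_comm (x j), mul_div_assoc]
  · rw [← prod_offDiag_swap]
    refine Finset.prod_congr rfl fun p _ => ?_
    by_cases h : p.1 ≠ i ∧ p.2 ≠ i
    · rw [if_pos h, if_pos (show p.swap.1 ≠ i ∧ p.swap.2 ≠ i from ⟨h.2, h.1⟩), conj_hFun hq,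
        conj_div_of_norm_eq_one (hn _) (hn _), Function.update_of_ne h.1,
        Function.update_of_ne h.2]
      rfl
    · rw [if_neg h, if_neg (show ¬ (p.swap.1 ≠ i ∧ p.swap.2 ≠ i) from fun h' => h ⟨h'.2, h'.1⟩),
        map_one]

theorem differentiableAt_shiftInt_integrand {q t : ℝ} (hq : q ∈ Set.Ioo (0 : ℝ) 1) (ht0 : 0 < t)
    (ht1 : t < 1) {n : ℕ} (i : Fin n) (u v : PowSum) {x : Fin n → ℂ}
    (hx : ∀ j, j ≠ i → ‖x j‖ = 1) (h1 : 1 ≤ ‖x i‖) (h2 : q * ‖x i‖ ≤ 1) :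
    DifferentiableAt ℂ (fun z => (fun x : Fin n → ℂ =>
      psEval x⁻¹ u * psEval (Function.update x i (q * x i)) v * shiftDelta q t i x)
        (Function.update x i z)) (x i) := by
  have hi0 : x i ≠ 0 := fun h => by rw [h, norm_zero] at h1; linarith
  have ha : DifferentiableAt ℂ (fun z => psEval (Function.update x i z)⁻¹ u) (x i) := by
    simp only [inv_update]
    exact DifferentiableAt.comp (x i) (f := fun z => Function.update x⁻¹ i z⁻¹)
      (g := fun y : Fin n → ℂ => psEval y u) (differentiable_psEval u).differentiableAt
      (differentiableAt_update x⁻¹ i (differentiableAt_inv hi0))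
  have hb : DifferentiableAt ℂ (fun z => psEval (Function.update (Function.update x i z) i
      (q * Function.update x i z i)) v) (x i) := by
    simp only [Function.update_self, Function.update_idem]
    exact DifferentiableAt.comp (x i) (f := fun z => Function.update x i (q * z))
      (g := fun y : Fin n → ℂ => psEval y v) (differentiable_psEval v).differentiableAt
      (differentiableAt_update x i (by fun_prop))
  exact (ha.fun_mul hb).fun_mul (differentiableAt_shiftDelta hq ht0 ht1 i hx h1 h2)

/-- The circle |x_i| = 1 is moved to |x_i| = 1/q and parametrized by x_i ↦ x_i/q. This removes the
shift from v and applies the inverse shift to the variables of u. -/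
theorem shiftInt_eq_contour_update {q t : ℝ} (hq : q ∈ Set.Ioo (0 : ℝ) 1) (ht0 : 0 < t)
    (ht1 : t < 1) {n : ℕ} (i : Fin n) (u v : PowSum) :
    shiftInt q t i u v = contour (fun _ => 1) fun x : Fin n → ℂ =>
      psEval (Function.update x i ((q⁻¹ : ℝ) * x i))⁻¹ u * psEval x v *
        shiftDelta q t i (Function.update x i ((q⁻¹ : ℝ) * x i)) := by
  have hq0 : (q : ℂ) ≠ 0 := by exact_mod_cast hq.1.ne'
  have hqi : 1 ≤ q⁻¹ := (one_le_inv₀ hq.1).2 hq.2.le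
  have hqq : q * q⁻¹ = 1 := mul_inv_cancel₀ hq.1.ne'
  have key := contour_deform i hqi (F := fun x : Fin n → ℂ =>
      psEval x⁻¹ u * psEval (Function.update x i (q * x i)) v * shiftDelta q t i x)
    (continuous_shiftInt_integrand hq ht0 ht1 i u v (fun _ _ => rfl) le_rfl (by simpa using hq.2.le))
    (continuous_shiftInt_integrand hq ht0 ht1 i u v (fun j hj => if_neg hj) (by simpa using hqi)
      (by simp [hq.1.ne']))
    fun x hx h1 hc => differentiableAt_shiftInt_integrand hq ht0 ht1 i u v hx h1
      ((mul_le_mul_of_nonneg_left hc hq.1.le).trans_eq hqq)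
  rw [shiftInt]
  refine key.trans (contour_congr fun θ => ?_)
  rw [Function.update_idem, Function.update_self]
  have h2 (y : Fin n → ℂ) : Function.update y i (q * ((q⁻¹ : ℝ) * y i)) = y := by
    rw [Complex.ofReal_inv, mul_inv_cancel_left₀ hq0, Function.update_eq_self]
  rw [h2]

/-- After the contour shift the integrand is pointwise the complex conjugate of the unshifted one
with u and v exchanged. -/
theorem conj_shiftInt {q t : ℝ} (hq : q ∈ Set.Ioo (0 : ℝ) 1) (ht0 : 0 < t) (ht1 : t < 1) {n : ℕ}
    (i : Fin n) (u v : PowSum) : (starRingEnd ℂ) (shiftInt q t i v u) = shiftInt q t i u v := by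
  rw [shiftInt_eq_contour_update hq ht0 ht1 i u v, shiftInt, contour_conj]
  refine contour_congr fun θ => ?_
  have hΔ := conj_shiftDelta (t := t) hq i (norm_torusPt_one θ)
  have hinv := inv_torusPt θ
  generalize torusPt (fun _ => 1) θ = x at *
  have h1 : psEval (Function.update x i ((q⁻¹ : ℝ) * x i))⁻¹ u =
      (starRingEnd ℂ) (psEval (Function.update x i (q * x i)) u) := by
    rw [conj_psEval, inv_update, hinv]
    refine congrArg (fun y => psEval y u) (funext fun j => ?_)
    by_cases h : j = i
    · subst h
      have := congrFun hinv j
      simp only [Pi.inv_apply] at this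
      simp [this, mul_comm]
    · simp [h]
  rw [map_mul, map_mul, hΔ, h1, hinv, conj_psEval]
  simp only [Complex.conj_conj]
  ring

/-- The action on the left argument is the conjugate of the action on the right one, and each
shifted integral is symmetric in this sense by `conj_shiftInt`. -/
theorem torusInt_macOp {q t : ℝ} (hq : q ∈ Set.Ioo (0 : ℝ) 1) (ht0 : 0 < t) (ht1 : t < 1) {n : ℕ}
    (u v : PowSum) : torusInt q t n (macOp q t u) v = torusInt q t n u (macOp q t v) := by
  have ht : (t : ℂ) ^ n ≠ 0 := pow_ne_zero _ (by exact_mod_cast ht0.ne')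
  refine mul_left_cancel₀ ht ?_
  rw [pow_mul_torusInt_macOp hq ht0 ht1, ← conj_torusInt hq,
    ← Complex.conj_ofReal t, ← map_pow, ← map_mul, pow_mul_torusInt_macOp hq ht0 ht1, map_add,
    map_mul, map_sum, conj_torusInt hq, map_sub, map_one, Complex.conj_ofReal]
  simp only [conj_shiftInt hq ht0 ht1]

open Classical in
/-- `torusInt` as a bilinear form. -/
def torusForm (t : ℝ) (n : ℕ) (q : ℝ) : PowSum →ₗ[ℝ] PowSum →ₗ[ℝ] ℂ :=
  if h : q ∈ Set.Ioo (0 : ℝ) 1 ∧ 0 < t ∧ t < 1 then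
    LinearMap.mk₂ ℝ (torusInt q t n) (torusInt_add_left h.1 h.2.1 h.2.2)
      (fun c u v => by rw [torusInt_smul_left h.1, Complex.real_smul])
      (torusInt_add_right h.1 h.2.1 h.2.2)
      (fun c u v => by rw [torusInt_smul_right, Complex.real_smul])
  else 0

theorem torusForm_apply {q t : ℝ} (hq : q ∈ Set.Ioo (0 : ℝ) 1) (ht0 : 0 < t) (ht1 : t < 1) {n : ℕ}
    (u v : PowSum) : torusForm t n q u v = torusInt q t n u v := by
  rw [torusForm, dif_pos ⟨hq, ht0, ht1⟩]
  rfl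

theorem continuousOn_torusInt {t : ℝ} (ht0 : 0 < t) (ht1 : t < 1) (n : ℕ) (u v : PowSum) :
    ContinuousOn (fun q => torusInt q t n u v) (Set.Ioo 0 1) := by
  rw [continuousOn_iff_continuous_domRestrict]
  have : LocallyCompactSpace (Set.Ioo (0 : ℝ) 1) := isOpen_Ioo.locallyCompactSpace
  refine continuous_const.mul (continuous_parametric_integral_of_continuous
    (f := fun (q : Set.Ioo (0 : ℝ) 1) (θ : Fin n → ℝ) => psEval (torusPt (fun _ => 1) θ)⁻¹ u *
      psEval (torusPt (fun _ => 1) θ) v * kerDelta q t (torusPt (fun _ => 1) θ)) ?_ isCompact_Icc)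
  refine Continuous.mul ((((continuous_psEval u).comp (continuous_inv_torusPt fun _ => one_pos)).mul
    ((continuous_psEval v).comp (continuous_torusPt _))).comp continuous_snd) ?_
  exact (continuousOn_kerDelta ht0 ht1 n).comp_continuous
    (f := fun p : Set.Ioo (0 : ℝ) 1 × (Fin n → ℝ) => ((p.1 : ℝ), p.2)) (by fun_prop)
    fun p => ⟨p.1.2, Set.mem_univ _⟩

theorem torusInt_eigP_eq_zero {q t : ℝ} (hq : q ∈ Set.Ioo (0 : ℝ) 1) (ht0 : 0 < t) (ht1 : t < 1)
    (n : ℕ) {lam mu : Ptn} (h : lam ≠ mu) : torusInt q t n (eigP q t lam) (eigP q t mu) = 0 := by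
  rw [← torusForm_apply hq ht0 ht1]
  refine form_eigP_eq_zero ht0 ht1 (fun a b => ?_) (fun p hp a b => ?_) h hq
  · exact (continuousOn_torusInt ht0 ht1 n a b).congr fun p hp => torusForm_apply hp ht0 ht1 a b
  · rw [torusForm_apply hp ht0 ht1, torusForm_apply hp ht0 ht1, torusInt_macOp hp ht0 ht1]

/-! ### Positivity -/

/-- On the unit torus the factors for (i,j) and (j,i) are complex conjugates. -/
theorem kerDelta_eq_normSq {q t : ℝ} (hq : q ∈ Set.Ioo (0 : ℝ) 1) {n : ℕ} {x : Fin n → ℂ}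
    (hx : ∀ i, ‖x i‖ = 1) : kerDelta q t x = (Complex.normSq
      (∏ p ∈ (Finset.univ : Finset (Fin n)).offDiag,
        if p.1 < p.2 then hFun q t (x p.1 / x p.2) else 1) : ℂ) := by
  rw [Complex.normSq_eq_conj_mul_self, map_prod, ← prod_offDiag_swap, ← Finset.prod_mul_distrib,
    kerDelta_eq]
  refine Finset.prod_congr rfl fun p hp => ?_
  have hne := (Finset.mem_offDiag.1 hp).2.2
  rcases lt_or_gt_of_ne hne with h | h
  · rw [if_pos h, if_neg (show ¬ p.swap.1 < p.swap.2 from h.not_gt), map_one, one_mul]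
  · rw [if_neg h.not_gt, if_pos (show p.swap.1 < p.swap.2 from h), mul_one, conj_hFun hq,
      conj_div_of_norm_eq_one (hx _) (hx _)]
    rfl

theorem kerDelta_ne_zero {q t : ℝ} (hq : q ∈ Set.Ioo (0 : ℝ) 1) (ht0 : 0 < t) (ht1 : t < 1) {n : ℕ}
    {x : Fin n → ℂ} (hx : ∀ i, ‖x i‖ = 1) (hinj : Function.Injective x) : kerDelta q t x ≠ 0 := by
  rw [kerDelta_eq]
  refine Finset.prod_ne_zero_iff.2 fun p hp => ?_
  have h0 : x p.2 ≠ 0 := fun h => by simpa [h] using hx p.2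
  exact hFun_ne_zero hq ht0 ht1 (by rw [norm_div, hx, hx, div_one])
    fun h => (Finset.mem_offDiag.1 hp).2.2 (hinj ((div_eq_one_iff_eq h0).1 h))

theorem toVars_eq_zero_of_psEval {n : ℕ} {u : PowSum}
    (h : ∀ θ ∈ Set.pi Set.univ fun _ : Fin n => Set.Ioo (0 : ℝ) (2 * Real.pi),
      Function.Injective (torusPt (fun _ => 1) θ) → psEval (torusPt (fun _ => 1) θ) u = 0) :
    toVars n u = 0 := by
  set S : Set ℂ := circleMap 0 1 '' Set.Ioo (0 : ℝ) (2 * Real.pi) with hS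
  have hSinf : S.Infinite := by
    refine Set.Infinite.image ?_ (Set.Ioo_infinite Real.two_pi_pos)
    exact (injOn_circleMap_of_abs_sub_le (c := 0) one_ne_zero
      (a := 0) (b := 2 * Real.pi) (by simp [abs_of_pos Real.pi_pos])).mono fun x hx => by
        rw [Set.uIoc_of_le Real.two_pi_pos.le]
        exact ⟨hx.1, hx.2.le⟩
  -- The discriminant takes care of the points with coinciding coordinates. The product then
  -- vanishes on a Cartesian power of an infinite set, hence identically.
  have h1 : map (algebraMap ℝ ℂ) (toVars n u * discr n) = 0 := by
    refine funext_set (fun _ => S) (fun _ => hSinf) fun x hx => ?_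
    choose θ hθ hθx using fun i => hx i (Set.mem_univ i)
    have hxθ : x = torusPt (fun _ => 1) θ := funext fun i => (hθx i).symm
    rw [map_zero, eval_map, ← aeval_def, map_mul]
    by_cases hinj : Function.Injective x
    · rw [aeval_toVars, hxθ, h θ (fun i _ => hθ i) (hxθ ▸ hinj), zero_mul]
    · obtain ⟨i, j, hij, hne⟩ : ∃ i j, x i = x j ∧ i ≠ j := by
        by_contra hcon
        push Not at hcon
        exact hinj fun i j hij => hcon i j hij
      rw [discr, map_prod, Finset.prod_eq_zero (i := (i, j)), mul_zero]
      · simp [hne]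
      · simp [hij]
  have h2 := (map_injective (algebraMap ℝ ℂ) Complex.ofReal_injective)
    (h1.trans (map_zero (map (algebraMap ℝ ℂ))).symm)
  exact (mul_eq_zero.1 h2).resolve_right (discr_ne_zero n)

/-- The integrand is continuous and nonnegative, so a zero integral makes it vanish on the open cube
of angles. There Δ is nonzero at points with distinct coordinates, which forces u to vanish at them.
-/
theorem torusInt_self_ne_zero {q t : ℝ} (hq : q ∈ Set.Ioo (0 : ℝ) 1) (ht0 : 0 < t) (ht1 : t < 1)
    {n : ℕ} {u : PowSum} (hu : toVars n u ≠ 0) : torusInt q t n u u ≠ 0 := by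
  intro h0
  refine hu (toVars_eq_zero_of_psEval fun θ hθ hinj => ?_)
  obtain ⟨g, hg0, hgeq⟩ : ∃ g : (Fin n → ℝ) → ℝ, (∀ θ, 0 ≤ g θ) ∧
      ∀ θ, psEval (torusPt (fun _ => 1) θ)⁻¹ u * psEval (torusPt (fun _ => 1) θ) u *
        kerDelta q t (torusPt (fun _ => 1) θ) = (g θ : ℂ) := by
    refine ⟨fun θ => Complex.normSq (psEval (torusPt (fun _ => 1) θ) u *
      ∏ p ∈ (Finset.univ : Finset (Fin n)).offDiag, if p.1 < p.2 then
        hFun q t (torusPt (fun _ => 1) θ p.1 / torusPt (fun _ => 1) θ p.2) else 1),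
      fun θ => Complex.normSq_nonneg _, fun θ => ?_⟩
    rw [kerDelta_eq_normSq hq (norm_torusPt_one θ), inv_torusPt, ← conj_psEval,
      ← Complex.normSq_eq_conj_mul_self, ← Complex.ofReal_mul, ← Complex.normSq_mul]
  have hgc : Continuous g := by
    have h1 := Complex.continuous_re.comp (continuous_torusInt_integrand hq ht0 ht1 (n := n) u u)
    refine h1.congr fun θ => ?_
    simp only [Function.comp]
    rw [hgeq, Complex.ofReal_re]
  have hint : ∫ θ in Set.Icc (0 : Fin n → ℝ) (fun _ => 2 * Real.pi), g θ = 0 := by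
    rw [torusInt, contour_def] at h0
    simp only [hgeq] at h0
    rw [integral_complex_ofReal, mul_eq_zero, inv_eq_zero] at h0
    have h2 : ((2 * Real.pi : ℂ) ^ Fintype.card (Fin n)) ≠ 0 :=
      pow_ne_zero _ (by exact_mod_cast Real.two_pi_pos.ne')
    exact_mod_cast h0.resolve_left h2
  rw [setIntegral_eq_zero_iff_of_nonneg_ae (Filter.Eventually.of_forall hg0)
    (hgc.continuousOn.integrableOn_compact isCompact_Icc)] at hint
  have hsub : Set.pi Set.univ (fun _ : Fin n => Set.Ioo (0 : ℝ) (2 * Real.pi)) ⊆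
      Set.Icc (0 : Fin n → ℝ) (fun _ => 2 * Real.pi) := fun φ hφ =>
    ⟨fun i => (hφ i (Set.mem_univ i)).1.le, fun i => (hφ i (Set.mem_univ i)).2.le⟩
  have h3 := Measure.eqOn_open_of_ae_eq (ae_restrict_of_ae_restrict_of_subset hsub hint)
    (isOpen_set_pi Set.finite_univ fun _ _ => isOpen_Ioo) hgc.continuousOn continuousOn_const hθ
  have h4 := hgeq θ
  rw [h3, inv_torusPt, ← conj_psEval] at h4
  simp only [Pi.zero_apply, Complex.ofReal_zero, mul_eq_zero, map_eq_zero, or_self] at h4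
  exact h4.resolve_right (kerDelta_ne_zero hq ht0 ht1 (norm_torusPt_one θ) hinj)

end MacdonaldInt

end

/-! ### Integrating the kernel against a Macdonald polynomial -/

noncomputable section

namespace MacdonaldInt

open MvPolynomial MeasureTheory

/-! ### The kernel reproduces Macdonald functions -/

theorem hasSum_contour {ι κ : Type*} [Fintype ι] [Countable κ] {R : ι → ℝ}
    {F : κ → (ι → ℂ) → ℂ} {G : (ι → ℂ) → ℂ} {b : κ → ℝ} (hb : Summable b)
    (hF : ∀ k, Continuous fun θ => F k (torusPt R θ)) 
    (hFb : ∀ k, ∀ θ ∈ Set.Icc (0 : ι → ℝ) (fun _ => 2 * Real.pi), ‖F k (torusPt R θ)‖ ≤ b k)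
    (hG : ∀ θ, HasSum (fun k => F k (torusPt R θ)) (G (torusPt R θ))) :
    HasSum (fun k => contour R (F k)) (contour R G) := by
  simp only [contour_def]
  refine HasSum.mul_left _ (hasSum_integral_of_dominated_convergence (fun k _ => b k)
    (fun k => (integrableOn_torusPt (hF k)).aestronglyMeasurable)
    (fun k => ae_restrict_of_forall_mem measurableSet_Icc (hFb k)) (Filter.Eventually.of_forall fun _ => hb)
    ?_ (Filter.Eventually.of_forall hG))
  exact continuous_const.integrableOn_Icc

/-- As functionals of u, both products with P_λ vanish on all P_μ with μ ≠ λ. The P_μ span, so the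
two functionals are proportional, and u = P_λ gives the factor. -/
theorem torusInt_eigP_right {q t : ℝ} (hq : q ∈ Set.Ioo (0 : ℝ) 1) (ht0 : 0 < t) (ht1 : t < 1)
    (m : ℕ) (lam : Ptn) (u : PowSum) : torusInt q t m u (eigP q t lam) =
      pairing q t u (eigP q t lam) * (torusInt q t m (eigP q t lam) (eigP q t lam) /
        pairing q t (eigP q t lam) (eigP q t lam)) := by
  have h : (torusForm t m q).flip (eigP q t lam) =
      ((pairingForm q t).flip (eigP q t lam)).smulRight
        (torusInt q t m (eigP q t lam) (eigP q t lam) /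
          (pairing q t (eigP q t lam) (eigP q t lam) : ℂ)) := by
    refine LinearMap.ext_on_range (v := eigP q t) (span_eigP hq.1 hq.2 ht0 ht1) fun mu => ?_
    rw [LinearMap.flip_apply, torusForm_apply hq ht0 ht1, LinearMap.smulRight_apply,
      LinearMap.flip_apply, pairingForm_apply]
    by_cases hmu : mu = lam
    · subst hmu
      have : (pairing q t (eigP q t mu) (eigP q t mu) : ℂ) ≠ 0 := by
        exact_mod_cast (pairing_self_pos hq.1 hq.2 ht0 ht1 (eigP_ne_zero hq.1 hq.2 ht0 ht1 mu)).ne'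
      rw [Complex.real_smul, mul_div_cancel₀ _ this]
    · rw [torusInt_eigP_eq_zero hq ht0 ht1 m hmu, pairing_eigP_eq_zero hq.1 hq.2 ht0 ht1 hmu,
        zero_smul]
  have := LinearMap.congr_fun h u
  rwa [LinearMap.flip_apply, torusForm_apply hq ht0 ht1, LinearMap.smulRight_apply,
      LinearMap.flip_apply, pairingForm_apply, Complex.real_smul] at this

/-- Integrating the expansion of Π termwise gives ∑ z_k^{-1} p_k(x) times the torus product of p_k
and P_λ. By proportionality this is a constant times ∑ z_k^{-1} p_k(x) ⟨p_k, P_λ⟩. As ⟨p_k, P_λ⟩ is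
z_k times the coefficient of p_k, the sum is P_λ(x). -/
theorem contour_kerPi_of_lt_one {q t : ℝ} (hq : q ∈ Set.Ioo (0 : ℝ) 1) (ht0 : 0 < t) (ht1 : t < 1)
    {n m : ℕ} {x : Fin n → ℂ} (hx : ∀ i, ‖x i‖ < 1) (lam : Ptn) :
    contour (fun _ : Fin m => 1) (fun y =>
      kerPi q t x y⁻¹ * kerDelta q t y * psEval y (eigP q t lam)) =
      torusInt q t m (eigP q t lam) (eigP q t lam) / pairing q t (eigP q t lam) (eigP q t lam) *
        psEval x (eigP q t lam) := by
  have hX : ‖x‖ < 1 := (pi_norm_lt_iff one_pos).2 hx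
  have hinv : ∀ (θ : Fin m → ℝ) j, ‖(torusPt (fun _ => 1) θ)⁻¹ j‖ ≤ 1 := fun θ j => by
    rw [Pi.inv_apply, norm_inv, norm_torusPt_one, inv_one]
  have hX1 : ‖x‖ * 1 < 1 := by rwa [mul_one]
  have hcΔ : Continuous fun θ : Fin m → ℝ => (fun y => kerDelta q t y * psEval y (eigP q t lam))
      (torusPt (fun _ => 1) θ) :=
    (continuous_kerDelta hq ht0 ht1 m).mul ((continuous_psEval _).comp (continuous_torusPt _))
  obtain ⟨M, hM⟩ : ∃ M : ℝ, ∀ θ ∈ Set.Icc (0 : Fin m → ℝ) (fun _ => 2 * Real.pi),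
      ‖kerDelta q t (torusPt (fun _ => 1) θ) *
      psEval (torusPt (fun _ => 1) θ) (eigP q t lam)‖ ≤ M :=
    isCompact_Icc.exists_bound_of_continuousOn hcΔ.continuousOn
  have hsum := hasSum_contour (R := fun _ : Fin m => (1 : ℝ))
    (F := fun k y => kerTerm q t x y⁻¹ k * (kerDelta q t y * psEval y (eigP q t lam)))
    (G := fun y => kerPi q t x y⁻¹ * (kerDelta q t y * psEval y (eigP q t lam)))
    (b := fun k => kerBound q t n m (‖x‖ * 1) k * M)
    ((summable_kerBound hq ht0 ht1 n m (by positivity) hX1).mul_right M)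
    (fun k => (continuous_const.mul (continuous_const.mul ((continuous_psEval _).comp
      (continuous_inv_torusPt fun _ => one_pos)))).mul hcΔ)
    (fun k θ hθ => by
      rw [norm_mul]
      exact mul_le_mul (norm_kerTerm_le hq ht0 ht1 (norm_le_pi_norm x) (hinv θ) k) (hM θ hθ)
        (norm_nonneg _) ((norm_nonneg _).trans
          (norm_kerTerm_le hq ht0 ht1 (norm_le_pi_norm x) (hinv θ) k)))
    (fun θ => (hasSum_kerTerm hq ht0 ht1 (norm_le_pi_norm x) (hinv θ) (norm_nonneg _)
      zero_le_one hX1).mul_right _)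
  simp only [← mul_assoc] at hsum
  refine hsum.unique ?_
  have hterm : ∀ k, contour (fun _ : Fin m => 1) (fun y =>
      kerTerm q t x y⁻¹ k * kerDelta q t y * psEval y (eigP q t lam)) =
      torusInt q t m (eigP q t lam) (eigP q t lam) / pairing q t (eigP q t lam) (eigP q t lam) *
        psEval x (monomial k ((eigP q t lam).coeff k)) := fun k => by
    have hz : (zWeight q t k : ℂ) ≠ 0 := by
      exact_mod_cast (zWeight_pos hq.1 hq.2 ht0 ht1 k).ne'
    have h1 := torusInt_eigP_right hq ht0 ht1 m lam (monomial k 1)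
    rw [pairing_monomial_left, one_mul] at h1
    have h2 : psEval x (monomial k ((eigP q t lam).coeff k)) =
        (eigP q t lam).coeff k * psEval x (monomial k 1) := by
      rw [← Complex.real_smul, ← map_smul, smul_monomial, smul_eq_mul, mul_one]
    have h3 : contour (fun _ : Fin m => 1) (fun y =>
        kerTerm q t x y⁻¹ k * kerDelta q t y * psEval y (eigP q t lam)) =
        ((zWeight q t k)⁻¹ : ℝ) * psEval x (monomial k 1) *
          torusInt q t m (monomial k 1) (eigP q t lam) := by
      rw [torusInt, ← contour_const_mul]
      refine contour_congr fun θ => ?_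
      rw [kerTerm]
      ring
    rw [h3, h1, h2]
    push_cast
    field_simp
  simp only [hterm]
  refine HasSum.mul_left _ ?_
  conv => arg 2; rw [(eigP q t lam).as_sum, map_sum]
  refine hasSum_sum_of_ne_finset_zero fun k hk => ?_
  rw [notMem_support_iff.1 hk, monomial_zero, map_zero]

theorem aeval_mul_of_isHomogeneous {n d : ℕ} {φ : MvPolynomial (Fin n) ℝ} (h : φ.IsHomogeneous d)
    (c : ℂ) (x : Fin n → ℂ) : aeval (fun i => c * x i) φ = c ^ d * aeval x φ := by
  rw [aeval_def, aeval_def, eval₂_eq', eval₂_eq', Finset.mul_sum]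
  refine Finset.sum_congr rfl fun k hk => ?_
  have hd : ∑ i, k i = d := by
    rw [← Finsupp.degree_eq_sum, Finsupp.degree_eq_weight_one]
    exact h (mem_support_iff.1 hk)
  simp only [mul_pow]
  rw [Finset.prod_mul_distrib, Finset.prod_pow_eq_pow_sum, hd]
  ring

/-- The reproducing property of the kernel. -/
theorem contour_kerPi {q t : ℝ} (hq : q ∈ Set.Ioo (0 : ℝ) 1) (ht0 : 0 < t) (ht1 : t < 1)
    {n m : ℕ} {x : Fin n → ℂ} {R : ℝ} (hR : 0 < R) (hx : ∀ i, ‖x i‖ < R) (lam : Ptn) :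
    contour (fun _ : Fin m => R) (fun y =>
      kerPi q t x y⁻¹ * kerDelta q t y * psEval y (eigP q t lam)) =
      torusInt q t m (eigP q t lam) (eigP q t lam) / pairing q t (eigP q t lam) (eigP q t lam) *
        psEval x (eigP q t lam) := by
  have hR0 : (R : ℂ) ≠ 0 := by exact_mod_cast hR.ne'
  -- Radius R is reduced to radius 1 by scaling: Δ is invariant, Π depends only on the ratios
  -- x_i/y_j, and P_λ is homogeneous.
  have hscale : ∀ (k : ℕ) (z : Fin k → ℂ), psEval (fun i => R * z i) (eigP q t lam) =
      (R : ℂ) ^ lam.1.degree * psEval z (eigP q t lam) := fun k z => by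
    rw [← aeval_toVars, ← aeval_toVars, aeval_mul_of_isHomogeneous (isHomogeneous_eigP ht0 lam k)]
  have hpt : ∀ θ, torusPt (fun _ : Fin m => R) θ = fun i => R * torusPt (fun _ => 1) θ i :=
    fun θ => funext fun i => by simp [torusPt, circleMap]
  have hx' : ∀ i, ‖(R : ℂ)⁻¹ * x i‖ < 1 := fun i => by
    rw [norm_mul, norm_inv, Complex.norm_real, Real.norm_of_nonneg hR.le, inv_mul_lt_one₀ hR]
    exact hx i
  have h1 := contour_kerPi_of_lt_one hq ht0 ht1 (m := m) hx' lam
  have h2 : psEval x (eigP q t lam) =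
      (R : ℂ) ^ lam.1.degree * psEval (fun i => (R : ℂ)⁻¹ * x i) (eigP q t lam) := by
    rw [← hscale]
    simp only [mul_inv_cancel_left₀ hR0]
  rw [h2, mul_left_comm, ← h1, ← contour_const_mul]
  simp only [contour_def]
  refine congrArg _ (integral_congr_ae (Filter.Eventually.of_forall fun θ => ?_))
  simp only [hpt, hscale]
  have h3 : kerDelta q t (fun i => R * torusPt (fun _ : Fin m => (1 : ℝ)) θ i) =
      kerDelta q t (torusPt (fun _ => 1) θ) := by
    simp only [kerDelta, mul_div_mul_left _ _ hR0]
  have h4 : kerPi q t x (fun i => R * torusPt (fun _ : Fin m => (1 : ℝ)) θ i)⁻¹ =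
      kerPi q t (fun i => (R : ℂ)⁻¹ * x i) (torusPt (fun _ => 1) θ)⁻¹ := by
    have : ∀ i j, x i * (R * torusPt (fun _ : Fin m => (1 : ℝ)) θ j)⁻¹ =
        (R : ℂ)⁻¹ * x i * (torusPt (fun _ : Fin m => (1 : ℝ)) θ j)⁻¹ := fun i j => by
      rw [mul_inv]; ring
    simp only [kerPi, Pi.inv_apply, this]
  rw [h3, h4]
  ring

end MacdonaldInt

end

/-! ### Building λ one rectangle at a time -/

noncomputable section

namespace MacdonaldInt

open MvPolynomial MeasureTheory

/-! ### Iteration -/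

theorem toVars_eigP_zero {q t : ℝ} (hq : q ∈ Set.Ioo (0 : ℝ) 1) (ht0 : 0 < t) (ht1 : t < 1)
    (n : ℕ) : toVars n (eigP q t 0) = 1 := by
  classical
  have h1 := eigP_sub_mono_mem hq.1 hq.2 ht0 ht1 0
  have h2 : {mu | DomLT mu 0} = ∅ := by
    refine Set.eq_empty_of_forall_notMem fun mu hmu => hmu.1 (Subtype.ext ?_)
    exact (Finsupp.degree_eq_zero_iff _).1 (hmu.2.1.trans (map_zero _))
  rw [lowSpan, h2, Set.image_empty, Submodule.span_empty, Submodule.mem_bot, sub_eq_zero] at h1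
  have h3 : ∀ i : ℕ, (0 : Ptn).1 i = 0 := fun i => rfl
  rw [h1, toVars_mono, monomialSym, if_pos fun i _ => h3 i]
  simp only [h3]
  rw [show (fun (_ : Equiv.Perm (Fin n)) (_ : Fin n) => (0 : ℕ)) = fun _ => 0 from rfl,
    Finset.image_const Finset.univ_nonempty, Finset.sum_singleton]
  simp

theorem psEval_eigP_add_rect {q t : ℝ} (hq : q ∈ Set.Ioo (0 : ℝ) 1) (ht0 : 0 < t) (ht1 : t < 1)
    {lam : Ptn} {n : ℕ} (hl : HasLen lam n) (s : ℕ) (x : Fin n → ℂ) :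
    psEval x (eigP q t (lam + rect s n)) = (∏ i, x i ^ s) * psEval x (eigP q t lam) := by
  rw [← aeval_toVars, toVars_eigP_add_rect hq.1 hq.2 ht0 ht1 hl, map_mul, map_prod, aeval_toVars]
  simp only [map_pow, aeval_X]

theorem hasLen_sum_rect {N : ℕ} (r s : Fin N → ℕ) {m : ℕ} (h : ∀ a, r a ≤ m) :
    HasLen (∑ a, rect (s a) (r a)) m := by
  refine Finset.sum_induction _ (fun lam => HasLen lam m) (fun a b ha hb i hi => ?_)
    (fun i _ => rfl) fun a _ i hi => ?_
  · rw [ptn_add_apply, ha i hi, hb i hi]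
  · rw [rect_apply, if_neg (not_lt.2 ((h a).trans hi))]

/-- The constant contributed to `Cplus` by one partition. -/
def stepConst (q t : ℝ) (m : ℕ) (lam : Ptn) : ℂ :=
  pairing q t (eigP q t lam) (eigP q t lam) / torusInt q t m (eigP q t lam) (eigP q t lam)

/-- The factorial of r_a cancels the one in the normalization of ⟨ , ⟩', leaving the ratio of the
two norms. -/
theorem Cplus_succ {q t : ℝ} (hq : q ∈ Set.Ioo (0 : ℝ) 1) (ht0 : 0 < t) (ht1 : t < 1) {N : ℕ}
    (r s : Fin (N + 1) → ℕ) : Cplus q t r s =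
      Cplus q t (fun a => r a.castSucc) (fun a => s a.castSucc) *
        stepConst q t (r (Fin.last N)) (∑ a, rect (s a) (r a)) := by
  have h1 : partialPtn r s (Fin.last N) = ∑ a, rect (s a) (r a) := by
    rw [partialPtn, ← Fin.top_eq_last, Finset.Iic_top]
  have h2 : ∀ a : Fin N, partialPtn r s a.castSucc =
      partialPtn (fun a => r a.castSucc) (fun a => s a.castSucc) a := fun a => by
    rw [partialPtn, partialPtn, ← Fin.map_castSuccEmb_Iic, Finset.sum_map]
    rfl
  rw [Cplus, Fin.prod_univ_castSucc, Cplus]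
  simp only [h1, h2]
  refine congrArg _ ?_
  rw [macdonaldP_apply hq.1 hq.2 ht0 ht1, macdonaldP_eq hq.1 hq.2 ht0 ht1, scalar_toSymFun,
    scalar'_toVars, mul_inv_cancel_left₀ (by exact_mod_cast Nat.factorial_ne_zero _), stepConst]

/-- One step of the iteration. -/
theorem stepConst_mul_contour {q t : ℝ} (hq : q ∈ Set.Ioo (0 : ℝ) 1) (ht0 : 0 < t) (ht1 : t < 1)
    {n m : ℕ} {x : Fin n → ℂ} {R : ℝ} (hR : 0 < R) (hx : ∀ i, ‖x i‖ < R) {lam : Ptn}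
    (hl : HasLen lam m) (s : ℕ) :
    stepConst q t m (lam + rect s m) * contour (fun _ : Fin m => R) (fun y =>
      kerPi q t x y⁻¹ * kerDelta q t y * ((∏ i, y i ^ s) * psEval y (eigP q t lam))) =
      psEval x (eigP q t (lam + rect s m)) := by
  simp only [← psEval_eigP_add_rect hq ht0 ht1 hl]
  rw [contour_kerPi hq ht0 ht1 hR hx, stepConst, ← mul_assoc, div_mul_div_cancel₀, div_self,
    one_mul]
  · exact_mod_cast (pairing_self_pos hq.1 hq.2 ht0 ht1 (eigP_ne_zero hq.1 hq.2 ht0 ht1 _)).ne'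
  · exact torusInt_self_ne_zero hq ht0 ht1
      (toVars_eigP_ne_zero hq.1 hq.2 ht0 ht1 (hasLen_add_rect hl s))

/-- Induction on N, peeling off the outermost maps. Since the r_a increase, the partition built so
far has at most r_N parts, as required for adding the next rectangle. -/
theorem Cplus_mul_iterNG {q t : ℝ} (hq : q ∈ Set.Ioo (0 : ℝ) 1) (ht0 : 0 < t) (ht1 : t < 1) {N : ℕ}
    (r s : Fin N → ℕ) (hr : StrictMono r) (n : ℕ) (x : Fin n → ℂ) :
    Cplus q t r s * iterNG q t N r s n x = psEval x (eigP q t (∑ a, rect (s a) (r a))) := by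
  induction N generalizing n with
  | zero =>
    rw [Fin.sum_univ_zero, ← aeval_toVars, toVars_eigP_zero hq ht0 ht1, map_one]
    simp [Cplus, iterNG]
  | succ N ih =>
    have hl : HasLen (∑ a : Fin N, rect (s a.castSucc) (r a.castSucc)) (r (Fin.last N)) :=
      hasLen_sum_rect _ _ fun a => (hr (Fin.castSucc_lt_last a)).le
    have hx : ∀ i, ‖x i‖ < ‖x‖ + 1 := fun i => (norm_le_pi_norm x i).trans_lt (lt_add_one _)
    rw [Cplus_succ hq ht0 ht1, Fin.sum_univ_castSucc,
      ← stepConst_mul_contour hq ht0 ht1 (by positivity) hx hl, iterNG, opN, mul_comm (Cplus _ _ _ _),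
      mul_assoc, ← contour_const_mul]
    refine congrArg _ (contour_congr fun θ => ?_)
    -- The constant of the earlier steps has been moved under the integral, where it turns the inner
    -- iterate into a Macdonald polynomial at each integration point.
    rw [opG, ← ih _ _ fun a b h => hr (Fin.castSucc_lt_castSucc_iff.2 h)]
    ring

theorem nextVars_castSucc {N n : ℕ} {r : Fin (N + 1) → ℕ} (x : Fin n → ℂ)
    (X : ∀ a, Fin (r a) → ℂ) (a : Fin N) : nextVars x X a.castSucc =
      nextVars (r := fun a => r a.castSucc) (X (Fin.last N)) (fun a => X a.castSucc) a := by
  by_cases h : (a : ℕ) + 1 < N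
  · rw [nextVars, nextVars, dif_pos (show (a.castSucc : ℕ) + 1 < N + 1 by simp), dif_pos h]
    rfl
  · have h' : (a : ℕ) + 1 = N := by omega
    rw [nextVars, nextVars, dif_pos (show (a.castSucc : ℕ) + 1 < N + 1 by simp), dif_neg h]
    have : (⟨(a.castSucc : ℕ) + 1, by simp⟩ : Fin (N + 1)) = Fin.last N := Fin.ext h'
    rw [this]

theorem nextVars_last {N n : ℕ} {r : Fin (N + 1) → ℕ} (x : Fin n → ℂ)
    (X : ∀ a, Fin (r a) → ℂ) : nextVars x X (Fin.last N) = ⟨n, x⟩ :=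
  dif_neg (by simp)

theorem integrand_succ (q t : ℝ) {N n : ℕ} {r : Fin (N + 1) → ℕ} (s : Fin (N + 1) → ℕ)
    (x : Fin n → ℂ) (X : ∀ a, Fin (r a) → ℂ) : integrand q t s x X =
      kerPi q t x (X (Fin.last N))⁻¹ * kerDelta q t (X (Fin.last N)) *
        ((∏ j, X (Fin.last N) j ^ s (Fin.last N)) *
          integrand q t (r := fun a => r a.castSucc) (fun a => s a.castSucc) (X (Fin.last N))
            fun a => X a.castSucc) := by
  rw [integrand, Fin.prod_univ_castSucc, Fin.prod_univ_castSucc (n := N), integrand, nextVars_last]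
  have h : ∀ a : Fin N, kerPi q t (nextVars x X a.castSucc).2 (X a.castSucc)⁻¹ =
      kerPi q t (nextVars (r := fun a => r a.castSucc) (X (Fin.last N)) (fun a => X a.castSucc) a).2
        (X a.castSucc)⁻¹ := fun a => by rw [nextVars_castSucc]
  simp only [h]
  ring

theorem continuous_kerPi_comp {q t : ℝ} (hq : q ∈ Set.Ioo (0 : ℝ) 1) {T : Type*}
    [TopologicalSpace T] {n m : ℕ} {x : T → Fin n → ℂ} {y : T → Fin m → ℂ} (hx : Continuous x)
    (hy : Continuous y) (h : ∀ p i j, ‖x p i * y p j‖ < 1) :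
    Continuous fun p => kerPi q t (x p) (y p) := by
  have hxy : ∀ i j, Continuous fun p => x p i * y p j := fun i j =>
    ((continuous_apply i).comp hx).mul ((continuous_apply j).comp hy)
  refine continuous_finsetProd _ fun i _ => continuous_finsetProd _ fun j _ => Continuous.div ?_ ?_
    fun p => qPoch_ne_zero (h p i j) hq
  · exact (continuous_qPoch hq).comp (continuous_const.mul (hxy i j))
  · exact (continuous_qPoch hq).comp (hxy i j)

theorem continuous_kerDelta_comp {q t : ℝ} (hq : q ∈ Set.Ioo (0 : ℝ) 1) (ht0 : 0 < t) (ht1 : t < 1)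
    {T : Type*} [TopologicalSpace T] {m : ℕ} {R : ℝ} (hR : 0 < R) {y : T → Fin m → ℂ}
    (hy : Continuous y) (h : ∀ p j, ‖y p j‖ = R) : Continuous fun p => kerDelta q t (y p) := by
  simp only [kerDelta_eq]
  refine continuous_finsetProd _ fun e _ => continuous_hFun_comp hq ht0 ht1 ?_ fun p => ?_
  · refine ((continuous_apply e.1).comp hy).div ((continuous_apply e.2).comp hy) fun p h0 => ?_
    have := h p e.2
    rw [show y p e.2 = 0 from h0, norm_zero] at this
    exact hR.ne this
  · rw [norm_div, h, h, div_self hR.ne']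

/-- Decreasing radii keep every ratio x^{a+1}_i / x^a_j strictly inside the unit disc, away from the
poles of Π. This continuity is what Fubini needs. -/
theorem continuous_integrand {q t : ℝ} (hq : q ∈ Set.Ioo (0 : ℝ) 1) (ht0 : 0 < t) (ht1 : t < 1)
    {T : Type*} [TopologicalSpace T] {N n : ℕ} {r : Fin N → ℕ} (s : Fin N → ℕ) {ρ : Fin N → ℝ}
    (hρ : StrictAnti ρ) (hρ0 : ∀ a, 0 < ρ a) {x : T → Fin n → ℂ} (hx : Continuous x)
    (hxρ : ∀ p a i, ‖x p i‖ < ρ a) {X : T → ∀ a, Fin (r a) → ℂ} (hX : Continuous X)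
    (hXρ : ∀ p a j, ‖X p a j‖ = ρ a) : Continuous fun p => integrand q t s (x p) (X p) := by
  induction N generalizing n with
  | zero =>
    simp only [integrand, Finset.univ_eq_empty, Finset.prod_empty]
    exact continuous_const
  | succ N ih =>
    have hXa : ∀ a, Continuous fun p => X p a := fun a => (continuous_apply a).comp hX
    have h0 : ∀ p j, X p (Fin.last N) j ≠ 0 := fun p j h => by
      have := hXρ p (Fin.last N) j
      rw [h, norm_zero] at this
      exact (hρ0 _).ne this
    simp only [integrand_succ]
    refine Continuous.mul (Continuous.mul ?_ ?_) (Continuous.mul ?_ ?_)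
    · refine continuous_kerPi_comp hq hx (y := fun p => (X p (Fin.last N))⁻¹)
        (continuous_pi fun j => ((continuous_apply j).comp (hXa _)).inv₀ fun p => h0 p j)
        fun p i j => ?_
      rw [Pi.inv_apply, norm_mul, norm_inv, hXρ, ← div_eq_mul_inv, div_lt_one (hρ0 _)]
      exact hxρ _ _ _
    · exact continuous_kerDelta_comp hq ht0 ht1 (hρ0 (Fin.last N)) (hXa _) fun p j => hXρ p _ j
    · exact continuous_finsetProd _ fun j _ => ((continuous_apply j).comp (hXa _)).pow _
    · refine ih _ (fun a b h => hρ (Fin.castSucc_lt_castSucc_iff.2 h)) (fun a => hρ0 _) (hXa _)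
        (fun p a i => ?_) (continuous_pi fun a => hXa _) fun p a j => hXρ p _ j
      rw [hXρ]
      exact hρ (Fin.castSucc_lt_last a)

/-- Separation of the last set of variables. -/
def sigmaLastEquiv {N : ℕ} (r : Fin (N + 1) → ℕ) :
    (Σ a : Fin N, Fin (r a.castSucc)) ⊕ Fin (r (Fin.last N)) ≃ Σ a, Fin (r a) :=
  Equiv.ofBijective (Sum.elim (fun p => ⟨p.1.castSucc, p.2⟩) fun j => ⟨Fin.last N, j⟩) <| by
    constructor
    · rintro (⟨a, i⟩ | i) (⟨b, j⟩ | j) h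
      · simp only [Sum.elim_inl, Sigma.mk.injEq] at h
        obtain ⟨h1, h2⟩ := h
        obtain rfl := Fin.castSucc_injective _ h1
        rw [eq_of_heq h2]
      · exact absurd (congrArg Sigma.fst h) (Fin.castSucc_lt_last a).ne
      · exact absurd (congrArg Sigma.fst h) (Fin.castSucc_lt_last b).ne'
      · simp only [Sum.elim_inr, Sigma.mk.injEq, heq_eq_eq, true_and] at h
        rw [h]
    · rintro ⟨a, i⟩
      induction a using Fin.lastCases with
      | last => exact ⟨Sum.inr i, rfl⟩
      | cast a => exact ⟨Sum.inl ⟨a, i⟩, rfl⟩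

/-- Fubini with the last set of variables outermost, so that the inner integral has the same shape
with N sets of variables and with x replaced by the last set. -/
theorem contour_sigma_succ {N : ℕ} {r : Fin (N + 1) → ℕ} (ρ : Fin (N + 1) → ℝ)
    {F : (∀ a, Fin (r a) → ℂ) → ℂ}
    (hF : Continuous fun θ : (Σ a, Fin (r a)) → ℝ =>
      F fun a j => torusPt (fun p : Σ a, Fin (r a) => ρ p.1) θ ⟨a, j⟩) :
    contour (fun p : Σ a, Fin (r a) => ρ p.1) (fun X => F fun a j => X ⟨a, j⟩) =
      contour (fun _ : Fin (r (Fin.last N)) => ρ (Fin.last N)) fun y =>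
        contour (fun p : Σ a : Fin N, Fin (r a.castSucc) => ρ p.1.castSucc) fun X =>
          F (Fin.lastCases (motive := fun a => Fin (r a) → ℂ) y fun a j => X ⟨a, j⟩) := by
  have h1 : ∀ (a : Fin N) (j : Fin (r a.castSucc)),
      (sigmaLastEquiv r).symm ⟨a.castSucc, j⟩ = Sum.inl ⟨a, j⟩ := fun a j =>
    (Equiv.symm_apply_eq _).2 rfl
  have h2 : ∀ j : Fin (r (Fin.last N)), (sigmaLastEquiv r).symm ⟨Fin.last N, j⟩ = Sum.inr j :=
    fun j => (Equiv.symm_apply_eq _).2 rfl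
  rw [contour_reindex (sigmaLastEquiv r), contour_sumType]
  · refine contour_congr fun θ => contour_congr fun φ => congrArg F (funext fun a => ?_)
    induction a using Fin.lastCases with
    | last =>
      funext j
      rw [Fin.lastCases_last, Function.comp_apply, h2]
      rfl
    | cast a =>
      funext j
      rw [Fin.lastCases_castSucc, Function.comp_apply, h1]
      rfl
  · have hcomp : ∀ θ, torusPt ((fun p : Σ a, Fin (r a) => ρ p.1) ∘ sigmaLastEquiv r) θ ∘
        (sigmaLastEquiv r).symm = torusPt (fun p : Σ a, Fin (r a) => ρ p.1)
          (θ ∘ (sigmaLastEquiv r).symm) := fun θ => funext fun p => by simp [torusPt]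
    simp only [hcomp]
    exact hF.comp (continuous_pi fun p => continuous_apply _)

theorem Cplus_mul_contour {q t : ℝ} (hq : q ∈ Set.Ioo (0 : ℝ) 1) (ht0 : 0 < t) (ht1 : t < 1)
    {N : ℕ} (r s : Fin N → ℕ) (hr : StrictMono r) {ρ : Fin N → ℝ} (hρ : StrictAnti ρ)
    (hρ0 : ∀ a, 0 < ρ a) (n : ℕ) (x : Fin n → ℂ) (hx : ∀ a i, ‖x i‖ < ρ a) :
    Cplus q t r s * contour (fun p : Σ a : Fin N, Fin (r a) => ρ p.1)
      (fun X => integrand q t s x (fun a j => X ⟨a, j⟩)) =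
        psEval x (eigP q t (∑ a, rect (s a) (r a))) := by
  induction N generalizing n with
  | zero =>
    rw [Fin.sum_univ_zero, ← aeval_toVars, toVars_eigP_zero hq ht0 ht1, map_one, contour_isEmpty]
    simp [Cplus, integrand]
  | succ N ih =>
    have hl : HasLen (∑ a : Fin N, rect (s a.castSucc) (r a.castSucc)) (r (Fin.last N)) :=
      hasLen_sum_rect _ _ fun a => (hr (Fin.castSucc_lt_last a)).le
    rw [Cplus_succ hq ht0 ht1, Fin.sum_univ_castSucc,
      ← stepConst_mul_contour hq ht0 ht1 (hρ0 (Fin.last N)) (hx _) hl, contour_sigma_succ,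
      mul_comm (Cplus _ _ _ _), mul_assoc, ← contour_const_mul]
    · refine congrArg _ (contour_congr fun θ => ?_)
      -- The induction hypothesis is applied at a point of the last torus, admissible because its
      -- radius is the smallest.
      rw [← ih _ _ (fun a b h => hr (Fin.castSucc_lt_castSucc_iff.2 h))
        (ρ := fun a => ρ a.castSucc) (fun a b h => hρ (Fin.castSucc_lt_castSucc_iff.2 h))
        (fun a => hρ0 _) _ _ fun a i => ?_]
      · simp only [integrand_succ, Fin.lastCases_last, Fin.lastCases_castSucc, contour_const_mul]
        ring
      · rw [norm_torusPt (R := fun _ => ρ (Fin.last N)) _ (hρ0 _).le]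
        exact hρ (Fin.castSucc_lt_last a)
    · refine continuous_integrand hq ht0 ht1 s hρ hρ0 continuous_const (fun _ => hx)
        (continuous_pi fun a => continuous_pi fun j =>
          (continuous_apply (⟨a, j⟩ : Σ a, Fin (r a))).comp
            (continuous_torusPt fun p : Σ a, Fin (r a) => ρ p.1)) fun p a j => ?_
      exact norm_torusPt (R := fun p : Σ a, Fin (r a) => ρ p.1) _ (hρ0 _).le

end MacdonaldInt

end

theorem theorem3p2 (q t : ℝ) (hq0 : 0 < q) (hq1 : q < 1) (ht0 : 0 < t) (ht1 : t < 1) :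
    (∃! P : Ptn → SymFun, IsMacdonaldFamily q t P) ∧
    ∀ (N : ℕ) (r s : Fin N → ℕ), StrictMono r →
    ∀ (n : ℕ) (x : Fin n → ℂ),
      MvPolynomial.aeval x ((macdonaldP q t (∑ a, rect (s a) (r a))).1 n) =
          Cplus q t r s * iterNG q t N r s n x ∧
      ∀ ρ : Fin N → ℝ, StrictAnti ρ → (∀ a, 0 < ρ a) → (∀ a i, ‖x i‖ < ρ a) →
        MvPolynomial.aeval x ((macdonaldP q t (∑ a, rect (s a) (r a))).1 n) =
          Cplus q t r s *
            contour (fun p : Σ a : Fin N, Fin (r a) => ρ p.1)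
              (fun X => integrand q t s x (fun a j => X ⟨a, j⟩)) := by
  refine ⟨existsUnique_isMacdonaldFamily hq0 hq1 ht0 ht1, fun N r s hr n x => ?_⟩
  rw [macdonaldP_apply hq0 hq1 ht0 ht1, aeval_toVars]
  exact ⟨(Cplus_mul_iterNG ⟨hq0, hq1⟩ ht0 ht1 r s hr n x).symm, fun ρ hρ hρ0 hx =>
    (Cplus_mul_contour ⟨hq0, hq1⟩ ht0 ht1 r s hr hρ hρ0 n x hx).symm⟩
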